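/- **Setting.** Let $\Bbbk$ be a field of characteristic $0$, let $\mathbb G=\{\mathbb Z\to G\to\mathbb Z/2\}$ be a grading datum (homomorphisms of abelian groups with surjective composition; write $1\in G$ for the image of $1\in\mathbb Z$; Koszul signs come from $G\to\mathbb Z/2$), let $P$ be a finite set, $f:\mathbb Z^P\to G$ a homomorphism landing in the even part of $G$, and $\mathsf N\subset\mathbb R^P$ a strongly convex cone with vertex at the origin and non-empty interior. Let $\mathsf N^\vee\subset\mathbb R^P$ be the dual cone and $\widetilde R=\Bbbk[\mathsf N^\vee\cap\mathbb Z^P]$, with monomials $r^u$ of degree $f(u)$; let $\widetilde{\mathfrak m}$ be the span of the $r^u$ with $u\ne0$, and $R$ the $\widetilde{\mathfrak m}$-adic completion of $\widetilde R$ in the $G$-graded sense. Write $\mathfrak m^n\subset R$ for the completion of $\widetilde{\mathfrak m}^n$, and a subscript $0$ for the part of degree $0\in G$. Let $u_p$ be the $p$-th basis vector and $r_p=r^{u_p}$. Assume that $R$ is *nice*: for every $p\in P$, the element $r_p$ lies in $\mathfrak m$, generates the graded piece $\mathfrak m_{f(u_p)}$ as an $R_0$-module, and does not lie in $\mathfrak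 m^2$. (If the monoid $\mathsf N^\vee\cap\mathbb Z^P$ is finitely generated, e.g. if $\mathsf N$ is rational polyhedral, it is equivalent to ask that $r_p$ lies in $\mathfrak m$, generates $\widetilde{\mathfrak m}_{f(u_p)}$ as an $\widetilde R_0$-module and is not in $\mathfrak m^2$.) Let $\operatorname{Aut}(R)$ be the group of $G$-graded $\Bbbk$-algebra automorphisms of $R$ that respect the filtration $(\mathfrak m^n)$. **(1) Differential graded Lie algebras.** Let $(\mathfrak g,\partial,[\cdot,\cdot])$ be a differential $G$-graded Lie algebra over $\Bbbk$, and $\mathfrak g\,\widehat\otimes\,\mathfrak m$ the $\mathfrak m$-adic completion of $\mathfrak g\otimes\mathfrak m$ in the $G$-graded sense. Let $MC_{\mathfrak g}(R)$ be the set of $\alpha=\sum_u r^u\alpha_u\in(\mathfrak g\,\widehat\otimes\,\mathfrak m)_1$ with $\partial\alpha+\frac12[\alpha,\alpha]=0$; write $\alpha\sim\beta$ if $\beta=e^{\gamma}\cdot\alpha$ for some $\gamma\in(\mathfrak g\,\widehat\otimes\,\mathfrak m)_0$, where $e^{t\gamma}\cdot\alpha=\alpha_t$ solves $\frac{d}{dt}\alpha_t=-\partial\gamma+[\gamma,\alpha_t]$,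 $\alpha_0=\alpha$. Let $\mathsf a_p=[\alpha_{u_p}]\in H^\bullet(\mathfrak g)$, let $r_p\mathsf a_p\in H^1(\mathfrak g\otimes\widetilde{\mathfrak m})$ be the first-order deformation classes of $\alpha$, and let $MC'_{\mathfrak g}(R)\subset MC_{\mathfrak g}(R)$ be the subset of those elements whose first-order deformation classes span $H^1(\mathfrak g\otimes\widetilde{\mathfrak m}/\widetilde{\mathfrak m}^2)$. Let $\alpha\in MC_{\mathfrak g}(R)$ be such that the $r_p\mathsf a_p$ span $H^1(\mathfrak g\otimes\widetilde{\mathfrak m})$ as an $\widetilde R_0$-module. Then for every $\beta\in MC'_{\mathfrak g}(R)$ there are units $\psi_p$ of $R$ lying in $R_0$ and $\psi^*\in\operatorname{Aut}(R)$ with $\psi^*(r^u)=r^u\prod_p\psi_p^{u(p)}$ for all $u$ (in particular $r_p\mapsto r_p\psi_p$), such that $\beta\sim\psi^*\alpha$. In particular $\alpha$ is $R$-complete: for every $\beta\in MC'_{\mathfrak g}(R)$ there is $\psi^*\in\operatorname{Aut}(R)$ with $\beta\sim\psi^*\alpha$. If furthermore $\mathsf a_p\neq0$ for all $p$, then $\alpha$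 is $R$-versal: it is $R$-complete, and for every $\beta\in MC'_{\mathfrak g}(R)$, any two $\psi^*\in\operatorname{Aut}(R)$ with $\beta\sim\psi^*\alpha$ induce the same map $\mathfrak m/\mathfrak m^2\to\mathfrak m/\mathfrak m^2$. **(2) $A_\infty$ categories.** Let $\mathcal A=(A,\mu)$ be a $G$-graded $\Bbbk$-linear (uncurved) $A_\infty$ category with shifted Hochschild complex $CC^\bullet(\mathcal A)[1]$. A deformation of $\mathcal A$ over $R$ is an $R$-linear, possibly curved $A_\infty$ structure $\mu+\sum_{u\ne0}r^u\alpha_u$ on $A\,\widehat\otimes\,R$ with $\sum_u r^u\alpha_u\in(CC^\bullet(\mathcal A)[1]\,\widehat\otimes\,\mathfrak m)_1$; its first-order deformation classes are $r_p\mathsf a_p$, $\mathsf a_p=[\alpha_{u_p}]$. Let $\mathcal A_R$ be a deformation whose classes $r_p\mathsf a_p$ span $HH^2(\mathcal A,\mathcal A\otimes\widetilde{\mathfrak m})=H^1(CC^\bullet(\mathcal A)[1]\otimes\widetilde{\mathfrak m})$ as an $\widetilde R_0$-module. Then for every deformation $\mathcal B_R$ of $\mathcal A$ whose first-order deformation classes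 span $HH^2(\mathcal A,\mathcal A\otimes\widetilde{\mathfrak m}/\widetilde{\mathfrak m}^2)$ there are $\psi^*\in\operatorname{Aut}(R)$ of the form described in (1) and a possibly curved $R$-linear $A_\infty$ functor $F:\mathcal B_R\dashrightarrow\psi^*\mathcal A_R$ with $F\equiv\mathrm{id}$ mod $\mathfrak m$ (given by an element of degree $0$ of $CC^\bullet(\mathcal A)[1]\,\widehat\otimes\,R$). In particular $\mathcal A_R$ is $R$-complete (for every such $\mathcal B_R$ there are $\psi^*\in\operatorname{Aut}(R)$ and such an $F$). If furthermore $\mathsf a_p\ne0$ for all $p$, then $\mathcal A_R$ is $R$-versal: it is $R$-complete, and for each such $\mathcal B_R$ the map $\mathfrak m/\mathfrak m^2\to\mathfrak m/\mathfrak m^2$ induced by $\psi^*$ is the same for all $\psi^*\in\operatorname{Aut}(R)$ for which such an $F$ exists. -/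

import Mathlib

/-- A grading datum `ℤ → G → ℤ/2`: homomorphisms of abelian groups with surjective composition. -/
structure GradingDatum (G : Type*) [AddCommGroup G] where
  ι : ℤ →+ G
  σ : G →+ ZMod 2
  surj : Function.Surjective (σ.comp ι)

/-- The Koszul sign `(-1)^a`. -/
def koszul (a : ZMod 2) : ℤ := (-1) ^ a.val

/-! ### The total algebra of a monoid in which every element has finitely many decompositions -/

/-- All formal sums `∑ c_u r^u`, with `u` in the monoid `M`. -/
def FormalSums (k M : Type*) := M → k

set_option linter.unusedSectionVars false

namespace FormalSums

variable {k M : Type*} [CommRing k] [AddCommMonoid M] [Finset.HasAntidiagonal M]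

noncomputable instance : AddCommGroup (FormalSums k M) := inferInstanceAs (AddCommGroup (M → k))

noncomputable instance : Module k (FormalSums k M) := inferInstanceAs (Module k (M → k))

noncomputable instance : Mul (FormalSums k M) :=
  ⟨fun c d u => ∑ x ∈ Finset.HasAntidiagonal.antidiagonal u, c x.1 * d x.2⟩

open scoped Classical in
noncomputable instance : One (FormalSums k M) := ⟨fun u => if u = 0 then 1 else 0⟩

theorem mul_apply (c d : FormalSums k M) (u : M) :
    (c * d) u = ∑ x ∈ Finset.HasAntidiagonal.antidiagonal u, c x.1 * d x.2 := rfl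

open scoped Classical in
theorem one_apply (u : M) : (1 : FormalSums k M) u = if u = 0 then 1 else 0 := rfl

theorem add_apply (c d : FormalSums k M) (u : M) : (c + d) u = c u + d u := rfl

theorem smul_apply (a : k) (c : FormalSums k M) (u : M) : (a • c) u = a * c u := rfl

theorem zero_apply (u : M) : (0 : FormalSums k M) u = 0 := rfl

protected theorem mul_comm (c d : FormalSums k M) : c * d = d * c := by
  funext u
  rw [FormalSums.mul_apply, FormalSums.mul_apply]
  refine Finset.sum_bij' (fun x _ => x.swap) (fun x _ => x.swap) ?_ ?_ (fun _ _ => rfl)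
    (fun _ _ => rfl) (fun x _ => _root_.mul_comm _ _)
  · intro x hx
    exact Finset.HasAntidiagonal.mem_antidiagonal.2
      ((add_comm _ _).trans (Finset.HasAntidiagonal.mem_antidiagonal.1 hx))
  · intro x hx
    exact Finset.HasAntidiagonal.mem_antidiagonal.2
      ((add_comm _ _).trans (Finset.HasAntidiagonal.mem_antidiagonal.1 hx))

protected theorem one_mul (c : FormalSums k M) : 1 * c = c := by
  classical
  funext u
  rw [FormalSums.mul_apply, Finset.sum_eq_single (0, u)]
  · simp [FormalSums.one_apply]
  · rintro ⟨v, w⟩ hx hne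
    have h : v + w = u := Finset.HasAntidiagonal.mem_antidiagonal.1 hx
    have : v ≠ 0 := by
      rintro rfl
      exact hne (by rw [← h, zero_add])
    simp [FormalSums.one_apply, this]
  · intro h
    exact absurd (Finset.HasAntidiagonal.mem_antidiagonal.2 (zero_add u)) h

protected theorem mul_assoc (c d e : FormalSums k M) : c * d * e = c * (d * e) := by
  classical
  funext u
  simp only [FormalSums.mul_apply, Finset.sum_mul, Finset.mul_sum]
  rw [Finset.sum_sigma', Finset.sum_sigma']
  refine Finset.sum_bij' (fun x _ => ⟨(x.2.1, x.2.2 + x.1.2), (x.2.2, x.1.2)⟩)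
    (fun x _ => ⟨(x.1.1 + x.2.1, x.2.2), (x.1.1, x.2.1)⟩) ?_ ?_ ?_ ?_ ?_
  · rintro ⟨⟨a, b⟩, ⟨a', b'⟩⟩ h
    simp only [Finset.mem_sigma, Finset.HasAntidiagonal.mem_antidiagonal] at h ⊢
    exact ⟨by rw [← h.1, ← h.2, add_assoc], trivial⟩
  · rintro ⟨⟨a, b⟩, ⟨a', b'⟩⟩ h
    simp only [Finset.mem_sigma, Finset.HasAntidiagonal.mem_antidiagonal] at h ⊢
    exact ⟨by rw [← h.1, ← h.2, add_assoc], trivial⟩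
  · rintro ⟨⟨a, b⟩, ⟨a', b'⟩⟩ h
    simp only [Finset.mem_sigma, Finset.HasAntidiagonal.mem_antidiagonal] at h
    obtain ⟨rfl, rfl⟩ := h
    rfl
  · rintro ⟨⟨a, b⟩, ⟨a', b'⟩⟩ h
    simp only [Finset.mem_sigma, Finset.HasAntidiagonal.mem_antidiagonal] at h
    obtain ⟨rfl, rfl⟩ := h
    rfl
  · rintro ⟨⟨a, b⟩, ⟨a', b'⟩⟩ h
    exact _root_.mul_assoc _ _ _

protected theorem add_mul (c d e : FormalSums k M) : (c + d) * e = c * e + d * e := by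
  funext u
  simp only [FormalSums.mul_apply, FormalSums.add_apply, _root_.add_mul, Finset.sum_add_distrib]

protected theorem zero_mul (c : FormalSums k M) : 0 * c = 0 := by
  funext u
  simp [FormalSums.mul_apply, FormalSums.zero_apply]

noncomputable instance : CommRing (FormalSums k M) :=
  { (inferInstance : AddCommGroup (FormalSums k M)) with
    mul := (· * ·)
    one := 1
    mul_comm := FormalSums.mul_comm
    mul_assoc := FormalSums.mul_assoc
    one_mul := FormalSums.one_mul
    mul_one := fun c => by rw [FormalSums.mul_comm, FormalSums.one_mul]
    zero_mul := FormalSums.zero_mul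
    mul_zero := fun c => by rw [FormalSums.mul_comm, FormalSums.zero_mul]
    right_distrib := FormalSums.add_mul
    left_distrib := fun c d e => by
      rw [FormalSums.mul_comm, FormalSums.add_mul, FormalSums.mul_comm d, FormalSums.mul_comm e] }

theorem smul_mul (a : k) (c d : FormalSums k M) : (a • c) * d = a • (c * d) := by
  funext u
  simp only [FormalSums.mul_apply, FormalSums.smul_apply, Finset.mul_sum, _root_.mul_assoc]

noncomputable instance : Algebra k (FormalSums k M) :=
  Algebra.ofModule smul_mul fun a c d => by rw [_root_.mul_comm, smul_mul, _root_.mul_comm]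

end FormalSums

/-! ### The coefficient ring -/

/-- The data defining the coefficient ring: a homomorphism `f : ℤ^P → G` landing in the even part
of `G`, and a strongly convex cone `N ⊆ ℝ^P` with vertex at the origin and non-empty interior. -/
structure ToricDatum {G : Type*} [AddCommGroup G] (𝔾 : GradingDatum G)
    (P : Type*) [Fintype P] where
  f : (P → ℤ) →+ G
  f_even : ∀ u, 𝔾.σ (f u) = 0
  N : PointedCone ℝ (P → ℝ)
  strongly_convex : ∀ x ∈ N, -x ∈ N → x = 0
  full : (interior (N : Set (P → ℝ))).Nonempty

namespace ToricDatum

variable {G : Type*} [AddCommGroup G] {𝔾 : GradingDatum G} {P : Type*} [Fintype P]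

/-- The monoid `N^∨ ∩ ℤ^P`. -/
def monoid (T : ToricDatum 𝔾 P) : AddSubmonoid (P → ℤ) where
  carrier := {u | ∀ x ∈ T.N, 0 ≤ ∑ p, x p * (u p : ℝ)}
  zero_mem' := fun x _ => by simp
  add_mem' := fun {u v} hu hv x hx => by
    have := add_nonneg (hu x hx) (hv x hx)
    simpa [mul_add, Finset.sum_add_distrib] using this

theorem finite_decompositions (T : ToricDatum 𝔾 P) (w : T.monoid) :
    {x : T.monoid × T.monoid | x.1 + x.2 = w}.Finite := by
  classical
  obtain ⟨x, hx⟩ := T.full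
  obtain ⟨ε, hε, hball⟩ := Metric.mem_nhds_iff.1 (mem_interior_iff_mem_nhds.1 hx)
  set ℓ : T.monoid → ℝ := fun u => ∑ p, x p * ((u : P → ℤ) p : ℝ) with hℓ
  have hxN : x ∈ T.N := interior_subset hx
  have key : ∀ (u : T.monoid) (p : P) (s : ℝ), |s| < ε → 0 ≤ ℓ u + s * ((u : P → ℤ) p : ℝ) := by
    intro u p s hs
    have hmem : x + Pi.single p s ∈ T.N := by
      apply hball
      rw [Metric.mem_ball, dist_eq_norm, add_sub_cancel_left]
      rw [pi_norm_lt_iff hε]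
      intro q
      by_cases h : q = p
      · subst h; simpa using hs
      · simp [h, hε]
    have := u.2 _ hmem
    simpa [hℓ, add_mul, Finset.sum_add_distrib, Pi.single_apply] using this
  have hbound : ∀ (u : T.monoid) (p : P), ε / 2 * |((u : P → ℤ) p : ℝ)| ≤ ℓ u := by
    intro u p
    have hε2 : |ε / 2| < ε := by rw [abs_of_pos (by linarith)]; linarith
    have h1 := key u p (ε / 2) hε2
    have h2 := key u p (-(ε / 2)) (by rwa [abs_neg])
    rcases abs_cases ((u : P → ℤ) p : ℝ) with ⟨h, _⟩ | ⟨h, _⟩ <;> rw [h] <;> linarith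
  obtain ⟨B, hB⟩ := exists_nat_ge (2 / ε * ℓ w)
  have hfin : {u : T.monoid | (u : P → ℤ) ∈ Set.Icc (fun _ => -(B : ℤ)) (fun _ => (B : ℤ))}.Finite :=
    (Set.finite_Icc _ _).preimage Subtype.val_injective.injOn
  have hle : ∀ u v : T.monoid, u + v = w →
      (u : P → ℤ) ∈ Set.Icc (fun _ => -(B : ℤ)) (fun _ => (B : ℤ)) := by
    intro u v huv
    have hsum : ℓ u + ℓ v = ℓ w := by
      rw [← huv]
      simp [hℓ, mul_add, Finset.sum_add_distrib]
    have hv : 0 ≤ ℓ v := v.2 x hxN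
    have hb : ∀ p, |(u : P → ℤ) p| ≤ (B : ℤ) := by
      intro p
      have h1 : ε / 2 * |((u : P → ℤ) p : ℝ)| ≤ ℓ w := (hbound u p).trans (by linarith)
      have h2 : |((u : P → ℤ) p : ℝ)| ≤ 2 / ε * ℓ w := by
        have h3 : |((u : P → ℤ) p : ℝ)| = 2 / ε * (ε / 2 * |((u : P → ℤ) p : ℝ)|) := by
          field_simp
        rw [h3]
        exact mul_le_mul_of_nonneg_left h1 (by positivity)
      exact_mod_cast h2.trans hB
    exact ⟨fun p => (abs_le.1 (hb p)).1, fun p => (abs_le.1 (hb p)).2⟩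
  refine (hfin.prod hfin).subset ?_
  rintro ⟨u, v⟩ h
  exact ⟨hle u v h, hle v u ((add_comm v u).trans h)⟩

noncomputable instance (T : ToricDatum 𝔾 P) : Finset.HasAntidiagonal T.monoid where
  antidiagonal w := (T.finite_decompositions w).toFinset
  mem_antidiagonal := by simp

/-- `u ∈ T.filt n` if `u` is a sum of an element of the monoid and of `n` non-zero elements, i.e.
if the monomial `r^u` lies in `m̃ ^ n`, where `m̃` is spanned by the `r^u` with `u ≠ 0`. -/
def filt (T : ToricDatum 𝔾 P) : ℕ → Set T.monoid
  | 0 => Set.univ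
  | n + 1 => {u | ∃ v ∈ T.filt n, ∃ w : T.monoid, w ≠ 0 ∧ v + w = u}

theorem filt_add (T : ToricDatum 𝔾 P) (n : ℕ) {u : T.monoid} (hu : u ∈ T.filt n) (v : T.monoid) :
    u + v ∈ T.filt n := by
  induction n generalizing u with
  | zero => exact Set.mem_univ _
  | succ n ih =>
    obtain ⟨a, ha, b, hb, rfl⟩ := hu
    exact ⟨a + v, ih ha, b, hb, add_right_comm a v b⟩

/-- The coefficient ring `R`: the `m̃`-adic completion of `R̃ = k[N^∨ ∩ ℤ^P]` in the `G`-graded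
sense. As `m̃ ^ n` is spanned by monomials, its elements are the formal sums of monomials that have
finitely many terms modulo each `m̃ ^ n` and whose terms have finitely many different degrees. -/
def ring (k : Type*) [Field k] (T : ToricDatum 𝔾 P) : Subalgebra k (FormalSums k T.monoid) where
  carrier := {c | (∀ n, {u | u ∉ T.filt n ∧ c u ≠ 0}.Finite) ∧
    ((fun u : T.monoid => T.f u) '' {u | c u ≠ 0}).Finite}
  mul_mem' := by
    rintro c d ⟨hc, hc'⟩ ⟨hd, hd'⟩
    have hsup : ∀ w, (c * d) w ≠ 0 → ∃ u v, u + v = w ∧ c u ≠ 0 ∧ d v ≠ 0 := by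
      intro w hw
      rw [FormalSums.mul_apply] at hw
      obtain ⟨x, hx, hne⟩ := Finset.exists_ne_zero_of_sum_ne_zero hw
      exact ⟨x.1, x.2, Finset.HasAntidiagonal.mem_antidiagonal.1 hx, left_ne_zero_of_mul hne,
        right_ne_zero_of_mul hne⟩
    refine ⟨fun n => ?_, ?_⟩
    · refine (((hc n).prod (hd n)).image fun x => x.1 + x.2).subset ?_
      rintro w ⟨hw, hne⟩
      obtain ⟨u, v, rfl, hu, hv⟩ := hsup w hne
      exact ⟨(u, v), ⟨⟨fun h => hw (T.filt_add n h v), hu⟩,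
        ⟨fun h => hw (add_comm u v ▸ T.filt_add n h u), hv⟩⟩, rfl⟩
    · refine ((hc'.prod hd').image fun x => x.1 + x.2).subset ?_
      rintro _ ⟨w, hne, rfl⟩
      obtain ⟨u, v, rfl, hu, hv⟩ := hsup w hne
      exact ⟨(T.f u, T.f v), ⟨⟨u, hu, rfl⟩, ⟨v, hv, rfl⟩⟩, (map_add T.f _ _).symm⟩
  add_mem' := by
    rintro c d ⟨hc, hc'⟩ ⟨hd, hd'⟩
    have hsup : ∀ w, (c + d) w ≠ 0 → c w ≠ 0 ∨ d w ≠ 0 := by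
      intro w hw
      by_contra! h
      exact hw (by rw [FormalSums.add_apply, h.1, h.2, add_zero])
    refine ⟨fun n => ((hc n).union (hd n)).subset ?_, (hc'.union hd').subset ?_⟩
    · rintro w ⟨hw, hne⟩
      exact (hsup w hne).imp (fun h => ⟨hw, h⟩) (fun h => ⟨hw, h⟩)
    · rintro _ ⟨w, hne, rfl⟩
      exact (hsup w hne).imp (fun h => ⟨w, h, rfl⟩) (fun h => ⟨w, h, rfl⟩)
  algebraMap_mem' := by
    intro a
    have hsup : ∀ w, (algebraMap k (FormalSums k T.monoid) a) w ≠ 0 → w = 0 := by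
      intro w hw
      by_contra h
      exact hw (by rw [Algebra.algebraMap_eq_smul_one, FormalSums.smul_apply,
        FormalSums.one_apply, if_neg h, mul_zero])
    refine ⟨fun n => (Set.finite_singleton 0).subset fun w hw => hsup w hw.2,
      (Set.finite_singleton (T.f 0)).subset ?_⟩
    rintro _ ⟨w, hw, rfl⟩
    rw [hsup w hw]
    rfl

/-- The coefficient of `r^u` in an element of `R`. -/
def coeff {k : Type*} [Field k] {T : ToricDatum 𝔾 P} (u : T.monoid) (c : T.ring k) : k :=
  (c : FormalSums k T.monoid) u

open scoped Classical in
/-- The monomial `r^u`. -/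
noncomputable def mono (k : Type*) [Field k] (T : ToricDatum 𝔾 P) (u : T.monoid) : T.ring k :=
  ⟨fun v => if v = u then 1 else 0, by
    have hsup : ∀ w, (if w = u then (1 : k) else 0) ≠ 0 → w = u := by
      intro w hw
      by_contra h
      exact hw (if_neg h)
    refine ⟨fun n => (Set.finite_singleton u).subset fun w hw => hsup w hw.2,
      (Set.finite_singleton (T.f u)).subset ?_⟩
    rintro _ ⟨w, hw, rfl⟩
    rw [hsup w hw]
    rfl⟩

/-- The graded piece `R_y`. -/
def piece (k : Type*) [Field k] (T : ToricDatum 𝔾 P) (y : G) : Submodule k (T.ring k) where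
  carrier := {c | ∀ u, coeff u c ≠ 0 → T.f u = y}
  zero_mem' := fun _ h => absurd rfl h
  add_mem' := by
    intro c d hc hd u hu
    by_contra h
    have h1 : coeff u c = 0 := by_contra fun h' => h (hc u h')
    have h2 : coeff u d = 0 := by_contra fun h' => h (hd u h')
    exact hu (show coeff u c + coeff u d = 0 by rw [h1, h2, add_zero])
  smul_mem' := by
    intro a c hc u hu
    exact hc u fun h => hu (show a * coeff u c = 0 by rw [h, mul_zero])

/-- The `n`-th step `m ^ n` of the `m`-adic filtration of `R`, i.e. the completion of `m̃ ^ n`.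
In particular `m = T.adic k 1`. -/
def adic (k : Type*) [Field k] (T : ToricDatum 𝔾 P) (n : ℕ) : Submodule k (T.ring k) where
  carrier := {c | ∀ u, coeff u c ≠ 0 → u ∈ T.filt n}
  zero_mem' := fun _ h => absurd rfl h
  add_mem' := by
    intro c d hc hd u hu
    by_contra h
    have h1 : coeff u c = 0 := by_contra fun h' => h (hc u h')
    have h2 : coeff u d = 0 := by_contra fun h' => h (hd u h')
    exact hu (show coeff u c + coeff u d = 0 by rw [h1, h2, add_zero])
  smul_mem' := by
    intro a c hc u hu
    exact hc u fun h => hu (show a * coeff u c = 0 by rw [h, mul_zero])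

/-- `Aut(R)`: the group of `G`-graded `k`-algebra automorphisms of `R` that respect the `m`-adic
filtration. -/
def aut (k : Type*) [Field k] (T : ToricDatum 𝔾 P) : Subgroup (T.ring k ≃ₐ[k] T.ring k) where
  carrier := {ψ | (∀ y c, ψ c ∈ T.piece k y ↔ c ∈ T.piece k y) ∧
    ∀ n c, ψ c ∈ T.adic k n ↔ c ∈ T.adic k n}
  one_mem' := ⟨fun _ _ => Iff.rfl, fun _ _ => Iff.rfl⟩
  mul_mem' := by
    rintro ψ χ ⟨h1, h2⟩ ⟨h3, h4⟩
    exact ⟨fun y c => (h1 y (χ c)).trans (h3 y c), fun n c => (h2 n (χ c)).trans (h4 n c)⟩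
  inv_mem' := by
    rintro ψ ⟨h1, h2⟩
    refine ⟨fun y c => ?_, fun n c => ?_⟩
    · have h := h1 y (ψ⁻¹ c)
      rw [show ψ (ψ⁻¹ c) = c from ψ.apply_symm_apply c] at h
      exact h.symm
    · have h := h2 n (ψ⁻¹ c)
      rw [show ψ (ψ⁻¹ c) = c from ψ.apply_symm_apply c] at h
      exact h.symm

/-- `ψ` is the automorphism attached to `(c_p) ∈ (R_0^*)^P`:
`∏ r_p ^ a_p ↦ ∏ r_p ^ a_p · ∏ c_p ^ a_p`. In particular `r_p ↦ r_p · c_p`. -/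
def IsRescaling {k : Type*} [Field k] {T : ToricDatum 𝔾 P} (ψ : T.ring k ≃ₐ[k] T.ring k)
    (c : P → (T.ring k)ˣ) : Prop :=
  (∀ p, (c p : T.ring k) ∈ T.piece k 0) ∧
    ∀ u : T.monoid, ψ (T.mono k u) =
      T.mono k u * ((∏ p, c p ^ (u : P → ℤ) p : (T.ring k)ˣ) : T.ring k)

/-- The ring `R` is *nice* if, for all `p`: `r_p` lies in `m`, and generates the graded piece
`m_{f(u_p)}` as an `R_0`-module; and `r_p ∉ m ^ 2`. (Here `u_p` is the `p`-th basis vector and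
`r_p = r^{u_p}`; a non-zero element of the monoid gives a monomial in `m`.) -/
structure IsNice [DecidableEq P] (k : Type*) [Field k] (T : ToricDatum 𝔾 P) : Prop where
  mem : ∀ p, (Pi.single p 1 : P → ℤ) ∈ T.monoid
  gen : ∀ p, ∀ x ∈ T.adic k 1, x ∈ T.piece k (T.f (Pi.single p 1)) →
    ∃ c ∈ T.piece k 0, x = c * T.mono k ⟨Pi.single p 1, mem p⟩
  notMem_sq : ∀ p, T.mono k ⟨Pi.single p 1, mem p⟩ ∉ T.adic k 2

theorem finite_notMem_filt (T : ToricDatum 𝔾 P) (hfg : AddMonoid.FG T.monoid) (n : ℕ) :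
    {u | u ∉ T.filt n}.Finite := by
  obtain ⟨S, hS⟩ := hfg.fg_top
  have key : ∀ u : T.monoid, u = 0 ∨ ∃ v, ∃ s ∈ S, s ≠ 0 ∧ v + s = u := by
    intro u
    have hu : u ∈ AddSubmonoid.closure (S : Set T.monoid) := hS ▸ AddSubmonoid.mem_top u
    induction hu using AddSubmonoid.closure_induction with
    | mem s hs =>
      by_cases h : s = 0
      · exact Or.inl h
      · exact Or.inr ⟨0, s, hs, h, zero_add s⟩
    | zero => exact Or.inl rfl
    | add a b _ _ ha hb =>
      rcases hb with rfl | ⟨v, s, hs, h0, rfl⟩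
      · simpa using ha
      · exact Or.inr ⟨a + v, s, hs, h0, add_assoc a v s⟩
  induction n with
  | zero => simp [filt]
  | succ n ih =>
    refine (((ih.prod S.finite_toSet).image fun x => x.1 + x.2).union
      (Set.finite_singleton 0)).subset fun u hu => ?_
    rcases key u with rfl | ⟨v, s, hs, h0, rfl⟩
    · exact Or.inr rfl
    · exact Or.inl ⟨(v, s), ⟨fun hv => hu ⟨v, hv, s, h0, rfl⟩, hs⟩, rfl⟩

theorem zero_notMem_filt_one (T : ToricDatum 𝔾 P) : (0 : T.monoid) ∉ T.filt 1 := by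
  rintro ⟨v, -, w, hw, hvw⟩
  have hinf : (Set.range fun n : ℕ => ((n • w, n • v) : T.monoid × T.monoid)).Infinite := by
    refine Set.infinite_range_of_injective fun a b hab => ?_
    have h2 : a • w = b • w := congrArg Prod.fst hab
    have h3 : a • (w : P → ℤ) = b • (w : P → ℤ) := congrArg Subtype.val h2
    have hw1 : (w : P → ℤ) ≠ 0 := fun h => hw (Subtype.ext h)
    obtain ⟨q, hq⟩ := Function.ne_iff.1 hw1
    have h4 := congrFun h3 q
    simp only [Pi.smul_apply, nsmul_eq_mul] at h4
    exact_mod_cast mul_right_cancel₀ hq h4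
  refine hinf ((T.finite_decompositions 0).subset ?_)
  rintro _ ⟨n, rfl⟩
  change n • w + n • v = 0
  rw [← nsmul_add, add_comm w v, hvw, nsmul_zero]

/-- If the monoid is finitely generated (for example, if `N` is rational polyhedral), then it is
enough to check niceness before completion: `r_p ∈ m̃` generates the graded piece `m̃_{f(u_p)}` as an
`R̃_0`-module, and is not in `m̃ ^ 2`. -/
theorem isNice_of_fg [DecidableEq P] (k : Type*) [Field k] (T : ToricDatum 𝔾 P)
    (hfg : AddMonoid.FG T.monoid) (mem : ∀ p, (Pi.single p 1 : P → ℤ) ∈ T.monoid)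
    (gen : ∀ p, ∀ u : T.monoid, u ≠ 0 → T.f u = T.f (Pi.single p 1) →
      ∃ v : T.monoid, T.f v = 0 ∧ v + ⟨Pi.single p 1, mem p⟩ = u)
    (notMem_sq : ∀ p, (⟨Pi.single p 1, mem p⟩ : T.monoid) ∉ T.filt 2) : T.IsNice k := by
  classical
  refine ⟨mem, fun p x hx hxp => ?_, fun p h => notMem_sq p (h _ ?_)⟩
  · set e : T.monoid := ⟨Pi.single p 1, mem p⟩ with he
    let c : T.ring k := ⟨fun v => if T.f v = 0 then coeff (v + e) x else 0,
      fun n => (T.finite_notMem_filt hfg n).subset fun v hv => hv.1,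
      (Set.finite_singleton 0).subset (by
        rintro _ ⟨v, hv, rfl⟩
        by_contra h
        exact hv (if_neg h))⟩
    refine ⟨c, fun v hv => by_contra fun h => hv (if_neg h), Subtype.ext (funext fun u => ?_)⟩
    change coeff u x = ∑ y ∈ Finset.HasAntidiagonal.antidiagonal u,
      (if T.f y.1 = 0 then coeff (y.1 + e) x else 0) * (if y.2 = e then 1 else 0)
    by_cases hu : coeff u x = 0
    · rw [hu, Finset.sum_eq_zero]
      intro y hy
      have hy' := Finset.HasAntidiagonal.mem_antidiagonal.1 hy
      by_cases h : y.2 = e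
      · rw [← h, hy', hu]
        simp
      · simp [h]
    · have hu0 : u ≠ 0 := by
        rintro rfl
        exact T.zero_notMem_filt_one (hx 0 hu)
      obtain ⟨v, hv, hve⟩ := gen p u hu0 (hxp u hu)
      rw [← he] at hve
      clear_value c e
      rw [Finset.sum_eq_single (v, e)]
      · simp [hv, hve]
      · rintro ⟨a, b⟩ hy hne
        have hy' : a + b = v + e := (Finset.HasAntidiagonal.mem_antidiagonal.1 hy).trans hve.symm
        have hb : b ≠ e := by
          intro hb
          rw [hb] at hy'
          exact hne (by rw [hb, add_right_cancel hy'])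
        simp [hb]
      · intro h
        exact absurd (Finset.HasAntidiagonal.mem_antidiagonal.2 hve) h
  · simp [coeff, mono]

/-- The exponent `u_p` of `r_p`, as an element of `N^∨ ∩ ℤ^P`. -/
def IsNice.u [DecidableEq P] {k : Type*} [Field k] {T : ToricDatum 𝔾 P} (h : T.IsNice k) (p : P) :
    T.monoid := ⟨Pi.single p 1, h.mem p⟩

/-! ### Completed tensor products -/

section Completed

variable {k : Type*} [Field k] {L : Type*} [AddCommGroup L] [Module k L]

/-- `x = ∑ r^u · x_u` is an element of degree `y` of `V ⊗̂ R`, the `G`-graded `m`-adic completion,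
where `V` is the graded space with pieces `gr y`: the coefficient `x_u` has degree `y - f(u)`, and
there are finitely many terms modulo each `m ^ n`. -/
def MemTensorR (T : ToricDatum 𝔾 P) (gr : G → Submodule k L) (y : G) (x : T.monoid → L) : Prop :=
  (∀ u : T.monoid, x u ∈ gr (y - T.f u)) ∧ ∀ n, {u | u ∉ T.filt n ∧ x u ≠ 0}.Finite

/-- `x` is an element of degree `y` of `V ⊗̂ m`. -/
def MemTensorM (T : ToricDatum 𝔾 P) (gr : G → Submodule k L) (y : G) (x : T.monoid → L) : Prop :=
  T.MemTensorR gr y x ∧ x 0 = 0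

/-- The action of an endomorphism `ψ` of `R` on the coefficients: `∑ r^u x_u ↦ ∑ ψ(r^u) x_u`.
The sum below has finitely many non-zero terms when `ψ` respects the `m`-adic filtration and `x`
lies in a completed tensor product. -/
noncomputable def push {T : ToricDatum 𝔾 P} (ψ : T.ring k ≃ₐ[k] T.ring k) (x : T.monoid → L) :
    T.monoid → L :=
  fun w => ∑ᶠ u, coeff w (ψ (T.mono k u)) • x u

/-- Let `V` be a `G`-graded complex with graded pieces `gr y ⊆ L` and differential `d y` on `gr y`,
and let `W` be the subquotient of `R̃` with monomial basis `r^u`, `u ∈ S` (used for `W = m̃` and for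
`W = m̃ / m̃ ^ 2`). Given cocycles `a p` and exponents `e p`, the classes `r^{e p} · [a p]` span
`H^1(V ⊗ W)` as an `R̃_0`-module: every cocycle `z` of degree `1` is, up to the coboundary of an
element `b` of degree `0`, a combination `∑ φ_p · r^{e p} · a p` with `φ_p ∈ R̃_0`. -/
def SpansH1 (T : ToricDatum 𝔾 P) (gr : G → Submodule k L) (d : G → L → L) (S : Set T.monoid)
    (e : P → T.monoid) (a : P → L) : Prop :=
  ∀ z : T.monoid →₀ L, (∀ u ∈ z.support, u ∈ S) → (∀ u : T.monoid, z u ∈ gr (𝔾.ι 1 - T.f u)) →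
    (∀ u : T.monoid, d (𝔾.ι 1 - T.f u) (z u) = 0) →
    ∃ (φ : P → T.monoid →₀ k) (b : T.monoid →₀ L),
      (∀ p, ∀ v : T.monoid, φ p v ≠ 0 → T.f v = 0) ∧
      (∀ u : T.monoid, b u ∈ gr (0 - T.f u)) ∧
      ∀ u ∈ S, z u = (∑ p, ∑ᶠ (v : T.monoid) (_ : v + e p = u), φ p v • a p) + d (0 - T.f u) (b u)

end Completed

end ToricDatum

/-! ### Differential graded Lie algebras and the Maurer–Cartan equation -/

/-- A differential `G`-graded Lie algebra structure on `L`. -/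
structure DGLA (k : Type*) [Field k] {G : Type*} [AddCommGroup G] [DecidableEq G]
    (𝔾 : GradingDatum G) (L : Type*) [AddCommGroup L] [Module k L] where
  gr : G → Submodule k L
  internal : DirectSum.IsInternal gr
  d : L →ₗ[k] L
  d_mem : ∀ y, ∀ x ∈ gr y, d x ∈ gr (y + 𝔾.ι 1)
  d_d : ∀ x, d (d x) = 0
  br : L →ₗ[k] L →ₗ[k] L
  br_mem : ∀ y z, ∀ a ∈ gr y, ∀ b ∈ gr z, br a b ∈ gr (y + z)
  br_symm : ∀ y z, ∀ a ∈ gr y, ∀ b ∈ gr z, br a b = -(koszul (𝔾.σ y * 𝔾.σ z) • br b a)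
  jacobi : ∀ y z, ∀ a ∈ gr y, ∀ b ∈ gr z, ∀ c,
    br a (br b c) = br (br a b) c + koszul (𝔾.σ y * 𝔾.σ z) • br b (br a c)
  leibniz : ∀ y, ∀ a ∈ gr y, ∀ b, d (br a b) = br (d a) b + koszul (𝔾.σ y) • br a (d b)

namespace DGLA

variable {k : Type*} [Field k] {G : Type*} [AddCommGroup G] [DecidableEq G] {𝔾 : GradingDatum G}
  {P : Type*} [Fintype P] {L : Type*} [AddCommGroup L] [Module k L]

/-- The bracket on `g ⊗̂ m` (no signs appear, as `R` is even). -/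
noncomputable def brT (𝔤 : DGLA k 𝔾 L) (T : ToricDatum 𝔾 P) (x y : T.monoid → L) : T.monoid → L :=
  fun u => ∑ v ∈ Finset.HasAntidiagonal.antidiagonal u, 𝔤.br (x v.1) (y v.2)

/-- `MC_g(R)`: elements `α` of degree `1` of `g ⊗̂ m` with `∂α + ½[α, α] = 0`. -/
def MC (𝔤 : DGLA k 𝔾 L) (T : ToricDatum 𝔾 P) : Set (T.monoid → L) :=
  {α | T.MemTensorM 𝔤.gr (𝔾.ι 1) α ∧ ∀ u, 𝔤.d (α u) + (2 : k)⁻¹ • 𝔤.brT T α α u = 0}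

/-- The coefficients of the power series solution `α_t = ∑ tⁿ α_n` of `dα_t/dt = -∂γ + [γ, α_t]`
with `α_0 = α`. -/
noncomputable def flowCoeff (𝔤 : DGLA k 𝔾 L) (T : ToricDatum 𝔾 P) (γ α : T.monoid → L) :
    ℕ → T.monoid → L
  | 0 => α
  | n + 1 => fun u => ((n : k) + 1)⁻¹ •
      ((if n = 0 then -𝔤.d (γ u) else 0) + 𝔤.brT T γ (𝔤.flowCoeff T γ α n) u)

/-- The gauge action `e^γ · α`: the solution at time `1`. For `γ, α` in `g ⊗̂ m` the `n`-th
coefficient is of order `m ^ n`, so that every coefficient of the sum is a finite sum. -/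
noncomputable def gauge (𝔤 : DGLA k 𝔾 L) (T : ToricDatum 𝔾 P) (γ α : T.monoid → L) :
    T.monoid → L :=
  fun u => ∑ᶠ n, 𝔤.flowCoeff T γ α n u

/-- `α ∼ β`: `β = e^γ · α` for some `γ` of degree `0` in `g ⊗̂ m`. -/
def GaugeEquiv (𝔤 : DGLA k 𝔾 L) (T : ToricDatum 𝔾 P) (α β : T.monoid → L) : Prop :=
  ∃ γ, T.MemTensorM 𝔤.gr 0 γ ∧ β = 𝔤.gauge T γ α

variable [DecidableEq P] {T : ToricDatum 𝔾 P}

/-- The classes `r_p · [α_{u_p}]` span `H^1(g ⊗ m̃)` as an `R̃_0`-module. -/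
def FirstOrderSpans (𝔤 : DGLA k 𝔾 L) (hR : T.IsNice k) (α : T.monoid → L) : Prop :=
  T.SpansH1 𝔤.gr (fun _ => 𝔤.d) (T.filt 1) hR.u fun p => α (hR.u p)

/-- `MC'_g(R)`: the Maurer–Cartan elements whose first-order deformation classes span
`H^1(g ⊗ m̃ / m̃ ^ 2)`. -/
def MC' (𝔤 : DGLA k 𝔾 L) (hR : T.IsNice k) : Set (T.monoid → L) :=
  {β | β ∈ 𝔤.MC T ∧
    T.SpansH1 𝔤.gr (fun _ => 𝔤.d) (T.filt 1 \ T.filt 2) hR.u fun p => β (hR.u p)}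

/-- The class `a_p = [α_{u_p}]` in cohomology is non-zero. -/
def FirstOrderNeZero (𝔤 : DGLA k 𝔾 L) (hR : T.IsNice k) (α : T.monoid → L) (p : P) : Prop :=
  ¬ ∃ b ∈ 𝔤.gr (0 - T.f (hR.u p)), 𝔤.d b = α (hR.u p)

/-- `α` is `R`-complete. -/
def RComplete (𝔤 : DGLA k 𝔾 L) (hR : T.IsNice k) (α : T.monoid → L) : Prop :=
  ∀ β ∈ 𝔤.MC' hR, ∃ ψ ∈ T.aut k, 𝔤.GaugeEquiv T β (ToricDatum.push ψ α)

/-- `α` is `R`-versal: it is `R`-complete, and for each `β` the map `m / m ^ 2 → m / m ^ 2`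
induced by `ψ` is uniquely determined. -/
def RVersal (𝔤 : DGLA k 𝔾 L) (hR : T.IsNice k) (α : T.monoid → L) : Prop :=
  𝔤.RComplete hR α ∧
    ∀ β ∈ 𝔤.MC' hR, ∀ ψ ∈ T.aut k, ∀ ψ' ∈ T.aut k,
      𝔤.GaugeEquiv T β (ToricDatum.push ψ α) → 𝔤.GaugeEquiv T β (ToricDatum.push ψ' α) →
      ∀ x ∈ T.adic k 1, ψ x - ψ' x ∈ T.adic k 2

end DGLA

/-! ### `A_∞` categories, Hochschild cochains and deformations -/

/-- Composable chains of morphisms `(a_1, …, a_s)`, with `a_i ∈ H L_{i-1} L_i`. -/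
inductive MorChain {Ob : Type*} (H : Ob → Ob → Type*) : Ob → Ob → Type _
  | nil (X : Ob) : MorChain H X X
  | cons {X Y Z : Ob} (a : H X Y) (c : MorChain H Y Z) : MorChain H X Z

namespace MorChain

variable {Ob : Type*} {H : Ob → Ob → Type*}

def append {X Y Z : Ob} : MorChain H X Y → MorChain H Y Z → MorChain H X Z
  | nil _, c => c
  | cons a b, c => cons a (append b c)

/-- Apply a map to each entry. -/
def map (τ : ∀ X Y, H X Y → H X Y) {X Y : Ob} : MorChain H X Y → MorChain H X Y
  | nil X => nil X
  | cons a c => cons (τ _ _ a) (map τ c)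

/-- All ways to cut a chain into two consecutive (possibly empty) parts. -/
def splits {X Z : Ob} : MorChain H X Z → List (Σ Y, MorChain H X Y × MorChain H Y Z)
  | nil X => [⟨X, nil X, nil X⟩]
  | cons a c => ⟨_, nil _, cons a c⟩ :: (splits c).map fun s => ⟨s.1, cons a s.2.1, s.2.2⟩

end MorChain

/-- Families of maps `(a_1, …, a_s) ↦ φ(a_1, …, a_s) ∈ H L_0 L_s`, for all `s ≥ 0` and all objects
`L_0, …, L_s`, without any conditions yet. -/
abbrev Cochain {Ob : Type*} (H : Ob → Ob → Type*) := ∀ X Y, MorChain H X Y → H X Y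

/-- The cochain whose component of length `1` is the identity, and whose other components are
zero. -/
def idCochain {Ob : Type*} (H : Ob → Ob → Type*) [∀ X Y, AddCommGroup (H X Y)] : Cochain H
  | _, _, .cons a (.nil _) => a
  | _, _, _ => 0

/-- A `G`-graded pre-category with objects `Ob`: a `G`-grading of each morphism space. -/
structure PreCat (k : Type*) [Field k] {G : Type*} [AddCommGroup G] [DecidableEq G]
    (𝔾 : GradingDatum G) {Ob : Type*} (H : Ob → Ob → Type*)
    [∀ X Y, AddCommGroup (H X Y)] [∀ X Y, Module k (H X Y)] where
  gr : ∀ X Y, G → Submodule k (H X Y)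
  internal : ∀ X Y, DirectSum.IsInternal (gr X Y)

namespace PreCat

variable {k : Type*} [Field k] {G : Type*} [AddCommGroup G] [DecidableEq G] {𝔾 : GradingDatum G}
  {Ob : Type*} {H : Ob → Ob → Type*} [∀ X Y, AddCommGroup (H X Y)] [∀ X Y, Module k (H X Y)]

/-- The linear map `a ↦ (-1)^(|a| - 1) a` on morphism spaces. -/
noncomputable def shiftSign (C : PreCat k 𝔾 H) (X Y : Ob) : H X Y →ₗ[k] H X Y :=
  (DirectSum.toModule k G (H X Y) fun y => koszul (𝔾.σ y + 1) • (C.gr X Y y).subtype) ∘ₗ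
    (LinearEquiv.ofBijective (DirectSum.coeLinearMap (C.gr X Y)) (C.internal X Y)).symm.toLinearMap

/-- The Koszul sign `(-1)^(ε · (|a_1|' + … + |a_s|'))`, where `|a|' = |a| - 1`, distributed over the
entries of a chain. -/
noncomputable def sign (C : PreCat k 𝔾 H) (ε : ZMod 2) {X Y : Ob} (c : MorChain H X Y) :
    MorChain H X Y :=
  if ε = 0 then c else c.map fun X Y => C.shiftSign X Y

/-- The chain consists of homogeneous elements, of shifted degrees `|a_i| - 1` with sum `t`. -/
inductive Homog (C : PreCat k 𝔾 H) : ∀ {X Y : Ob}, MorChain H X Y → G → Prop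
  | nil (X : Ob) : Homog C (.nil X) 0
  | cons {X Y Z : Ob} (a : H X Y) (c : MorChain H Y Z) (g t : G) (ha : a ∈ C.gr X Y g)
      (hc : Homog C c t) : Homog C (.cons a c) (g - 𝔾.ι 1 + t)

/-- The piece of degree `y` of the shifted Hochschild cochains `CC^•(C)[1]`: multilinear families
that have degree `y` with respect to the shifted gradings of the morphism spaces. -/
def CC (C : PreCat k 𝔾 H) (y : G) : Submodule k (Cochain H) where
  carrier := {φ |
    (∀ {X Y Z W : Ob} (c : MorChain H X Y) (c' : MorChain H Z W),
      IsLinearMap k fun a : H Y Z => φ _ _ (c.append (.cons a c'))) ∧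
    ∀ {X Y : Ob} (c : MorChain H X Y) (t : G), C.Homog c t → φ X Y c ∈ C.gr X Y (t + y + 𝔾.ι 1)}
  zero_mem' := ⟨fun _ _ => ⟨fun _ _ => (add_zero _).symm, fun a _ => (smul_zero a).symm⟩,
    fun _ _ _ => Submodule.zero_mem _⟩
  add_mem' := by
    rintro φ χ ⟨h1, h2⟩ ⟨h3, h4⟩
    refine ⟨fun c c' => ⟨fun a b => ?_, fun r a => ?_⟩,
      fun c t hc => Submodule.add_mem _ (h2 c t hc) (h4 c t hc)⟩
    · simp only [Pi.add_apply, (h1 c c').map_add, (h3 c c').map_add]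
      abel
    · simp only [Pi.add_apply, (h1 c c').map_smul, (h3 c c').map_smul, smul_add]
  smul_mem' := by
    rintro r φ ⟨h1, h2⟩
    refine ⟨fun c c' => ⟨fun a b => ?_, fun s a => ?_⟩,
      fun c t hc => Submodule.smul_mem _ r (h2 c t hc)⟩
    · simp only [Pi.smul_apply, (h1 c c').map_add, smul_add]
    · simp only [Pi.smul_apply, (h1 c c').map_smul, smul_comm r s]

/-- The Gerstenhaber product `φ ∘ χ`, for `χ` of parity `ε` in the shifted Hochschild complex:
`∑ (-1)^(ε · (|a_1|' + … + |a_i|')) φ(a_1, …, a_i, χ(a_{i+1}, …, a_j), a_{j+1}, …, a_s)`. -/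
noncomputable def circ (C : PreCat k 𝔾 H) (ε : ZMod 2) (φ χ : Cochain H) : Cochain H :=
  fun X Y c => (c.splits.map fun s => (s.2.2.splits.map fun t =>
    φ X Y ((C.sign ε s.2.1).append (.cons (χ _ _ t.2.1) t.2.2))).sum).sum

end PreCat

/-- A `G`-graded `k`-linear `A_∞` category. -/
structure AInfCat (k : Type*) [Field k] {G : Type*} [AddCommGroup G] [DecidableEq G]
    (𝔾 : GradingDatum G) {Ob : Type*} (H : Ob → Ob → Type*)
    [∀ X Y, AddCommGroup (H X Y)] [∀ X Y, Module k (H X Y)] extends PreCat k 𝔾 H where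
  μ : Cochain H
  μ_mem : μ ∈ toPreCat.CC (𝔾.ι 1)
  μ_circ_μ : toPreCat.circ 1 μ μ = 0
  uncurved : ∀ X, μ X X (.nil X) = 0

/-- A chain cut into consecutive (possibly empty) parts, each labelled by an element of `M`. -/
inductive Pieces (M : Type*) {Ob : Type*} (H : Ob → Ob → Type*) : Ob → Ob → Type _
  | nil (X : Ob) : Pieces M H X X
  | cons {X Y Z : Ob} (w : M) (c : MorChain H X Y) (r : Pieces M H Y Z) : Pieces M H X Z

namespace Pieces

variable {M : Type*} {Ob : Type*} {H : Ob → Ob → Type*}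

/-- The chain that has been cut. -/
def chain {X Y : Ob} : Pieces M H X Y → MorChain H X Y
  | nil X => .nil X
  | cons _ c r => c.append (chain r)

/-- The sum of the labels. -/
def weight [AddCommMonoid M] {X Y : Ob} : Pieces M H X Y → M
  | nil _ => 0
  | cons w _ r => w + weight r

/-- The chain `(F_{w_1}(c_1), …, F_{w_r}(c_r))`, for parts `c_i` with labels `w_i`. -/
def apply (F : M → Cochain H) {X Y : Ob} : Pieces M H X Y → MorChain H X Y
  | nil X => .nil X
  | cons w c r => .cons (F w _ _ c) (apply F r)

end Pieces

namespace AInfCat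

variable {k : Type*} [Field k] {G : Type*} [AddCommGroup G] [DecidableEq G] {𝔾 : GradingDatum G}
  {Ob : Type*} {H : Ob → Ob → Type*} [∀ X Y, AddCommGroup (H X Y)] [∀ X Y, Module k (H X Y)]
  {P : Type*} [Fintype P]

/-- The Hochschild differential `[μ, φ] = μ ∘ φ - (-1)^|φ|' φ ∘ μ` on cochains `φ` of degree `y`
in `CC^•(A)[1]`. -/
noncomputable def hochschildD (A : AInfCat k 𝔾 H) (y : G) (φ : Cochain H) : Cochain H :=
  A.circ (𝔾.σ y) A.μ φ - koszul (𝔾.σ y) • A.circ 1 φ A.μ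

open scoped Classical in
/-- The structure maps `μ + ∑ r^u α_u`. -/
noncomputable def total (A : AInfCat k 𝔾 H) {T : ToricDatum 𝔾 P} (α : T.monoid → Cochain H) :
    T.monoid → Cochain H :=
  fun u => (if u = 0 then A.μ else 0) + α u

/-- The deformations of `A` over `R`: the `α ∈ CC^•(A)[1] ⊗̂ m` of degree `1` for which `μ + α` is
a (possibly curved) `R`-linear `A_∞` structure on `A ⊗̂ R`. -/
def Deformations (A : AInfCat k 𝔾 H) (T : ToricDatum 𝔾 P) : Set (T.monoid → Cochain H) :=
  {α | T.MemTensorM A.CC (𝔾.ι 1) α ∧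
    ∀ u, ∑ v ∈ Finset.HasAntidiagonal.antidiagonal u, A.circ 1 (A.total α v.1) (A.total α v.2) = 0}

/-- `F = ∑ r^u F_u` is a (possibly curved) `R`-linear `A_∞` functor from `(A ⊗̂ R, μ + β)` to
`(A ⊗̂ R, μ + α)`, with `F ≡ id` modulo `m`. It acts as the identity on objects, and
`∑ (μ + α)(F(…), …, F(…)) = ∑ ± F(…, (μ + β)(…), …)`. The parts on the left may be empty, but as
`F` is the identity modulo `m`, the sum has finitely many non-zero terms. -/
def IsFunctor (A : AInfCat k 𝔾 H) {T : ToricDatum 𝔾 P} (β α : T.monoid → Cochain H)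
    (F : T.monoid → Cochain H) : Prop :=
  T.MemTensorR A.CC 0 F ∧ F 0 = idCochain H ∧
    ∀ (u : T.monoid) (X Y : Ob) (c : MorChain H X Y),
      ∑ᶠ (x : T.monoid × Pieces T.monoid H X Y) (_ : x.2.chain = c ∧ x.1 + x.2.weight = u),
        A.total α x.1 X Y (x.2.apply F) =
      ∑ v ∈ Finset.HasAntidiagonal.antidiagonal u, A.circ 1 (F v.1) (A.total β v.2) X Y c

variable [DecidableEq P] {T : ToricDatum 𝔾 P}

/-- The first-order deformation classes `r_p · [α_{u_p}]` span
`HH^2(A, A ⊗ m̃) = H^1(CC^•(A)[1] ⊗ m̃)` as an `R̃_0`-module. -/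
def FirstOrderSpans (A : AInfCat k 𝔾 H) (hR : T.IsNice k) (α : T.monoid → Cochain H) : Prop :=
  T.SpansH1 A.CC A.hochschildD (T.filt 1) hR.u fun p => α (hR.u p)

/-- The deformations whose first-order deformation classes span `HH^2(A, A ⊗ m̃ / m̃ ^ 2)`. -/
def Deformations' (A : AInfCat k 𝔾 H) (hR : T.IsNice k) : Set (T.monoid → Cochain H) :=
  {β | β ∈ A.Deformations T ∧
    T.SpansH1 A.CC A.hochschildD (T.filt 1 \ T.filt 2) hR.u fun p => β (hR.u p)}

/-- The class `a_p = [α_{u_p}]` in Hochschild cohomology is non-zero. -/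
def FirstOrderNeZero (A : AInfCat k 𝔾 H) (hR : T.IsNice k) (α : T.monoid → Cochain H) (p : P) :
    Prop :=
  ¬ ∃ b ∈ A.CC (0 - T.f (hR.u p)), A.hochschildD (0 - T.f (hR.u p)) b = α (hR.u p)

/-- The deformation `α` is `R`-complete. -/
def RComplete (A : AInfCat k 𝔾 H) (hR : T.IsNice k) (α : T.monoid → Cochain H) : Prop :=
  ∀ β ∈ A.Deformations' hR, ∃ ψ ∈ T.aut k, ∃ F, A.IsFunctor β (ToricDatum.push ψ α) F

/-- The deformation `α` is `R`-versal. -/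
def RVersal (A : AInfCat k 𝔾 H) (hR : T.IsNice k) (α : T.monoid → Cochain H) : Prop :=
  A.RComplete hR α ∧
    ∀ β ∈ A.Deformations' hR, ∀ ψ ∈ T.aut k, ∀ ψ' ∈ T.aut k,
      (∃ F, A.IsFunctor β (ToricDatum.push ψ α) F) →
      (∃ F, A.IsFunctor β (ToricDatum.push ψ' α) F) →
      ∀ x ∈ T.adic k 1, ψ x - ψ' x ∈ T.adic k 2

end AInfCat

set_option linter.unusedSectionVars false

open Finset.HasAntidiagonal

/-! Both halves of the theorem are one obstruction argument. An equivalence x from β to a is a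
solution of a system d x_u + a_u + W_u(β, x, a) = 0, one equation per monomial r^u, in which W_u
involves x and a only at monomials strictly dividing r^u; `DeformationTheory` collects the formal
properties that are needed. As the cone has interior, a monomial has finitely many divisors, so
strict divisibility is well founded (`sdvd_wf`) and the system can be solved recursively. The
unknowns are x and the units ψ_p, with a = ∑ r^u ψ^u α_u.

Suppose the equations hold at all strict divisors of r^u. Then a_u + W_u is a cocycle, by a Bianchi
identity, and as the r_p a_p span H^1 it is cohomologous to a combination of those α_{u_p} with u =
u_p + v and f(v) = 0. In a nice ring the r_p are irreducible with pairwise different degrees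
(`IsNice.eq_of_f_u`), so a single p occurs. For v ≠ 0 the coefficient of r^v in ψ_p enters at u only
through its multiple of α_{u_p}, and not at all at strict divisors of u (`twist_unitsOf_congr`), so
it can be chosen to make the obstruction exact. The constant terms of the ψ_p are fixed beforehand:
the two spanning hypotheses make β_{u_p} cohomologous to a non-zero multiple of α_{u_p}
(`exists_scale`).

The solution must also lie in the completion. All choices are made so that zero data give zero; the
supports then stay in a locally finite submonoid generated by the supports of α and β, the u_p, and
quotients by the r_p (`IsNice.exists_submonoids`). Niceness of the completed ring is what makes
these quotients locally finite.

For versality, every filtered graded automorphism is itself a rescaling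
(`IsNice.exists_isRescaling`), and its effect on m/m^2 depends only on the constant terms of its
units. The equation at u_p says that β_{u_p} is cohomologous to that constant times α_{u_p}, which
determines the constant when a_p ≠ 0.

It remains to verify the formal properties. For a differential graded Lie algebra the equation is a
= e^x·β; the gauge flow preserves the Maurer–Cartan equation because the curvature satisfies a
linear differential equation (`curvature_flow_eq_zero`). For A_∞ categories the functor is F = id +
x. In bar notation, let F̂ be the coalgebra map and α̂, β̂ the coderivations defined by F and the
structure maps. Then `pull` is composition with F̂, `ins` is composition with a coderivation, and
the equation is the vanishing of the curvature αF̂ - Fβ̂. The identity `curv_cocycle` comes from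
α̂F̂ - F̂β̂ being a coderivation along F̂ together with αα̂ = 0 and β̂β̂ = 0, and `curv_sub_curv`
identifies the linear part of the curvature with the Hochschild differential. -/

/-- A dependent recursion along a well-founded relation, stated for a step function that is defined
on all families but only depends on the values at smaller arguments. -/
theorem WellFounded.exists_fixed {α : Type*} {r : α → α → Prop} (wf : WellFounded r)
    {X : α → Type*} [∀ a, Nonempty (X a)] (F : (∀ a, X a) → ∀ a, X a)
    (hF : ∀ x y a, (∀ b, r b a → x b = y b) → F x a = F y a) : ∃ x, ∀ a, x a = F x a := by
  classical
  let x : ∀ a, X a := wf.fix fun a ih => F (fun b => if h : r b a then ih b h else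
    Classical.arbitrary _) a
  refine ⟨x, fun a => ?_⟩
  have : x a = F (fun b => if h : r b a then x b else Classical.arbitrary _) a :=
    wf.fix_eq _ a
  rw [this]
  exact hF _ _ _ fun b hb => by simp [hb]

/-- Both sides run over all quadruples of exponents with sum u; the bijection transposes the 2×2
array. It separates the monomials from the powers of units in a product of two rescaled sums. -/
theorem sum_antidiagonal_four {M N : Type*} [AddCommMonoid M] [Finset.HasAntidiagonal M]
    [AddCommMonoid N] (F : M → M → M → M → N) (u : M) :
    ∑ x ∈ antidiagonal u, ∑ i ∈ antidiagonal x.1, ∑ j ∈ antidiagonal x.2,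
        F i.1 i.2 j.1 j.2 =
      ∑ x ∈ antidiagonal u, ∑ i ∈ antidiagonal x.1, ∑ j ∈ antidiagonal x.2,
        F i.1 j.1 i.2 j.2 := by
  simp only [← Finset.sum_product']
  rw [Finset.sum_sigma', Finset.sum_sigma']
  refine Finset.sum_bij'
    (fun x _ => ⟨(x.2.1.1 + x.2.2.1, x.2.1.2 + x.2.2.2), ((x.2.1.1, x.2.2.1), (x.2.1.2, x.2.2.2))⟩)
    (fun x _ => ⟨(x.2.1.1 + x.2.2.1, x.2.1.2 + x.2.2.2), ((x.2.1.1, x.2.2.1), (x.2.1.2, x.2.2.2))⟩)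
    ?_ ?_ ?_ ?_ ?_
  · rintro ⟨⟨a, b⟩, ⟨⟨c, d⟩, ⟨e, f⟩⟩⟩ h
    simp only [Finset.mem_sigma, Finset.mem_product, mem_antidiagonal] at h ⊢
    obtain ⟨h, rfl, rfl⟩ := h
    exact ⟨by rw [← h]; abel, trivial, trivial⟩
  · rintro ⟨⟨a, b⟩, ⟨⟨c, d⟩, ⟨e, f⟩⟩⟩ h
    simp only [Finset.mem_sigma, Finset.mem_product, mem_antidiagonal] at h ⊢
    obtain ⟨h, rfl, rfl⟩ := h
    exact ⟨by rw [← h]; abel, trivial, trivial⟩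
  · rintro ⟨⟨a, b⟩, ⟨⟨c, d⟩, ⟨e, f⟩⟩⟩ h
    simp only [Finset.mem_sigma, Finset.mem_product, mem_antidiagonal] at h
    obtain ⟨h, rfl, rfl⟩ := h
    rfl
  · rintro ⟨⟨a, b⟩, ⟨⟨c, d⟩, ⟨e, f⟩⟩⟩ h
    simp only [Finset.mem_sigma, Finset.mem_product, mem_antidiagonal] at h
    obtain ⟨h, rfl, rfl⟩ := h
    rfl
  · rintro ⟨⟨a, b⟩, ⟨⟨c, d⟩, ⟨e, f⟩⟩⟩ h
    rfl

namespace ToricDatum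

variable {G : Type*} [AddCommGroup G] {𝔾 : GradingDatum G} {P : Type*} [Fintype P]
  {T : ToricDatum 𝔾 P}

/-! ### Divisibility of monomials -/

/-- Strict divisibility of monomials. -/
def SDvd (v u : T.monoid) : Prop := ∃ w : T.monoid, w ≠ 0 ∧ v + w = u

theorem eq_zero_of_add_eq_zero {v w : T.monoid} (h : v + w = 0) : w = 0 := by
  by_contra hw
  exact T.zero_notMem_filt_one ⟨v, Set.mem_univ _, w, hw, h⟩

theorem mem_filt_one {u : T.monoid} : u ∈ T.filt 1 ↔ u ≠ 0 :=
  ⟨fun h h0 => T.zero_notMem_filt_one (h0 ▸ h), fun h => ⟨0, Set.mem_univ _, u, h, zero_add u⟩⟩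

/-- Adding w to the second component embeds the decompositions of v into those of v + w, and misses
(v + w, 0) because the monoid has no non-zero invertible element. The number of decompositions is
thus a rank function for divisibility. -/
theorem SDvd.card_lt {v u : T.monoid} (h : SDvd v u) :
    (antidiagonal v).card < (antidiagonal u).card := by
  classical
  obtain ⟨w, hw, rfl⟩ := h
  have hinj : Function.Injective fun x : T.monoid × T.monoid => (x.1, x.2 + w) := by
    rintro ⟨a, b⟩ ⟨a', b'⟩ h
    simp only [Prod.mk.injEq] at h
    exact Prod.ext h.1 (add_right_cancel h.2)
  rw [← Finset.card_image_of_injective _ hinj]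
  refine Finset.card_lt_card (Finset.ssubset_iff_of_subset ?_ |>.2 ⟨(v + w, 0), ?_, ?_⟩)
  · intro x hx
    obtain ⟨y, hy, rfl⟩ := Finset.mem_image.1 hx
    have hy' := mem_antidiagonal.1 hy
    refine mem_antidiagonal.2 ?_
    rw [← hy', add_assoc]
  · exact mem_antidiagonal.2 (add_zero _)
  · intro hx
    obtain ⟨y, -, hy⟩ := Finset.mem_image.1 hx
    exact hw (eq_zero_of_add_eq_zero (congrArg Prod.snd hy))

theorem sdvd_wf : WellFounded (SDvd (T := T)) :=
  Subrelation.wf (fun h => SDvd.card_lt h)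
    (InvImage.wf (fun u : T.monoid => (antidiagonal u).card) wellFounded_lt)

theorem SDvd.trans {u v w : T.monoid} (h : SDvd u v) (h' : SDvd v w) : SDvd u w := by
  obtain ⟨a, ha, rfl⟩ := h
  obtain ⟨b, hb, rfl⟩ := h'
  exact ⟨a + b, fun h => hb (eq_zero_of_add_eq_zero h), (add_assoc u a b).symm⟩

theorem SDvd.of_add {v w u : T.monoid} (h : v + w = u) (hw : w ≠ 0) : SDvd v u := ⟨w, hw, h⟩

theorem SDvd.of_add' {v w u : T.monoid} (h : v + w = u) (hv : v ≠ 0) : SDvd w u :=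
  ⟨v, hv, (add_comm w v).trans h⟩

theorem SDvd.irrefl (u : T.monoid) : ¬ SDvd u u := fun h => lt_irrefl _ h.card_lt

/-- Each step down the filtration strictly lowers the number of decompositions. Hence the filtration
is separated, so that sums over orders become finite coefficient by coefficient. -/
theorem lt_card_of_mem_filt (n : ℕ) {u : T.monoid} (h : u ∈ T.filt n) :
    n < (antidiagonal u).card := by
  induction n generalizing u with
  | zero => exact Finset.card_pos.2 ⟨(0, u), mem_antidiagonal.2 (zero_add u)⟩
  | succ n ih =>
    obtain ⟨v, hv, w, hw, h⟩ := h
    exact (Nat.succ_le_of_lt (ih hv)).trans_lt (SDvd.card_lt ⟨w, hw, h⟩)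

theorem exists_notMem_filt (u : T.monoid) : ∃ n, u ∉ T.filt n :=
  ⟨_, fun h => lt_irrefl _ (lt_card_of_mem_filt _ h)⟩

theorem filt_succ_subset (n : ℕ) : T.filt (n + 1) ⊆ T.filt n := by
  rintro _ ⟨v, hv, w, -, rfl⟩
  exact T.filt_add n hv w

theorem filt_anti {m n : ℕ} (h : m ≤ n) : T.filt n ⊆ T.filt m :=
  antitone_nat_of_succ_le (f := T.filt) filt_succ_subset h

theorem add_mem_filt {m n : ℕ} {u v : T.monoid} (hu : u ∈ T.filt m) (hv : v ∈ T.filt n) :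
    u + v ∈ T.filt (m + n) := by
  induction n generalizing v with
  | zero => exact T.filt_add m hu v
  | succ n ih =>
    obtain ⟨a, ha, b, hb, rfl⟩ := hv
    exact ⟨u + a, ih ha, b, hb, add_assoc u a b⟩

/-- Outside `T.filt 2` there are only 0 and the irreducible exponents, where everything quadratic
vanishes. The first-order arguments rest on this. -/
theorem eq_of_add_of_notMem {u v w : T.monoid} (hu : u ∉ T.filt 2) (hw : w ≠ 0) (h : w + v = u) :
    v = 0 := by
  by_contra hv
  exact hu ⟨w, mem_filt_one.2 hw, v, hv, h⟩

/-- A set of exponents that contains finitely many elements outside each step of the filtration. -/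
def LocFin (B : Set T.monoid) : Prop := ∀ n, {u | u ∉ T.filt n ∧ u ∈ B}.Finite

theorem LocFin.mono {B C : Set T.monoid} (h : LocFin C) (hBC : B ⊆ C) : LocFin B :=
  fun n => (h n).subset fun _ hu => ⟨hu.1, hBC hu.2⟩

theorem LocFin.union {B C : Set T.monoid} (h : LocFin B) (h' : LocFin C) : LocFin (B ∪ C) :=
  fun n => ((h n).union (h' n)).subset fun _ hu => hu.2.imp (fun h => ⟨hu.1, h⟩) fun h => ⟨hu.1, h⟩

theorem LocFin.iUnion {ι : Type*} [Finite ι] {B : ι → Set T.monoid} (h : ∀ i, LocFin (B i)) :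
    LocFin (⋃ i, B i) := fun n => (Set.finite_iUnion fun i => h i n).subset fun u hu => by
  obtain ⟨i, hi⟩ := Set.mem_iUnion.1 hu.2
  exact Set.mem_iUnion.2 ⟨i, hu.1, hi⟩

theorem LocFin.of_finite {B : Set T.monoid} (h : B.Finite) : LocFin B :=
  fun _ => h.subset fun _ hu => hu.2

theorem LocFin.add {B C : Set T.monoid} (h : LocFin B) (h' : LocFin C) :
    LocFin {u | ∃ b ∈ B, ∃ c ∈ C, b + c = u} := by
  refine fun n => (((h n).prod (h' n)).image fun x => x.1 + x.2).subset ?_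
  rintro _ ⟨hn, b, hb, c, hc, rfl⟩
  exact ⟨(b, c), ⟨⟨fun h => hn (T.filt_add n h c), hb⟩,
    ⟨fun h => hn (add_comm c b ▸ T.filt_add n h b), hc⟩⟩, rfl⟩

/-- Splitting off one non-zero generator s from u ∉ `T.filt (n + 1)` leaves v ∉ `T.filt n`, while s
itself lies outside `T.filt (n + 1)`; induction on n leaves finitely many pairs. -/
theorem LocFin.closure {B : Set T.monoid} (hB : LocFin B) :
    LocFin (AddSubmonoid.closure B : Set T.monoid) := by
  have key : ∀ u ∈ AddSubmonoid.closure B, u = 0 ∨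
      ∃ v ∈ AddSubmonoid.closure B, ∃ s ∈ B, s ≠ 0 ∧ v + s = u := by
    intro u hu
    induction hu using AddSubmonoid.closure_induction with
    | mem s hs =>
      by_cases h : s = 0
      · exact Or.inl h
      · exact Or.inr ⟨0, zero_mem _, s, hs, h, zero_add s⟩
    | zero => exact Or.inl rfl
    | add a b ha _ iha ihb =>
      rcases ihb with rfl | ⟨v, hv, s, hs, h0, rfl⟩
      · simpa using iha
      · exact Or.inr ⟨a + v, add_mem ha hv, s, hs, h0, add_assoc a v s⟩
  intro n
  induction n with
  | zero => simp [filt]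
  | succ n ih =>
    refine (((ih.prod (hB (n + 1))).image fun x => x.1 + x.2).union
      (Set.finite_singleton 0)).subset fun u hu => ?_
    rcases key u hu.2 with rfl | ⟨v, hv, s, hs, h0, rfl⟩
    · exact Or.inr rfl
    · refine Or.inl ⟨(v, s), ⟨⟨fun h => hu.1 ⟨v, h, s, h0, rfl⟩, hv⟩,
        ⟨fun h => hu.1 ?_, hs⟩⟩, rfl⟩
      exact add_comm s v ▸ T.filt_add (n + 1) h v

/-! ### Formal sums of monomials -/

variable {k : Type*} [Field k]

theorem antidiagonal_zero' : antidiagonal (0 : T.monoid) = {(0, 0)} := by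
  ext ⟨a, b⟩
  simp only [mem_antidiagonal, Finset.mem_singleton, Prod.mk.injEq]
  constructor
  · intro h
    exact ⟨eq_zero_of_add_eq_zero ((add_comm b a).trans h), eq_zero_of_add_eq_zero h⟩
  · rintro ⟨rfl, rfl⟩
    exact add_zero 0

/-- The constant term of a formal sum. -/
noncomputable def constTerm (k : Type*) [Field k] (T : ToricDatum 𝔾 P) :
    FormalSums k T.monoid →+* k where
  toFun c := c 0
  map_zero' := rfl
  map_one' := by rw [FormalSums.one_apply, if_pos rfl]
  map_add' _ _ := rfl
  map_mul' c d := by rw [FormalSums.mul_apply, antidiagonal_zero', Finset.sum_singleton]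

/-- In the equation c · x = 1 at u, the unknown x_u occurs only in c_0 x_u; the other terms involve
x at strict divisors of u. -/
theorem isUnit_formalSums {c : FormalSums k T.monoid} (hc : c 0 ≠ 0) : IsUnit c := by
  classical
  obtain ⟨x, hx⟩ := (sdvd_wf (T := T)).exists_fixed (X := fun _ => k)
    (fun x u => (c 0)⁻¹ * ((1 : FormalSums k T.monoid) u -
      ∑ y ∈ (antidiagonal u).erase (0, u), c y.1 * x y.2)) (by
    intro x y u h
    congr 2
    refine Finset.sum_congr rfl fun z hz => ?_
    rw [Finset.mem_erase, mem_antidiagonal] at hz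
    rw [h]
    refine SDvd.of_add' hz.2 fun h0 => hz.1 (Prod.ext h0 ?_)
    simpa [h0] using hz.2)
  refine IsUnit.of_mul_eq_one (show FormalSums k T.monoid from x) ?_
  funext u
  have hm : ((0 : T.monoid), u) ∈ antidiagonal u := mem_antidiagonal.2 (zero_add u)
  rw [FormalSums.mul_apply, ← Finset.add_sum_erase _ _ hm]
  have := hx u
  dsimp only
  rw [this, mul_inv_cancel_left₀ hc, sub_add_cancel]

/-- The formal sums supported in a submonoid. -/
def supportedIn (k : Type*) [Field k] (S : AddSubmonoid T.monoid) :
    Subalgebra k (FormalSums k T.monoid) where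
  carrier := {c | ∀ u, c u ≠ 0 → u ∈ S}
  mul_mem' := by
    intro c d hc hd u hu
    rw [FormalSums.mul_apply] at hu
    obtain ⟨x, hx, hne⟩ := Finset.exists_ne_zero_of_sum_ne_zero hu
    rw [← mem_antidiagonal.1 hx]
    exact add_mem (hc _ (left_ne_zero_of_mul hne)) (hd _ (right_ne_zero_of_mul hne))
  add_mem' := by
    intro c d hc hd u hu
    by_contra h
    exact hu (by rw [FormalSums.add_apply, not_not.1 (mt (hc u) h), not_not.1 (mt (hd u) h),
      add_zero])
  algebraMap_mem' := by
    intro a w hw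
    by_contra h
    refine hw ?_
    rw [Algebra.algebraMap_eq_smul_one, FormalSums.smul_apply, FormalSums.one_apply, if_neg,
      mul_zero]
    rintro rfl
    exact h (zero_mem S)

theorem unit_const_ne_zero (c : (FormalSums k T.monoid)ˣ) : (c : FormalSums k T.monoid) 0 ≠ 0 :=
  ((Units.map (constTerm k T : FormalSums k T.monoid →* k)) c).ne_zero

theorem inv_mem_supportedIn {S : AddSubmonoid T.monoid} {c : (FormalSums k T.monoid)ˣ}
    (hc : (c : FormalSums k T.monoid) ∈ supportedIn k S) :
    ((c⁻¹ : (FormalSums k T.monoid)ˣ) : FormalSums k T.monoid) ∈ supportedIn k S := by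
  classical
  intro u
  induction u using (sdvd_wf (T := T)).induction with
  | _ u ih =>
  intro hu
  by_contra hS
  have h1 : ((c : FormalSums k T.monoid) * (c⁻¹ : (FormalSums k T.monoid)ˣ)) u = 0 := by
    rw [Units.mul_inv, FormalSums.one_apply, if_neg]
    rintro rfl
    exact hS (zero_mem S)
  have hm : ((0 : T.monoid), u) ∈ antidiagonal u := mem_antidiagonal.2 (zero_add u)
  rw [FormalSums.mul_apply, ← Finset.add_sum_erase _ _ hm, Finset.sum_eq_zero, add_zero] at h1
  · exact mul_ne_zero (unit_const_ne_zero c) hu h1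
  · intro y hy
    rw [Finset.mem_erase, mem_antidiagonal] at hy
    by_contra hne
    have hy1 : y.1 ≠ 0 := fun h0 => hy.1 (Prod.ext h0 (by simpa [h0] using hy.2))
    have h2 := ih y.2 (SDvd.of_add' hy.2 hy1) (right_ne_zero_of_mul hne)
    exact hS (hy.2 ▸ add_mem (hc _ (left_ne_zero_of_mul hne)) h2)

/-- The units supported in a submonoid. -/
def unitsIn (k : Type*) [Field k] (S : AddSubmonoid T.monoid) :
    Subgroup (FormalSums k T.monoid)ˣ where
  carrier := {c | (c : FormalSums k T.monoid) ∈ supportedIn k S}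
  mul_mem' hc hd := (supportedIn k S).mul_mem hc hd
  one_mem' := (supportedIn k S).one_mem
  inv_mem' hc := inv_mem_supportedIn hc

/-- The multiplicative extension `w ↦ ∏ θ_p ^ w_p` of a family of units. -/
noncomputable def pw (θ : P → (FormalSums k T.monoid)ˣ) (w : P → ℤ) : (FormalSums k T.monoid)ˣ :=
  ∏ p, θ p ^ w p

theorem pw_add (θ : P → (FormalSums k T.monoid)ˣ) (v w : P → ℤ) :
    pw θ (v + w) = pw θ v * pw θ w := by
  simp [pw, zpow_add, Finset.prod_mul_distrib]

theorem pw_zero (θ : P → (FormalSums k T.monoid)ˣ) : pw θ 0 = 1 := by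
  simp [pw]

theorem pw_single [DecidableEq P] (θ : P → (FormalSums k T.monoid)ˣ) (p : P) :
    pw θ (Pi.single p 1) = θ p := by
  rw [pw, Finset.prod_eq_single p]
  · simp
  · intro q _ hq
    simp [hq]
  · simp

theorem pw_mem {S : AddSubmonoid T.monoid} {θ : P → (FormalSums k T.monoid)ˣ}
    (hθ : ∀ p, (θ p : FormalSums k T.monoid) ∈ supportedIn k S) (w : P → ℤ) :
    (pw θ w : FormalSums k T.monoid) ∈ supportedIn k S :=
  (unitsIn k S).prod_mem fun p _ => (unitsIn k S).zpow_mem (hθ p) (w p)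

/-- The formal sums without terms dividing `r^v`. -/
def lowIdeal (k : Type*) [Field k] (v : T.monoid) : Ideal (FormalSums k T.monoid) where
  carrier := {c | ∀ a b : T.monoid, a + b = v → c a = 0}
  zero_mem' _ _ _ := rfl
  add_mem' := by
    intro c d hc hd a b hab
    rw [FormalSums.add_apply, hc a b hab, hd a b hab, add_zero]
  smul_mem' := by
    intro c d hd a b hab
    rw [smul_eq_mul, FormalSums.mul_apply]
    refine Finset.sum_eq_zero fun x hx => ?_
    rw [hd x.2 (x.1 + b), mul_zero]
    rw [← hab, ← mem_antidiagonal.1 hx, ← add_assoc, add_comm x.2]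

/-- Modulo the ideal of sums without terms dividing r^v the two families of units coincide, hence so
do their products and inverses, and the coefficient at v survives in the quotient. This avoids any
expansion of negative powers. -/
theorem pw_congr {θ θ' : P → (FormalSums k T.monoid)ˣ} {v : T.monoid}
    (h : ∀ p a b, a + b = v → (θ p : FormalSums k T.monoid) a = (θ' p : FormalSums k T.monoid) a)
    (w : P → ℤ) : (pw θ w : FormalSums k T.monoid) v = (pw θ' w : FormalSums k T.monoid) v := by
  let q : (FormalSums k T.monoid)ˣ →* (FormalSums k T.monoid ⧸ lowIdeal k v)ˣ :=
    Units.map (Ideal.Quotient.mk (lowIdeal k v) : _ →* _)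
  have h1 : ∀ p, q (θ p) = q (θ' p) := by
    intro p
    refine Units.ext (Ideal.Quotient.eq.2 fun a b hab => ?_)
    change (θ p : FormalSums k T.monoid) a - (θ' p : FormalSums k T.monoid) a = 0
    rw [h p a b hab, sub_self]
  have h2 : q (pw θ w) = q (pw θ' w) := by
    simp only [pw, map_prod, map_zpow, h1]
  have h3 := Ideal.Quotient.eq.1 (congrArg Units.val h2) v 0 (add_zero v)
  exact sub_eq_zero.1 h3

theorem pw_const (θ : P → (FormalSums k T.monoid)ˣ) (w : P → ℤ) :
    (pw θ w : FormalSums k T.monoid) 0 = ∏ p, ((θ p : FormalSums k T.monoid) 0) ^ w p := by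
  have h := congrArg Units.val (map_prod (Units.map (constTerm k T : FormalSums k T.monoid →* k))
    (fun p => θ p ^ w p) Finset.univ)
  simp only [map_zpow] at h
  rw [Units.coe_prod] at h
  simp only [Units.val_zpow_eq_zpow_val] at h
  exact h

/-! ### The action of rescalings on coefficients -/

section Twist

variable {L : Type*} [AddCommGroup L] [Module k L]

/-- The coefficients of `∑ r^u θ^u x_u`. -/
noncomputable def twist (θ : P → (FormalSums k T.monoid)ˣ) (x : T.monoid → L) : T.monoid → L :=
  fun u => ∑ y ∈ antidiagonal u, (pw θ y.1 : FormalSums k T.monoid) y.2 • x y.1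

theorem twist_supp {S : AddSubmonoid T.monoid} {θ : P → (FormalSums k T.monoid)ˣ}
    (hθ : ∀ p, (θ p : FormalSums k T.monoid) ∈ supportedIn k S) {x : T.monoid → L}
    (hx : ∀ u, x u ≠ 0 → u ∈ S) {u : T.monoid} (hu : twist θ x u ≠ 0) : u ∈ S := by
  obtain ⟨y, hy, hne⟩ := Finset.exists_ne_zero_of_sum_ne_zero hu
  rw [← mem_antidiagonal.1 hy]
  refine add_mem (hx _ fun h => hne (by rw [h, smul_zero])) (pw_mem hθ y.1 _ fun h => hne ?_)
  rw [h, zero_smul]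

theorem twist_zero (θ : P → (FormalSums k T.monoid)ˣ) (x : T.monoid → L) :
    twist θ x 0 = x 0 := by
  rw [twist, antidiagonal_zero', Finset.sum_singleton]
  simp [pw_zero, FormalSums.one_apply]

/-- The reason is (r^a θ^a)(r^b θ^b) = r^(a+b) θ^(a+b). The pairing is assumed only to expand over
the twisted sums in question, since the Gerstenhaber product is additive in its second argument only
when the first one is multilinear. -/
theorem twist_conv {N : Type*} [AddCommGroup N] [Module k N]
    (θ : P → (FormalSums k T.monoid)ˣ) (x y : T.monoid → L) (B : L → L → N)
    (hB : ∀ u v, B (twist θ x u) (twist θ y v) =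
      ∑ i ∈ antidiagonal u, ∑ j ∈ antidiagonal v,
        ((pw θ i.1 : FormalSums k T.monoid) i.2 * (pw θ j.1 : FormalSums k T.monoid) j.2) •
          B (x i.1) (y j.1)) (u : T.monoid) :
    ∑ v ∈ antidiagonal u, B (twist θ x v.1) (twist θ y v.2) =
      twist θ (fun w => ∑ v ∈ antidiagonal w, B (x v.1) (y v.2)) u := by
  simp only [hB]
  rw [sum_antidiagonal_four fun a b c d : T.monoid =>
    ((pw θ (a : P → ℤ) : FormalSums k T.monoid) b * (pw θ (c : P → ℤ) : FormalSums k T.monoid) d) •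
      B (x a) (y c)]
  refine Finset.sum_congr rfl fun z _ => ?_
  rw [Finset.smul_sum]
  refine Finset.sum_congr rfl fun i hi => ?_
  rw [← Finset.sum_smul, ← mem_antidiagonal.1 hi, AddSubmonoid.coe_add, pw_add,
    Units.val_mul, FormalSums.mul_apply]

end Twist

end ToricDatum

namespace ToricDatum

variable {G : Type*} [AddCommGroup G] {𝔾 : GradingDatum G} {P : Type*} [Fintype P]
  {T : ToricDatum 𝔾 P} {k : Type*} [Field k]

/-! ### Monomials -/

open scoped Classical in
theorem coeff_mono (u v : T.monoid) : coeff v (T.mono k u) = if v = u then 1 else 0 := rfl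

theorem coeff_mul (c d : T.ring k) (u : T.monoid) :
    coeff u (c * d) = ∑ y ∈ antidiagonal u, coeff y.1 c * coeff y.2 d := rfl

theorem coeff_sub (c d : T.ring k) (u : T.monoid) :
    coeff u (c - d) = coeff u c - coeff u d := rfl

theorem ring_ext {c d : T.ring k} (h : ∀ u, coeff u c = coeff u d) : c = d :=
  Subtype.ext (funext h)

theorem coeff_mono_mul_add (u v : T.monoid) (c : T.ring k) :
    coeff (u + v) (T.mono k u * c) = coeff v c := by
  classical
  rw [coeff_mul, Finset.sum_eq_single (u, v)]
  · simp [coeff_mono]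
  · rintro ⟨a, b⟩ hy hne
    have hy' : a + b = u + v := mem_antidiagonal.1 hy
    rw [coeff_mono, if_neg, zero_mul]
    rintro rfl
    exact hne (by rw [add_left_cancel hy'])
  · intro h
    have h' : ((u, v) : T.monoid × T.monoid) ∈ antidiagonal (u + v) := mem_antidiagonal.2 (Eq.refl _)
    exact absurd h' h

theorem coeff_mono_mul_ne_zero {u w : T.monoid} {c : T.ring k}
    (h : coeff w (T.mono k u * c) ≠ 0) : ∃ v, u + v = w ∧ coeff v c ≠ 0 := by
  classical
  rw [coeff_mul] at h
  obtain ⟨y, hy, hne⟩ := Finset.exists_ne_zero_of_sum_ne_zero h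
  have h1 : y.1 = u := by
    by_contra h1
    exact hne (by rw [coeff_mono, if_neg h1, zero_mul])
  exact ⟨y.2, h1 ▸ mem_antidiagonal.1 hy, right_ne_zero_of_mul hne⟩

theorem mono_mul_cancel {u : T.monoid} {c d : T.ring k} (h : T.mono k u * c = T.mono k u * d) :
    c = d :=
  ring_ext fun v => by rw [← coeff_mono_mul_add u v c, h, coeff_mono_mul_add]

theorem mono_zero : T.mono k 0 = 1 :=
  ring_ext fun u => (coeff_mono 0 u).trans (Eq.trans (by congr) (FormalSums.one_apply u).symm)

theorem mono_add (u v : T.monoid) : T.mono k (u + v) = T.mono k u * T.mono k v := by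
  classical
  refine ring_ext fun w => ?_
  by_cases h : coeff w (T.mono k u * T.mono k v) = 0
  · rw [h, coeff_mono, if_neg]
    rintro rfl
    rw [coeff_mono_mul_add, coeff_mono, if_pos rfl] at h
    exact one_ne_zero h
  · obtain ⟨a, rfl, ha⟩ := coeff_mono_mul_ne_zero h
    rw [coeff_mono_mul_add, coeff_mono, coeff_mono]
    simp

theorem mono_sum_nsmul {ι : Type*} (s : Finset ι) (n : ι → ℕ) (e : ι → T.monoid) :
    T.mono k (∑ i ∈ s, n i • e i) = ∏ i ∈ s, T.mono k (e i) ^ n i := by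
  let φ : Multiplicative T.monoid →* T.ring k :=
    { toFun := fun u => T.mono k u.toAdd, map_one' := mono_zero, map_mul' := fun u v => mono_add _ _ }
  have h := map_prod φ (fun i => Multiplicative.ofAdd (e i) ^ n i) s
  simp only [map_pow] at h
  exact h

theorem mono_mem_piece (u : T.monoid) : T.mono k u ∈ T.piece k (T.f u) := by
  classical
  intro v hv
  rw [coeff_mono] at hv
  by_cases h : v = u
  · rw [h]
  · exact absurd (if_neg h) hv

theorem mono_mem_adic {n : ℕ} {u : T.monoid} (hu : u ∈ T.filt n) : T.mono k u ∈ T.adic k n := by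
  classical
  intro v hv
  rw [coeff_mono] at hv
  by_cases h : v = u
  · rwa [h]
  · exact absurd (if_neg h) hv

/-! ### Rescaling automorphisms -/

theorem mem_ring {c : FormalSums k T.monoid} : c ∈ T.ring k ↔ LocFin {u | c u ≠ 0} ∧
    ((fun u : T.monoid => T.f u) '' {u | c u ≠ 0}).Finite := Iff.rfl

theorem supportedIn_le_ring {S : AddSubmonoid T.monoid} (hS : ∀ u ∈ S, T.f u = 0)
    (hloc : LocFin (S : Set T.monoid)) {c : FormalSums k T.monoid} (hc : c ∈ supportedIn k S) :
    c ∈ T.ring k := by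
  refine mem_ring.2 ⟨hloc.mono fun u hu => hc u hu, (Set.finite_singleton 0).subset ?_⟩
  rintro _ ⟨u, hu, rfl⟩
  exact hS u (hc u hu)

/-- The endomorphism `r^u ↦ r^u θ^u` of the algebra of formal sums. -/
noncomputable def twistHom (θ : P → (FormalSums k T.monoid)ˣ) :
    FormalSums k T.monoid →ₐ[k] FormalSums k T.monoid :=
  AlgHom.ofLinearMap
    { toFun := fun c u => ∑ y ∈ antidiagonal u, (pw θ y.1 : FormalSums k T.monoid) y.2 * c y.1
      map_add' := fun c d => by
        funext u
        exact (Finset.sum_congr rfl fun y _ => mul_add _ _ _).trans Finset.sum_add_distrib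
      map_smul' := fun a c => by
        funext u
        exact (Finset.sum_congr rfl fun y _ => mul_left_comm _ _ _).trans (Finset.mul_sum _ _ _).symm }
    (by
      classical
      funext u
      change ∑ y ∈ antidiagonal u, (pw θ y.1 : FormalSums k T.monoid) y.2 *
        (1 : FormalSums k T.monoid) y.1 = _
      simp only [FormalSums.one_apply]
      rw [Finset.sum_eq_single (0, u)]
      · simp [pw_zero, FormalSums.one_apply]
      · intro y hy hne
        rw [if_neg, mul_zero]
        intro h0
        exact hne (Prod.ext h0 (by simpa [h0] using mem_antidiagonal.1 hy))
      · exact fun h => absurd (mem_antidiagonal.2 (zero_add u)) h)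
    (fun c d => by
      funext u
      refine (twist_conv θ (c : T.monoid → k) (d : T.monoid → k) (fun a b => a * b) ?_ u).symm
      intro u v
      simp only [twist, Finset.sum_mul_sum, smul_eq_mul]
      exact Finset.sum_congr rfl fun y _ => Finset.sum_congr rfl fun z _ => by ring)

theorem twistHom_apply (θ : P → (FormalSums k T.monoid)ˣ) (c : FormalSums k T.monoid)
    (u : T.monoid) : twistHom θ c u =
      ∑ y ∈ antidiagonal u, (pw θ y.1 : FormalSums k T.monoid) y.2 * c y.1 := rfl

theorem twistHom_apply_erase [DecidableEq T.monoid] (θ : P → (FormalSums k T.monoid)ˣ)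
    (c : FormalSums k T.monoid)
    (u : T.monoid) : twistHom θ c u = (pw θ u : FormalSums k T.monoid) 0 * c u +
      ∑ y ∈ (antidiagonal u).erase (u, 0), (pw θ y.1 : FormalSums k T.monoid) y.2 * c y.1 := by
  rw [twistHom_apply, ← Finset.add_sum_erase _ _ (a := (u, 0)) (mem_antidiagonal.2 (add_zero u))]

theorem sdvd_of_mem_erase [DecidableEq T.monoid] {u : T.monoid} {y : T.monoid × T.monoid}
    (hy : y ∈ (antidiagonal u).erase (u, 0)) : SDvd y.1 u := by
  rw [Finset.mem_erase, mem_antidiagonal] at hy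
  exact SDvd.of_add hy.2 fun h0 => hy.1 (Prod.ext (by simpa [h0] using hy.2) h0)

/-- The map is triangular for divisibility with non-zero diagonal entries, so supports can be
followed in both directions by induction. Varying Q gives compatibility with degrees and with the
filtration, and Q = ∅ gives injectivity. -/
theorem twistHom_supp_iff {S : AddSubmonoid T.monoid} {θ : P → (FormalSums k T.monoid)ˣ}
    (hθ : ∀ p, (θ p : FormalSums k T.monoid) ∈ supportedIn k S) {Q : Set T.monoid}
    (hQ : ∀ q ∈ Q, ∀ s ∈ S, q + s ∈ Q) (c : FormalSums k T.monoid) :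
    (∀ u, twistHom θ c u ≠ 0 → u ∈ Q) ↔ ∀ u, c u ≠ 0 → u ∈ Q := by
  classical
  constructor
  · intro h u
    induction u using (sdvd_wf (T := T)).induction with
    | _ u ih =>
    intro hu
    by_contra huQ
    have h1 := not_not.1 (mt (h u) huQ)
    rw [twistHom_apply_erase, Finset.sum_eq_zero, add_zero] at h1
    · exact mul_ne_zero (unit_const_ne_zero _) hu h1
    · intro y hy
      by_contra hne
      refine huQ ?_
      rw [← mem_antidiagonal.1 (Finset.mem_of_mem_erase hy)]
      exact hQ _ (ih _ (sdvd_of_mem_erase hy) (right_ne_zero_of_mul hne)) _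
        (pw_mem hθ _ _ (left_ne_zero_of_mul hne))
  · intro h u hu
    rw [twistHom_apply] at hu
    obtain ⟨y, hy, hne⟩ := Finset.exists_ne_zero_of_sum_ne_zero hu
    rw [← mem_antidiagonal.1 hy]
    exact hQ _ (h _ (right_ne_zero_of_mul hne)) _ (pw_mem hθ _ _ (left_ne_zero_of_mul hne))

theorem twistHom_surjective (θ : P → (FormalSums k T.monoid)ˣ) :
    Function.Surjective (twistHom θ) := by
  classical
  intro d
  obtain ⟨x', hx⟩ := (sdvd_wf (T := T)).exists_fixed (X := fun _ => k)
    (fun x u => ((pw θ u : FormalSums k T.monoid) 0)⁻¹ * (d u -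
      ∑ y ∈ (antidiagonal u).erase (u, 0), (pw θ y.1 : FormalSums k T.monoid) y.2 * x y.1)) (by
    intro x y u h
    congr 2
    exact Finset.sum_congr rfl fun z hz => by rw [h _ (sdvd_of_mem_erase hz)])
  obtain ⟨x, rfl⟩ : ∃ x : FormalSums k T.monoid, (x : T.monoid → k) = x' := ⟨x', rfl⟩
  refine ⟨(x : FormalSums k T.monoid), funext fun u => ?_⟩
  rw [twistHom_apply_erase, hx u, mul_inv_cancel_left₀ (unit_const_ne_zero _), sub_add_cancel]

theorem twistHom_mem_ring_iff {S : AddSubmonoid T.monoid} {θ : P → (FormalSums k T.monoid)ˣ}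
    (hθ : ∀ p, (θ p : FormalSums k T.monoid) ∈ supportedIn k S) (hS : ∀ u ∈ S, T.f u = 0)
    (hloc : LocFin (S : Set T.monoid)) (c : FormalSums k T.monoid) :
    twistHom θ c ∈ T.ring k ↔ c ∈ T.ring k := by
  have key : ∀ d c : FormalSums k T.monoid, d ∈ T.ring k →
      ((∀ Q : Set T.monoid, (∀ q ∈ Q, ∀ s ∈ S, q + s ∈ Q) → (∀ u, d u ≠ 0 → u ∈ Q) →
        ∀ u, c u ≠ 0 → u ∈ Q)) → c ∈ T.ring k := by
    intro d c hd h
    -- The smallest S-stable set containing the support of d: it is again locally finite, and it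
    -- meets only the degrees of d because S has degree 0.
    have h1 := h {u | ∃ b ∈ {u | d u ≠ 0}, ∃ s ∈ (S : Set T.monoid), b + s = u} (by
      rintro _ ⟨b, hb, s, hs, rfl⟩ s' hs'
      exact ⟨b, hb, s + s', add_mem hs hs', (add_assoc b s s').symm⟩)
      fun u hu => ⟨u, hu, 0, zero_mem S, add_zero u⟩
    refine mem_ring.2 ⟨((mem_ring.1 hd).1.add hloc).mono h1, (mem_ring.1 hd).2.subset ?_⟩
    rintro _ ⟨u, hu, rfl⟩
    obtain ⟨b, hb, s, hs, rfl⟩ := h1 u hu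
    exact ⟨b, hb, by simp [hS s hs]⟩
  exact ⟨fun h => key _ _ h fun Q hQ => (twistHom_supp_iff hθ hQ c).1,
    fun h => key _ _ h fun Q hQ => (twistHom_supp_iff hθ hQ c).2⟩

/-- A family of units of degree `0` supported in a locally finite submonoid defines a rescaling. -/
theorem exists_rescaling {S : AddSubmonoid T.monoid} {θ : P → (FormalSums k T.monoid)ˣ}
    (hθ : ∀ p, (θ p : FormalSums k T.monoid) ∈ supportedIn k S) (hS : ∀ u ∈ S, T.f u = 0)
    (hloc : LocFin (S : Set T.monoid)) :
    ∃ ψ ∈ T.aut k, ∃ c : P → (T.ring k)ˣ, IsRescaling ψ c ∧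
      ∀ p, ((c p : T.ring k) : FormalSums k T.monoid) = θ p := by
  classical
  let φ : T.ring k →ₐ[k] T.ring k := ((twistHom θ).comp (T.ring k).val).codRestrict (T.ring k)
    fun c => (twistHom_mem_ring_iff hθ hS hloc _).2 c.2
  have hφ : ∀ (c : T.ring k) u, coeff u (φ c) = twistHom θ c u := fun _ _ => rfl
  have hinj : Function.Injective φ := by
    refine (injective_iff_map_eq_zero φ).2 fun c hc => ring_ext fun u => ?_
    by_contra hne
    exact (twistHom_supp_iff hθ (Q := ∅) (by simp) (c : FormalSums k T.monoid)).1
      (fun v hv => hv (congrArg (coeff v) hc)) u hne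
  have hsurj : Function.Surjective φ := by
    intro d
    obtain ⟨c, hc⟩ := twistHom_surjective θ (d : FormalSums k T.monoid)
    exact ⟨⟨c, (twistHom_mem_ring_iff hθ hS hloc c).1 (hc ▸ d.2)⟩, Subtype.ext hc⟩
  let ψ : T.ring k ≃ₐ[k] T.ring k := AlgEquiv.ofBijective φ ⟨hinj, hsurj⟩
  have hψ : ∀ (c : T.ring k) u, coeff u (ψ c) = twistHom θ c u := fun _ _ => rfl
  have hmem : ∀ c ∈ unitsIn k S, (c : FormalSums k T.monoid) ∈ T.ring k :=
    fun c hc => supportedIn_le_ring hS hloc hc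
  let c : P → (T.ring k)ˣ := fun p =>
    { val := ⟨θ p, hmem _ (hθ p)⟩
      inv := ⟨((θ p)⁻¹ : (FormalSums k T.monoid)ˣ), hmem _ ((unitsIn k S).inv_mem (hθ p))⟩
      val_inv := Subtype.ext (Units.mul_inv _)
      inv_val := Subtype.ext (Units.inv_mul _) }
  refine ⟨ψ, ⟨fun y d => ?_, fun n d => ?_⟩, c, ⟨fun p u hu => hS u (hθ p u hu), fun u => ?_⟩,
    fun p => rfl⟩
  · refine twistHom_supp_iff hθ (Q := {u | T.f u = y}) ?_ (d : FormalSums k T.monoid)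
    rintro q hq s hs
    simpa [hS s hs] using hq
  · exact twistHom_supp_iff hθ (Q := T.filt n) (fun q hq s _ => T.filt_add n hq s)
      (d : FormalSums k T.monoid)
  · have hc : ((((∏ p, c p ^ (u : P → ℤ) p : (T.ring k)ˣ) : T.ring k)) : FormalSums k T.monoid) =
        pw θ u := by
      have h := map_prod (Units.map ((T.ring k).val : T.ring k →* FormalSums k T.monoid))
        (fun p => c p ^ (u : P → ℤ) p) Finset.univ
      simp only [map_zpow] at h
      refine (congrArg Units.val h).trans ?_
      have h2 : ∀ p, Units.map ((T.ring k).val : T.ring k →* FormalSums k T.monoid) (c p) = θ p :=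
        fun p => Units.ext rfl
      simp only [h2]
      rfl
    refine ring_ext fun w => ?_
    rw [hψ, twistHom_apply, coeff_mul]
    refine Finset.sum_congr rfl fun y _ => ?_
    change _ * coeff y.1 (T.mono k u) = _
    rw [coeff_mono]
    split_ifs with h
    · rw [mul_comm, h, ← hc]
      rfl
    · rw [zero_mul, mul_zero]

/-- The units of the ring of formal sums underlying a family of units of `R`. -/
noncomputable def toFormal (c : P → (T.ring k)ˣ) : P → (FormalSums k T.monoid)ˣ :=
  fun p => Units.map ((T.ring k).val : T.ring k →* FormalSums k T.monoid) (c p)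

theorem coe_prod_zpow (c : P → (T.ring k)ˣ) (u : P → ℤ) :
    (((∏ p, c p ^ u p : (T.ring k)ˣ) : T.ring k) : FormalSums k T.monoid) = pw (toFormal c) u := by
  have h := map_prod (Units.map ((T.ring k).val : T.ring k →* FormalSums k T.monoid))
    (fun p => c p ^ u p) Finset.univ
  simp only [map_zpow] at h
  exact congrArg Units.val h

/-- At w only monomials dividing r^w can contribute, so for a rescaling the sum is finite without
any condition on x. -/
theorem push_eq_twist {L : Type*} [AddCommGroup L] [Module k L] {ψ : T.ring k ≃ₐ[k] T.ring k}
    {c : P → (T.ring k)ˣ} (h : IsRescaling ψ c) (x : T.monoid → L) :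
    push ψ x = twist (toFormal c) x := by
  classical
  funext w
  have h1 : ∀ u, coeff w (ψ (T.mono k u)) • x u = ∑ y ∈ antidiagonal w,
      if y.1 = u then (pw (toFormal c) y.1 : FormalSums k T.monoid) y.2 • x y.1 else 0 := by
    intro u
    rw [h.2, coeff_mul, Finset.sum_smul]
    refine Finset.sum_congr rfl fun y _ => ?_
    rw [coeff_mono]
    split_ifs with hy
    · rw [one_mul, ← coe_prod_zpow, hy]
      rfl
    · rw [zero_mul, zero_smul]
  simp only [push, h1, twist]
  rw [finsum_sum_comm]
  · refine Finset.sum_congr rfl fun y _ => ?_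
    rw [finsum_eq_single _ y.1 fun u hu => if_neg hu.symm, if_pos rfl]
  · intro y _
    refine (Set.finite_singleton y.1).subset fun u hu => ?_
    by_contra hne
    exact hu (if_neg fun h => hne h.symm)

/-! ### Automorphisms of nice rings -/

section Nice

variable [DecidableEq P]

theorem IsNice.u_ne_zero (hR : T.IsNice k) (p : P) : hR.u p ≠ 0 := by
  intro h
  have := congrFun (congrArg Subtype.val h) p
  simp [IsNice.u] at this

theorem IsNice.u_notMem (hR : T.IsNice k) (p : P) : hR.u p ∉ T.filt 2 :=
  fun h => hR.notMem_sq p (mono_mem_adic h)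

/-- Niceness writes the monomial r^u as c · r_p with c of degree 0, and the coefficient at u
exhibits the quotient as a monomial of c. -/
theorem IsNice.exists_add (hR : T.IsNice k) {p : P} {u : T.monoid} (hu : u ≠ 0)
    (hf : T.f u = T.f (hR.u p)) : ∃ v : T.monoid, T.f v = 0 ∧ hR.u p + v = u := by
  classical
  obtain ⟨c, hc, h⟩ := hR.gen p (T.mono k u) (mono_mem_adic (mem_filt_one.2 hu)) (by
    have := mono_mem_piece (k := k) u
    rwa [hf] at this)
  have h1 : coeff u (T.mono k (hR.u p) * c) ≠ 0 := by
    have h2 : T.mono k u = T.mono k (hR.u p) * c := h.trans (mul_comm _ _)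
    rw [← h2, coeff_mono, if_pos rfl]
    exact one_ne_zero
  obtain ⟨v, hv, hne⟩ := coeff_mono_mul_ne_zero h1
  exact ⟨v, hc v hne, hv⟩

/-- Division by `r_p` preserves local finiteness, in degree `f(u_p)`. -/
theorem IsNice.locFin_sub (hR : T.IsNice k) (p : P) {S : Set T.monoid} (hS : LocFin S) :
    LocFin {v : T.monoid | T.f v = 0 ∧ hR.u p + v ∈ S} := by
  classical
  -- The sum of all non-trivial monomials of S of degree f(u_p). Local finiteness of S makes it an
  -- element of R; its quotient by r_p again lies in R, and membership in R is the finiteness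
  -- sought.
  let x : T.ring k := ⟨fun u => if u ≠ 0 ∧ T.f u = T.f (hR.u p) ∧ u ∈ S then 1 else 0, by
    refine mem_ring.2 ⟨hS.mono fun u hu => ?_, (Set.finite_singleton (T.f (hR.u p))).subset ?_⟩
    · by_contra h
      exact hu (if_neg fun h' => h h'.2.2)
    · rintro _ ⟨u, hu, rfl⟩
      by_contra h
      exact hu (if_neg fun h' => h h'.2.1)⟩
  have hx : ∀ u, coeff u x = if u ≠ 0 ∧ T.f u = T.f (hR.u p) ∧ u ∈ S then 1 else 0 := fun _ => rfl
  obtain ⟨c, -, h⟩ := hR.gen p x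
    (fun u hu => mem_filt_one.2 (by
      by_contra h
      exact hu ((hx u).trans (if_neg fun h' => h'.1 h))))
    (fun u hu => by
      by_contra h
      exact hu ((hx u).trans (if_neg fun h' => h h'.2.1)))
  refine (mem_ring.1 c.2).1.mono fun v hv => ?_
  have h1 : x = T.mono k (hR.u p) * c := h.trans (mul_comm _ _)
  change coeff v c ≠ 0
  rw [← coeff_mono_mul_add (hR.u p), ← h1, hx, if_pos]
  · exact one_ne_zero
  · refine ⟨fun h0 => hR.u_ne_zero p ?_, ?_, hv.2⟩
    · exact eq_zero_of_add_eq_zero ((add_comm _ _).trans h0)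
    · simp [hv.1]

/-- The exponent u may have negative entries, so r^u need not be a product of the r_p. Clearing
denominators in this way still determines the image of r^u from the images of the r_p. -/
theorem IsNice.sum_toNat (hR : T.IsNice k) (u : T.monoid) :
    u + ∑ p, (-(u : P → ℤ) p).toNat • hR.u p = ∑ p, ((u : P → ℤ) p).toNat • hR.u p := by
  refine Subtype.ext (funext fun q => ?_)
  have h : ∀ n : P → ℕ, ((∑ p, n p • hR.u p : T.monoid) : P → ℤ) q = n q := by
    intro n
    simp [IsNice.u, Finset.sum_apply, Pi.single_apply]
  rw [AddSubmonoid.coe_add, Pi.add_apply, h, h]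
  omega

/-- Every graded automorphism of a nice ring that respects the filtration is a rescaling. -/
theorem IsNice.exists_isRescaling (hR : T.IsNice k) {ψ : T.ring k ≃ₐ[k] T.ring k}
    (hψ : ψ ∈ T.aut k) : ∃ c, IsRescaling ψ c := by
  have key : ∀ χ ∈ T.aut k, ∀ p, ∃ c ∈ T.piece k 0,
      χ (T.mono k (hR.u p)) = T.mono k (hR.u p) * c := by
    intro χ hχ p
    obtain ⟨c, hc, h⟩ := hR.gen p (χ (T.mono k (hR.u p)))
      ((hχ.2 1 _).2 (mono_mem_adic (mem_filt_one.2 (hR.u_ne_zero p))))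
      ((hχ.1 _ _).2 (mono_mem_piece _))
    exact ⟨c, hc, h.trans (mul_comm _ _)⟩
  choose c hc0 hc using key ψ hψ
  -- The inverse automorphism supplies the inverse of c_p: applying ψ to ψ⁻¹(r_p) = r_p d_p gives
  -- r_p = r_p · c_p · ψ(d_p), and r_p can be cancelled.
  choose d _ hd using key ψ⁻¹ (inv_mem hψ)
  have hu : ∀ p, c p * ψ (d p) = 1 := by
    intro p
    refine mono_mul_cancel (u := hR.u p) ?_
    rw [mul_one, ← mul_assoc, ← hc, ← map_mul, ← hd]
    exact ψ.apply_symm_apply _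
  let C : P → (T.ring k)ˣ := fun p =>
    ⟨c p, ψ (d p), hu p, (mul_comm _ _).trans (hu p)⟩
  refine ⟨C, hc0, fun u => ?_⟩
  have hψm : ∀ n : P → ℕ, ψ (T.mono k (∑ p, n p • hR.u p)) =
      T.mono k (∑ p, n p • hR.u p) * ((∏ p, C p ^ n p : (T.ring k)ˣ) : T.ring k) := by
    intro n
    rw [mono_sum_nsmul, map_prod, Units.coe_prod, ← Finset.prod_mul_distrib]
    refine Finset.prod_congr rfl fun p _ => ?_
    rw [map_pow, hc, mul_pow]
    rfl
  -- The images of the positive and negative parts are known; cancelling the negative part, monomial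
  -- and unit alike, isolates ψ(r^u).
  have h1 := congrArg (fun v => ψ (T.mono k v)) (hR.sum_toNat u)
  rw [mono_add, map_mul, hψm, hψm, ← hR.sum_toNat, mono_add] at h1
  have h2 : (∏ p, C p ^ ((u : P → ℤ) p).toNat) =
      (∏ p, C p ^ (u : P → ℤ) p) * ∏ p, C p ^ (-(u : P → ℤ) p).toNat := by
    rw [← Finset.prod_mul_distrib]
    refine Finset.prod_congr rfl fun p _ => ?_
    rw [← zpow_natCast, ← zpow_natCast, ← zpow_add]
    congr 1
    omega
  rw [h2, Units.val_mul] at h1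
  refine (Units.mul_left_inj (∏ p, C p ^ (-(u : P → ℤ) p).toNat)).1 ?_
  refine mono_mul_cancel (u := ∑ p, (-(u : P → ℤ) p).toNat • hR.u p) ?_
  calc _ = _ := by ring
    _ = _ := h1
    _ = _ := by ring

/-- Rescalings with the same constant terms agree on `m / m ^ 2`. -/
theorem sub_mem_adic_two {ψ ψ' : T.ring k ≃ₐ[k] T.ring k} (hψ : ψ ∈ T.aut k)
    (hψ' : ψ' ∈ T.aut k) {c c' : P → (T.ring k)ˣ} (hc : IsRescaling ψ c) (hc' : IsRescaling ψ' c')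
    (h : ∀ p, coeff 0 (c p : T.ring k) = coeff 0 (c' p : T.ring k)) {x : T.ring k}
    (hx : x ∈ T.adic k 1) : ψ x - ψ' x ∈ T.adic k 2 := by
  classical
  have hmono : ∀ u : T.monoid, u ≠ 0 → ψ (T.mono k u) - ψ' (T.mono k u) ∈ T.adic k 2 := by
    intro u hu w hw
    rw [hc.2, hc'.2, ← mul_sub] at hw
    obtain ⟨v, rfl, hv⟩ := coeff_mono_mul_ne_zero hw
    rw [add_comm]
    by_cases hv0 : v = 0
    · subst hv0
      refine absurd ?_ hv
      rw [coeff_sub, sub_eq_zero]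
      have h1 := coe_prod_zpow c (u : P → ℤ)
      have h2 := coe_prod_zpow c' (u : P → ℤ)
      refine (congrFun h1 0).trans (Eq.trans ?_ (congrFun h2 0).symm)
      rw [pw_const, pw_const]
      exact Finset.prod_congr rfl fun p _ => congrArg (· ^ _) (h p)
    · exact ⟨v, mem_filt_one.2 hv0, u, hu, rfl⟩
  -- Modulo m^2 the element x is a finite sum s of monomials, and both automorphisms preserve m^2.
  -- Only monomials have to be compared, and no continuity argument is needed.
  let I : Finset T.monoid := ((mem_ring.1 x.2).1 2).toFinset
  have hI : ∀ u, u ∈ I ↔ u ∉ T.filt 2 ∧ coeff u x ≠ 0 := fun u => Set.Finite.mem_toFinset _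
  let s : T.ring k := ∑ u ∈ I, coeff u x • T.mono k u
  have hs : ∀ w, coeff w s = if w ∈ I then coeff w x else 0 := by
    intro w
    let cw : T.ring k →ₗ[k] k :=
      { toFun := coeff w, map_add' := fun _ _ => rfl, map_smul' := fun _ _ => rfl }
    have : coeff w s = ∑ u ∈ I, coeff u x * coeff w (T.mono k u) := by
      change cw s = _
      simp only [s, map_sum, map_smul]
      rfl
    rw [this]
    simp [coeff_mono]
  have hy : x - s ∈ T.adic k 2 := by
    intro u hu
    by_contra h2
    refine hu ?_
    rw [coeff_sub, hs]
    split_ifs with h3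
    · exact sub_self _
    · rw [sub_zero]
      by_contra h4
      exact h3 ((hI u).2 ⟨h2, h4⟩)
  have e : ψ x - ψ' x = (ψ (x - s) - ψ' (x - s)) + (ψ s - ψ' s) := by
    rw [map_sub, map_sub]
    ring
  rw [e]
  refine add_mem (sub_mem ((hψ.2 2 _).2 hy) ((hψ'.2 2 _).2 hy)) ?_
  simp only [s, map_sum, map_smul]
  rw [← Finset.sum_sub_distrib]
  refine sum_mem fun u hu => ?_
  rw [← smul_sub]
  exact Submodule.smul_mem _ _ (hmono u (mem_filt_one.1 (hx u ((hI u).1 hu).2)))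

end Nice

end ToricDatum

namespace ToricDatum

variable {G : Type*} [AddCommGroup G] {𝔾 : GradingDatum G} {P : Type*} [Fintype P]
  {T : ToricDatum 𝔾 P} {k : Type*} [Field k] {L : Type*} [AddCommGroup L] [Module k L]

/-! ### Combinatorics of nice monoids -/

section Nice

variable [DecidableEq P]

theorem IsNice.u_injective (hR : T.IsNice k) : Function.Injective hR.u := by
  intro p q h
  by_contra hne
  have := congrFun (congrArg Subtype.val h) p
  simp [IsNice.u, hne] at this

theorem IsNice.eq_of_u_add (hR : T.IsNice k) {p q : P} {v : T.monoid}
    (h : hR.u q + v = hR.u p) : v = 0 ∧ q = p := by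
  have hv := eq_of_add_of_notMem (hR.u_notMem p) (hR.u_ne_zero q) h
  exact ⟨hv, hR.u_injective (by rwa [hv, add_zero] at h)⟩

/-- Equal degrees make r_p divide r_q, and irreducibility of r_q forces p = q. Hence an obstruction
at a given exponent involves a single class a_p. -/
theorem IsNice.eq_of_f_u (hR : T.IsNice k) {p q : P} (h : T.f (hR.u q) = T.f (hR.u p)) : q = p := by
  obtain ⟨v, -, hv⟩ := hR.exists_add (hR.u_ne_zero q) h
  exact (hR.eq_of_u_add hv).2.symm

/-- The factor w + w' has degree f(u_p), hence is divisible by u_p, and the quotient v'' satisfies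
v' + v'' = v. So the coefficients of the units that matter at u_p + v and its divisors lie strictly
below v, with the single exception of the pair (u_p, v). -/
theorem IsNice.sdvd_or_eq (hR : T.IsNice k) {p : P} {v v' w w' : T.monoid} (hw : w ≠ 0)
    (hf : T.f v = 0) (hf' : T.f v' = 0) (h : v' + (w + w') = hR.u p + v) :
    SDvd v' v ∨ (w = hR.u p ∧ v' = v ∧ w' = 0) := by
  have h1 : T.f (w + w' : T.monoid) = T.f (hR.u p) := by
    have := congrArg (fun u : T.monoid => T.f u) h
    simpa [hf, hf'] using this
  have h0 : w + w' ≠ 0 := fun h0 => hw (eq_zero_of_add_eq_zero ((add_comm w' w).trans h0))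
  obtain ⟨v'', -, hv''⟩ := hR.exists_add h0 h1
  have h2 : v' + v'' = v := by
    rw [← hv'', add_left_comm] at h
    exact add_left_cancel h
  by_cases h3 : v'' = 0
  · subst h3
    rw [add_zero] at h2 hv''
    have h4 := eq_of_add_of_notMem (hR.u_notMem p) hw hv''.symm
    refine Or.inr ⟨?_, h2, h4⟩
    rw [hv'', h4, add_zero]
  · exact Or.inl ⟨v'', h3, h2⟩

/-- The supports of a solution lie in suitable locally finite submonoids. -/
theorem IsNice.exists_submonoids (hR : T.IsNice k) {A : Set T.monoid} (hA : LocFin A) :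
    ∃ S S₀ : AddSubmonoid T.monoid, A ⊆ S ∧ S₀ ≤ S ∧ LocFin (S : Set T.monoid) ∧
      (∀ u ∈ S₀, T.f u = 0) ∧ ∀ p (v : T.monoid), T.f v = 0 → hR.u p + v ∈ S → v ∈ S₀ := by
  -- The u_p are included for the degenerate case f(u_p) = 0 below, where u_p + u_p ∈ M' puts u_p
  -- itself into B.
  let A' : Set T.monoid := A ∪ Set.range hR.u
  have hA' : LocFin A' := hA.union (LocFin.of_finite (Set.finite_range _))
  let M' := AddSubmonoid.closure A'
  let B : Set T.monoid := ⋃ p, {v : T.monoid | T.f v = 0 ∧ hR.u p + v ∈ (M' : Set T.monoid)}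
  have hB : LocFin B := LocFin.iUnion fun p => hR.locFin_sub p hA'.closure
  have hBmem : ∀ p (v : T.monoid), T.f v = 0 → hR.u p + v ∈ M' → v ∈ AddSubmonoid.closure B :=
    fun p v hv h => AddSubmonoid.subset_closure (Set.mem_iUnion.2 ⟨p, hv, h⟩)
  have hu : ∀ p, hR.u p ∈ M' := fun p => AddSubmonoid.subset_closure (Or.inr ⟨p, rfl⟩)
  have hB0 : ∀ u ∈ AddSubmonoid.closure B, T.f u = 0 := by
    intro u hu
    induction hu using AddSubmonoid.closure_induction with
    | mem s hs =>
      obtain ⟨p, hp⟩ := Set.mem_iUnion.1 hs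
      exact hp.1
    | zero => simp
    | add a b _ _ ha hb => simp [ha, hb]
  refine ⟨AddSubmonoid.closure (A' ∪ B), AddSubmonoid.closure B, ?_,
    AddSubmonoid.closure_mono Set.subset_union_right, (hA'.union hB).closure, hB0, ?_⟩
  · exact fun a ha => AddSubmonoid.subset_closure (Or.inl (Or.inl ha))
  · intro p v hv h
    rw [AddSubmonoid.closure_union, AddSubmonoid.mem_sup] at h
    obtain ⟨m, hm, s, hs, h⟩ := h
    by_cases hm0 : m = 0
    · -- here `f(u_p) = 0`, and every monomial of degree `0` is a power of `r_p`
      subst hm0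
      rw [zero_add] at h
      have hfp : T.f (hR.u p) = 0 := by
        have := congrArg (fun u : T.monoid => T.f u) h
        simpa [hv, hB0 s hs] using this.symm
      have hall : ∀ v : T.monoid, T.f v = 0 → v ∈ AddSubmonoid.closure B := by
        intro v
        induction v using (sdvd_wf (T := T)).induction with
        | _ v ih =>
        intro hv
        by_cases hv0 : v = 0
        · rw [hv0]
          exact zero_mem _
        · obtain ⟨v', hv', hvv⟩ := hR.exists_add hv0 (hv.trans hfp.symm)
          rw [← hvv]
          exact add_mem (hBmem p _ hfp (add_mem (hu p) (hu p)))
            (ih v' (SDvd.of_add' hvv (hR.u_ne_zero p)) hv')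
      exact hall v hv
    -- As m has degree f(u_p), it equals u_p + v' with v' ∈ B; cancelling u_p gives v = v' + s.
    · have hfm : T.f m = T.f (hR.u p) := by
        have := congrArg (fun u : T.monoid => T.f u) h
        simpa [hv, hB0 s hs] using this
      obtain ⟨v', hv', rfl⟩ := hR.exists_add hm0 hfm
      rw [add_assoc] at h
      rw [← add_left_cancel h]
      exact add_mem (hBmem p v' hv' hm) hs

end Nice

/-! ### Abstract deformation theory -/

/-- `x` has degree `y` and no constant term; no finiteness is required. -/
def IsGraded (T : ToricDatum 𝔾 P) (gr : G → Submodule k L) (y : G) (x : T.monoid → L) : Prop :=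
  (∀ u : T.monoid, x u ∈ gr (y - T.f u)) ∧ x 0 = 0

/-- The formal properties of an equation `d x_u + a_u + W_u(β, x, a) = 0`, expressing that `x`
defines an equivalence from `β` to `a`, that are needed to solve it order by order. -/
structure DeformationTheory (k : Type*) [Field k] (T : ToricDatum 𝔾 P) (L : Type*)
    [AddCommGroup L] [Module k L] where
  gr : G → Submodule k L
  d : G → L →ₗ[k] L
  IsMC : (T.monoid → L) → Prop
  W : (T.monoid → L) → (T.monoid → L) → (T.monoid → L) → T.monoid → L
  isMC_twist : ∀ (θ : P → (FormalSums k T.monoid)ˣ) a, T.IsGraded gr (𝔾.ι 1) a → IsMC a →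
    IsMC (twist θ a)
  W_congr : ∀ β x x' a a' u, T.IsGraded gr (𝔾.ι 1) β → T.IsGraded gr 0 x → T.IsGraded gr 0 x' →
    T.IsGraded gr (𝔾.ι 1) a → T.IsGraded gr (𝔾.ι 1) a' →
    (∀ v, SDvd v u → x v = x' v ∧ a v = a' v) → W β x a u = W β x' a' u
  W_mem : ∀ β x a (u : T.monoid), T.IsGraded gr (𝔾.ι 1) β → T.IsGraded gr 0 x → T.IsGraded gr (𝔾.ι 1) a →
    W β x a u ∈ gr (𝔾.ι 1 - T.f u)
  -- The Bianchi identity: once the equation holds at all strict divisors of u, its left side at u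
  -- is a cocycle, whatever x_u is.
  W_cocycle : ∀ β x a (u : T.monoid), T.IsGraded gr (𝔾.ι 1) β → IsMC β → T.IsGraded gr 0 x →
    T.IsGraded gr (𝔾.ι 1) a → IsMC a →
    (∀ v : T.monoid, SDvd v u → d (0 - T.f v) (x v) + a v + W β x a v = 0) →
    d (𝔾.ι 1 - T.f u) (d (0 - T.f u) (x u) + a u + W β x a u) = 0
  d_irr : ∀ a (u : T.monoid), T.IsGraded gr (𝔾.ι 1) a → IsMC a → u ∉ T.filt 2 →
    d (𝔾.ι 1 - T.f u) (a u) = 0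
  W_irr : ∀ β x a u, T.IsGraded gr (𝔾.ι 1) β → T.IsGraded gr 0 x → T.IsGraded gr (𝔾.ι 1) a →
    u ∉ T.filt 2 → W β x a u = -β u
  W_supp : ∀ β x a (S : AddSubmonoid T.monoid), T.IsGraded gr (𝔾.ι 1) β → T.IsGraded gr 0 x →
    T.IsGraded gr (𝔾.ι 1) a → (∀ u, β u ≠ 0 → u ∈ S) → (∀ u, x u ≠ 0 → u ∈ S) →
    (∀ u, a u ≠ 0 → u ∈ S) → ∀ u, W β x a u ≠ 0 → u ∈ S

/-- The submonoid of exponents of degree `0`. -/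
def degZero (T : ToricDatum 𝔾 P) : AddSubmonoid T.monoid where
  carrier := {u | T.f u = 0}
  zero_mem' := by simp
  add_mem' := fun {a b} ha hb => by
    change T.f _ = 0 at ha hb
    change T.f _ = 0
    simp [ha, hb]

theorem IsGraded.twist {gr : G → Submodule k L} {y : G} {x : T.monoid → L}
    (hx : T.IsGraded gr y x) {θ : P → (FormalSums k T.monoid)ˣ}
    (hθ : ∀ p, (θ p : FormalSums k T.monoid) ∈ supportedIn k T.degZero) :
    T.IsGraded gr y (twist θ x) := by
  refine ⟨fun u => Submodule.sum_mem _ fun z hz => ?_, (twist_zero θ x).trans hx.2⟩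
  by_cases h : (pw θ z.1 : FormalSums k T.monoid) z.2 = 0
  · rw [h, zero_smul]
    exact zero_mem _
  · have h1 : T.f z.2 = 0 := pw_mem hθ _ _ h
    have h2 : T.f z.1 = T.f u := by
      rw [← mem_antidiagonal.1 hz]
      simp [h1]
    rw [← h2]
    exact Submodule.smul_mem _ _ (hx.1 _)

/-- The spanning condition is applied to a cocycle concentrated at u. As the monoid is cancellative,
at most one coefficient of each φ_p contributes there. -/
theorem SpansH1.exists_of_single {gr : G → Submodule k L} {d : G → L →ₗ[k] L} {S : Set T.monoid}
    {e : P → T.monoid} {a : P → L} (h : T.SpansH1 gr (fun y => d y) S e a) {u : T.monoid}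
    (hu : u ∈ S) {z : L} (hz : z ∈ gr (𝔾.ι 1 - T.f u)) (hd : d (𝔾.ι 1 - T.f u) z = 0) :
    ∃ s : P → k, ∃ b ∈ gr (0 - T.f u), z = (∑ p, s p • a p) + d (0 - T.f u) b ∧
      ∀ p, s p ≠ 0 → ∃ v : T.monoid, T.f v = 0 ∧ v + e p = u := by
  classical
  obtain ⟨φ, b, hφ, hb, hzb⟩ := h (Finsupp.single u z)
    (fun w hw => by
      have := Finsupp.support_single_subset hw
      rw [Finset.mem_singleton] at this
      rwa [this])
    (fun w => by
      by_cases hw : w = u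
      · subst hw
        simpa using hz
      · rw [Finsupp.single_eq_of_ne hw]
        exact zero_mem _)
    (fun w => by
      by_cases hw : w = u
      · subst hw
        simpa using hd
      · rw [Finsupp.single_eq_of_ne hw]
        exact map_zero _)
  have h1 : ∀ p, ∃ s : k, (∑ᶠ (v : T.monoid) (_ : v + e p = u), φ p v • a p) = s • a p ∧
      (s ≠ 0 → ∃ v : T.monoid, T.f v = 0 ∧ v + e p = u) := by
    intro p
    by_cases hv : ∃ v, v + e p = u
    · obtain ⟨v, hv⟩ := hv
      refine ⟨φ p v, ?_, fun h => ⟨v, hφ p v h, hv⟩⟩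
      rw [finsum_eq_single _ v]
      · rw [finsum_eq_if, if_pos hv]
      · intro v' hv'
        rw [finsum_eq_if, if_neg]
        intro h
        exact hv' (add_right_cancel (h.trans hv.symm))
    · refine ⟨0, ?_, fun h => absurd rfl h⟩
      rw [zero_smul, finsum_eq_zero_of_forall_eq_zero]
      intro v
      rw [finsum_eq_if, if_neg fun h => hv ⟨v, h⟩]
  choose s hs hs' using h1
  refine ⟨s, b u, hb u, ?_, hs'⟩
  have := hzb u hu
  rw [Finsupp.single_eq_same] at this
  rw [this]
  simp only [hs]

namespace DeformationTheory

variable [DecidableEq P]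

/-- Irreducibility of u_p and α_0 = 0 leave only the decomposition (u_p, 0), so just the constant
term of θ_p is seen. -/
theorem twist_u (hR : T.IsNice k) {α : T.monoid → L} (hα : α 0 = 0)
    (θ : P → (FormalSums k T.monoid)ˣ) (p : P) :
    twist θ α (hR.u p) = (θ p : FormalSums k T.monoid) 0 • α (hR.u p) := by
  rw [twist, Finset.sum_eq_single (hR.u p, 0)]
  · have : pw θ (hR.u p : P → ℤ) = θ p := pw_single θ p
    rw [this]
  · intro y hy hne
    have hy' := mem_antidiagonal.1 hy
    by_cases h : y.1 = 0
    · rw [h, hα, smul_zero]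
    · have h2 := eq_of_add_of_notMem (hR.u_notMem p) h hy'
      exact absurd (Prod.ext (by rw [← hy', h2, add_zero]) h2) hne
  · exact fun h => absurd (mem_antidiagonal.2 (add_zero _)) h

variable (D : DeformationTheory k T L) (hR : T.IsNice k)

/-- The first-order classes of `β` are non-zero multiples of those of `α`. -/
theorem exists_scale {α β : T.monoid → L} (hα : T.IsGraded D.gr (𝔾.ι 1) α) (hαm : D.IsMC α)
    (hβ : T.IsGraded D.gr (𝔾.ι 1) β) (hβm : D.IsMC β)
    (hs : T.SpansH1 D.gr (fun y => D.d y) (T.filt 1) hR.u fun p => α (hR.u p))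
    (hs' : T.SpansH1 D.gr (fun y => D.d y) (T.filt 1 \ T.filt 2) hR.u fun p => β (hR.u p)) (p : P) :
    ∃ c : k, c ≠ 0 ∧ ∃ b ∈ D.gr (0 - T.f (hR.u p)),
      β (hR.u p) = c • α (hR.u p) + D.d (0 - T.f (hR.u p)) b := by
  have hmem := mem_filt_one.2 (hR.u_ne_zero p)
  have key : ∀ (s : P → k) (x : P → L),
      (∀ q, s q ≠ 0 → ∃ v : T.monoid, T.f v = 0 ∧ v + hR.u q = hR.u p) →
      ∑ q, s q • x q = s p • x p := by
    intro s x h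
    refine Finset.sum_eq_single p (fun q _ hq => ?_) fun h => absurd (Finset.mem_univ p) h
    by_contra hne
    obtain ⟨v, -, hv⟩ := h q fun h => hne (by rw [h, zero_smul])
    exact hq (hR.eq_of_u_add ((add_comm _ _).trans hv)).2
  obtain ⟨s, b, hb, h1, h2⟩ := hs.exists_of_single hmem (hβ.1 _)
    (D.d_irr β _ hβ hβm (hR.u_notMem p))
  rw [key s _ h2] at h1
  -- If the multiple is 0, then β_{u_p} is exact. The classes of β span over m̃/m̃^2, so α_{u_p} is
  -- then exact as well and the constant 1 will do.
  by_cases hsp : s p = 0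
  · obtain ⟨t, b', hb', h3, h4⟩ := hs'.exists_of_single ⟨hmem, hR.u_notMem p⟩ (hα.1 _)
      (D.d_irr α _ hα hαm (hR.u_notMem p))
    rw [key t _ h4] at h3
    rw [hsp, zero_smul, zero_add] at h1
    refine ⟨1, one_ne_zero, b - (t p • b + b'),
      sub_mem hb (add_mem (Submodule.smul_mem _ _ hb) hb'), ?_⟩
    rw [h3, h1, map_sub, map_add, map_smul, one_smul]
    abel
  · exact ⟨s p, hsp, b, hb, h1⟩

/-- A primitive of `z`, if there is one; zero for `z = 0`. -/
theorem exists_prim : ∃ prim : ∀ u : T.monoid, L →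
    {z : L // z ∈ D.gr (0 - T.f u) ∧ (u = 0 → z = 0)}, (∀ u, (prim u 0 : L) = 0) ∧
      ∀ u : T.monoid, u ≠ 0 → ∀ z, (∃ b ∈ D.gr (0 - T.f u), D.d (0 - T.f u) b = z) →
        D.d (0 - T.f u) (prim u z) = z := by
  have h : ∀ (u : T.monoid) (z : L), ∃ b : {z : L // z ∈ D.gr (0 - T.f u) ∧ (u = 0 → z = 0)},
      (z = 0 → (b : L) = 0) ∧ (u ≠ 0 → (∃ b ∈ D.gr (0 - T.f u), D.d (0 - T.f u) b = z) →
        D.d (0 - T.f u) b = z) := by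
    intro u z
    by_cases h : z ≠ 0 ∧ u ≠ 0 ∧ ∃ b ∈ D.gr (0 - T.f u), D.d (0 - T.f u) b = z
    · obtain ⟨hz, hu, b, hb, hbz⟩ := h
      exact ⟨⟨b, hb, fun h => absurd h hu⟩, fun h => absurd h hz, fun _ _ => hbz⟩
    · refine ⟨⟨0, zero_mem _, fun _ => rfl⟩, fun _ => rfl, fun hu hb => ?_⟩
      have hz : z = 0 := by
        by_contra hz
        exact h ⟨hz, hu, hb⟩
      rw [hz]
      exact map_zero _
  choose prim h1 h2 using h
  exact ⟨prim, fun u => h1 u 0 rfl, fun u hu z => h2 u z hu⟩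

/-- The selected scalar is the coefficient that a unit needs in order to make the obstruction z
exact. It is chosen as a function of z that vanishes at z = 0, which is what controls the supports
of the units. -/
theorem exists_sel (α : T.monoid → L) : ∃ sel : P → T.monoid → L → k, (∀ p u, sel p u 0 = 0) ∧
    ∀ p (u : T.monoid) z, (∃ t : k, ∃ b ∈ D.gr (0 - T.f u), D.d (0 - T.f u) b = z + t • α (hR.u p)) →
      ∃ b ∈ D.gr (0 - T.f u), D.d (0 - T.f u) b = z + sel p u z • α (hR.u p) := by
  have h : ∀ (p : P) (u : T.monoid) (z : L), ∃ t : k, (z = 0 → t = 0) ∧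
      ((∃ t : k, ∃ b ∈ D.gr (0 - T.f u), D.d (0 - T.f u) b = z + t • α (hR.u p)) →
      ∃ b ∈ D.gr (0 - T.f u), D.d (0 - T.f u) b = z + t • α (hR.u p)) := by
    intro p u z
    by_cases hz : z = 0
    · exact ⟨0, fun _ => rfl, fun _ => ⟨0, zero_mem _, by simp [hz]⟩⟩
    · by_cases h : ∃ t : k, ∃ b ∈ D.gr (0 - T.f u), D.d (0 - T.f u) b = z + t • α (hR.u p)
      · obtain ⟨t, ht⟩ := h
        exact ⟨t, fun h => absurd h hz, fun _ => ht⟩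
      · exact ⟨0, fun _ => rfl, fun h' => absurd h' h⟩
  choose sel h1 h2 using h
  exact ⟨sel, fun p u => h1 p u 0 rfl, h2⟩

open scoped Classical in
/-- The family of units with constant terms `c` and coefficients `φ` in degree `0`. -/
noncomputable def unitsOf {c : P → k} (hc : ∀ p, c p ≠ 0) (φ : T.monoid → P → k) (p : P) :
    (FormalSums k T.monoid)ˣ :=
  (isUnit_formalSums (c := fun v : T.monoid => if v = 0 then c p else if T.f v = 0 then φ v p else 0)
    (by rw [if_pos rfl]; exact hc p)).unit

open scoped Classical in
theorem unitsOf_apply {c : P → k} (hc : ∀ p, c p ≠ 0) (φ : T.monoid → P → k) (p : P)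
    (v : T.monoid) : (unitsOf hc φ p : FormalSums k T.monoid) v =
      if v = 0 then c p else if T.f v = 0 then φ v p else 0 := rfl

theorem unitsOf_mem_degZero {c : P → k} (hc : ∀ p, c p ≠ 0) (φ : T.monoid → P → k) (p : P) :
    (unitsOf hc φ p : FormalSums k T.monoid) ∈ supportedIn k T.degZero := by
  classical
  intro v hv
  rw [unitsOf_apply] at hv
  by_cases h0 : v = 0
  · rw [h0]
    exact zero_mem _
  · by_contra h
    exact hv ((if_neg h0).trans (if_neg h))

/-- By `IsNice.sdvd_or_eq`, every term but the one for (u_p, v) involves the units only at strict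
divisors of v. This locality makes the recursion for φ legitimate. -/
theorem twist_unitsOf_congr {α : T.monoid → L} (hα : α 0 = 0) {c : P → k} (hc : ∀ p, c p ≠ 0)
    {φ φ' : T.monoid → P → k} {p : P} {v : T.monoid} (hv : T.f v = 0)
    (h : ∀ v', SDvd v' v → φ v' = φ' v') :
    (∀ u, SDvd u (hR.u p + v) → twist (unitsOf hc φ) α u = twist (unitsOf hc φ') α u) ∧
      twist (unitsOf hc φ) α (hR.u p + v) -
          (unitsOf hc φ p : FormalSums k T.monoid) v • α (hR.u p) =
        twist (unitsOf hc φ') α (hR.u p + v) -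
          (unitsOf hc φ' p : FormalSums k T.monoid) v • α (hR.u p) := by
  classical
  -- Both claims at once: w' = 0 treats the terms at u_p + v, and w' ≠ 0 those at its strict
  -- divisors.
  have key : ∀ (y : T.monoid × T.monoid) (w' : T.monoid), y.1 + y.2 + w' = hR.u p + v →
      ¬ (y = (hR.u p, v) ∧ w' = 0) →
      (pw (unitsOf hc φ) y.1 : FormalSums k T.monoid) y.2 • α y.1 =
        (pw (unitsOf hc φ') y.1 : FormalSums k T.monoid) y.2 • α y.1 := by
    rintro ⟨w, v'⟩ w' hsum hne
    by_cases hw : w = 0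
    · simp only [hw, hα, smul_zero]
    by_cases hv' : T.f v' = 0
    · have h1 : v' + (w + w') = hR.u p + v := by
        rw [← hsum]
        abel
      rcases hR.sdvd_or_eq hw hv hv' h1 with h2 | ⟨rfl, rfl, rfl⟩
      · congr 1
        refine pw_congr (fun q a b hab => ?_) _
        have h3 : SDvd a v := by
          by_cases hb : b = 0
          · rw [hb, add_zero] at hab
            exact hab ▸ h2
          · exact SDvd.trans ⟨b, hb, hab⟩ h2
        rw [unitsOf_apply, unitsOf_apply, h a h3]
      · exact absurd ⟨rfl, rfl⟩ hne
    · have h1 : ∀ φ : T.monoid → P → k, (pw (unitsOf hc φ) w : FormalSums k T.monoid) v' = 0 := by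
        intro φ
        by_contra h
        exact hv' (pw_mem (unitsOf_mem_degZero hc φ) _ _ h)
      rw [h1, h1]
  constructor
  · rintro u ⟨w', hw', hsum⟩
    refine Finset.sum_congr rfl fun y hy => key y w' ?_ fun h => hw' h.2
    rw [mem_antidiagonal.1 hy, hsum]
  · have hm : ((hR.u p, v) : T.monoid × T.monoid) ∈ antidiagonal (hR.u p + v) :=
      mem_antidiagonal.2 (Eq.refl _)
    have h1 : ∀ φ, twist (unitsOf hc φ) α (hR.u p + v) -
        (unitsOf hc φ p : FormalSums k T.monoid) v • α (hR.u p) =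
        ∑ y ∈ (antidiagonal (hR.u p + v)).erase (hR.u p, v),
          (pw (unitsOf hc φ) y.1 : FormalSums k T.monoid) y.2 • α y.1 := by
      intro φ
      rw [twist, ← Finset.add_sum_erase _ _ hm]
      have : pw (unitsOf hc φ) (hR.u p : P → ℤ) = unitsOf hc φ p := pw_single _ p
      rw [this, add_sub_cancel_left]
    rw [h1, h1]
    refine Finset.sum_congr rfl fun y hy => key y 0 ?_ fun h => ?_
    · rw [add_zero, mem_antidiagonal.1 (Finset.mem_of_mem_erase hy)]
    · exact (Finset.mem_erase.1 hy).1 h.1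

/-- Completeness: the equation `d x + a + W(β, x, a) = 0` has a solution with `a` a rescaling
of `α`. -/
theorem exists_solution {α β : T.monoid → L} (hα : T.IsGraded D.gr (𝔾.ι 1) α) (hαm : D.IsMC α)
    (hαf : LocFin {u | α u ≠ 0}) (hβ : T.IsGraded D.gr (𝔾.ι 1) β) (hβm : D.IsMC β)
    (hβf : LocFin {u | β u ≠ 0})
    (hs : T.SpansH1 D.gr (fun y => D.d y) (T.filt 1) hR.u fun p => α (hR.u p))
    (hs' : T.SpansH1 D.gr (fun y => D.d y) (T.filt 1 \ T.filt 2) hR.u fun p => β (hR.u p)) :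
    ∃ ψ ∈ T.aut k, ∃ c : P → (T.ring k)ˣ, IsRescaling ψ c ∧ ∃ x, T.MemTensorM D.gr 0 x ∧
      ∀ u : T.monoid, D.d (0 - T.f u) (x u) + push ψ α u + D.W β x (push ψ α) u = 0 := by
  classical
  choose c hc bc hbc hβc using D.exists_scale hR hα hαm hβ hβm hs hs'
  obtain ⟨prim, hprim0, hprim⟩ := D.exists_prim
  obtain ⟨sel, hsel0, hsel⟩ := D.exists_sel hR α
  let X : T.monoid → Type _ := fun u => {z : L // z ∈ D.gr (0 - T.f u) ∧ (u = 0 → z = 0)}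
  have hXne : ∀ u, Nonempty (X u) := fun u => ⟨⟨0, zero_mem _, fun _ => rfl⟩⟩
  have hX : ∀ x : ∀ u, X u, T.IsGraded D.gr 0 fun u => (x u : L) :=
    fun x => ⟨fun u => (x u).2.1, (x 0).2.2 rfl⟩
  let a : (T.monoid → P → k) → T.monoid → L := fun φ => twist (unitsOf hc φ) α
  have ha : ∀ φ, T.IsGraded D.gr (𝔾.ι 1) (a φ) := fun φ => hα.twist (unitsOf_mem_degZero hc φ)
  have ham : ∀ φ, D.IsMC (a φ) := fun φ => D.isMC_twist _ _ hα hαm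
  -- For every φ, solvable or not, x is defined by taking the selected primitive, which is 0 where
  -- none exists. Only afterwards is φ chosen so that primitives do exist.
  have hx : ∀ φ, ∃ x : ∀ u, X u, ∀ u, x u =
      prim u (-(a φ u + D.W β (fun u => (x u : L)) (a φ) u)) := by
    intro φ
    refine (sdvd_wf (T := T)).exists_fixed
      (fun (x : ∀ u, X u) u => prim u (-(a φ u + D.W β (fun u => (x u : L)) (a φ) u))) ?_
    intro x y u h
    rw [D.W_congr β _ (fun u => (y u : L)) _ _ u hβ (hX x) (hX y) (ha φ) (ha φ)
      fun v hv => ⟨congrArg Subtype.val (h v hv), rfl⟩]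
  choose x hx using hx
  let w : (T.monoid → P → k) → T.monoid → L := fun φ => D.W β (fun u => (x φ u : L)) (a φ)
  have hxw : ∀ φ u, x φ u = prim u (-(a φ u + w φ u)) := hx
  have hwloc : ∀ φ φ' u, (∀ v, SDvd v u → a φ v = a φ' v) → w φ u = w φ' u := by
    intro φ φ' u
    induction u using (sdvd_wf (T := T)).induction with
    | _ u ih =>
    intro h
    refine D.W_congr β _ _ _ _ u hβ (hX _) (hX _) (ha _) (ha _) fun v hv => ⟨?_, h v hv⟩
    rw [hxw, hxw, h v hv, ih v hv fun v' hv' => h v' (hv'.trans hv)]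
  -- The obstruction at u_p + v with the contribution of φ_v removed; it depends on φ only strictly
  -- below v.
  let z : (T.monoid → P → k) → P → T.monoid → L := fun φ p v =>
    a φ (hR.u p + v) - (unitsOf hc φ p : FormalSums k T.monoid) v • α (hR.u p) + w φ (hR.u p + v)
  have hzloc : ∀ φ φ' p (v : T.monoid), T.f v = 0 → (∀ v', SDvd v' v → φ v' = φ' v') →
      z φ p v = z φ' p v := by
    intro φ φ' p v hv h
    obtain ⟨h1, h2⟩ := twist_unitsOf_congr hR hα.2 hc (p := p) hv h
    exact congrArg₂ (· + ·) h2 (hwloc φ φ' _ h1)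
  let F : (T.monoid → P → k) → T.monoid → P → k := fun φ v p =>
    if T.f v = 0 then sel p (hR.u p + v) (z φ p v) else 0
  have hF : ∀ φ φ' v, (∀ v', SDvd v' v → φ v' = φ' v') → F φ v = F φ' v := by
    intro φ φ' v h
    funext p
    by_cases hv : T.f v = 0
    · simp only [F, if_pos hv, hzloc φ φ' p v hv h]
    · simp only [F, if_neg hv]
  obtain ⟨φ, hφ⟩ := (sdvd_wf (T := T)).exists_fixed (X := fun _ => P → k) F hF
  -- the supports
  obtain ⟨S, S₀, hAS, hS₀S, hSf, hS₀, hSS⟩ := hR.exists_submonoids (hαf.union hβf)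
  have hSα : ∀ u, α u ≠ 0 → u ∈ S := fun u hu => hAS (Or.inl hu)
  have hSβ : ∀ u, β u ≠ 0 → u ∈ S := fun u hu => hAS (Or.inr hu)
  have hunits : ∀ φ : T.monoid → P → k, (∀ v p, φ v p ≠ 0 → v ∈ S₀) →
      ∀ p, (unitsOf hc φ p : FormalSums k T.monoid) ∈ supportedIn k S₀ := by
    intro φ h p v hv
    rw [unitsOf_apply] at hv
    by_cases h0 : v = 0
    · rw [h0]
      exact zero_mem _
    · rw [if_neg h0] at hv
      refine h v p fun h' => hv ?_
      rw [h', ite_self]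
  have hsupp : ∀ φ : T.monoid → P → k, (∀ v p, φ v p ≠ 0 → v ∈ S₀) →
      (∀ u, a φ u ≠ 0 → u ∈ S) ∧ (∀ u, (x φ u : L) ≠ 0 → u ∈ S) ∧ ∀ u, w φ u ≠ 0 → u ∈ S := by
    intro φ h
    have h1 : ∀ u, a φ u ≠ 0 → u ∈ S := fun u =>
      twist_supp (fun p v hv => hS₀S (hunits φ h p v hv)) hSα
    have h2 : ∀ u, (∀ v, SDvd v u → (x φ v : L) ≠ 0 → v ∈ S) → w φ u ≠ 0 → u ∈ S := by
      intro u hu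
      -- Truncating x to the strict divisors of u does not change W at u, and the support of the
      -- truncation is controlled by the induction.
      let x' : ∀ u, X u := fun v => if SDvd v u then x φ v else ⟨0, zero_mem _, fun _ => rfl⟩
      have e : w φ u = D.W β (fun u => (x' u : L)) (a φ) u :=
        D.W_congr β _ _ _ _ u hβ (hX _) (hX x') (ha _) (ha _) fun v hv =>
          ⟨by simp only [x', if_pos hv], rfl⟩
      rw [e]
      refine D.W_supp β _ _ S hβ (hX x') (ha _) hSβ (fun v hv => ?_) h1 u
      by_cases h : SDvd v u
      · exact hu v h (by simpa only [x', if_pos h] using hv)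
      · exact absurd (by simp only [x', if_neg h]) hv
    have h3 : ∀ u, (x φ u : L) ≠ 0 → u ∈ S := by
      intro u
      induction u using (sdvd_wf (T := T)).induction with
      | _ u ih =>
      intro hu
      by_contra hS
      refine hu ?_
      rw [hxw, not_not.1 (mt (h1 u) hS), not_not.1 (mt (h2 u ih) hS), add_zero, neg_zero, hprim0]
    exact ⟨h1, h3, fun u => h2 u fun v _ => h3 v⟩
  have hφS : ∀ v p, φ v p ≠ 0 → v ∈ S₀ := by
    intro v
    induction v using (sdvd_wf (T := T)).induction with
    | _ v ih =>
    intro p hne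
    -- The truncation of φ to S₀ agrees with φ below v by induction, hence yields the same value at
    -- v, and all supports built from it are known to lie in S.
    let φ' : T.monoid → P → k := fun v p => if v ∈ S₀ then φ v p else 0
    have hφ' : ∀ v p, φ' v p ≠ 0 → v ∈ S₀ := by
      intro v p h
      by_contra hv
      exact h (if_neg hv)
    have heq : ∀ v', SDvd v' v → φ v' = φ' v' := by
      intro v' hv'
      funext q
      by_cases hq : v' ∈ S₀
      · exact (if_pos hq).symm
      · exact (not_not.1 (mt (ih v' hv' q) hq)).trans (if_neg hq).symm
    rw [hφ v, hF φ φ' v heq] at hne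
    by_cases hv : T.f v = 0
    · simp only [F, if_pos hv] at hne
      by_contra hvS
      refine hne ?_
      have hS' : hR.u p + v ∉ S := fun h => hvS (hSS p v hv h)
      obtain ⟨h1, -, h3⟩ := hsupp φ' hφ'
      have hzero : z φ' p v = 0 := by
        simp only [z]
        rw [not_not.1 (mt (h1 _) hS'), not_not.1 (mt (h3 _) hS'),
          not_not.1 (mt (hunits φ' hφ' p v) hvS), zero_smul, sub_zero, add_zero]
      rw [hzero, hsel0]
    · simp only [F, if_neg hv] at hne
      exact absurd rfl hne
  -- the equation
  have heqn : ∀ u : T.monoid, D.d (0 - T.f u) (x φ u) + a φ u + w φ u = 0 := by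
    intro u
    induction u using (sdvd_wf (T := T)).induction with
    | _ u ih =>
    by_cases hu0 : u = 0
    · subst hu0
      have h1 : w φ 0 = -β 0 := D.W_irr β _ _ 0 hβ (hX _) (ha _)
        fun h => T.zero_notMem_filt_one (filt_succ_subset 1 h)
      have h2 : (x φ 0 : L) = 0 := (hX (x φ)).2
      rw [h1, hβ.2, h2, (ha φ).2]
      simp
    suffices h : ∃ b ∈ D.gr (0 - T.f u), D.d (0 - T.f u) b = a φ u + w φ u by
      obtain ⟨b, hb, hbz⟩ := h
      rw [hxw, hprim u hu0 _ ⟨-b, neg_mem hb, by rw [map_neg, hbz]⟩]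
      abel
    have hcocycle : D.d (𝔾.ι 1 - T.f u) (a φ u + w φ u) = 0 := by
      -- With x_u replaced by 0, the cocycle property speaks of a_u + W_u alone; d ∘ d = 0 is not
      -- among the formal properties.
      let x' : ∀ u, X u := fun v => if v = u then ⟨0, zero_mem _, fun _ => rfl⟩ else x φ v
      have hx'u : (x' u : L) = 0 := by simp only [x', if_pos rfl]
      have hx'v : ∀ v, v ≠ u → x' v = x φ v := fun v hv => if_neg hv
      have hW : ∀ v, (v = u ∨ SDvd v u) → D.W β (fun u => (x' u : L)) (a φ) v = w φ v := by
        intro v hv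
        refine D.W_congr β _ _ _ _ v hβ (hX _) (hX _) (ha _) (ha _) fun v' hv' => ⟨?_, rfl⟩
        rw [hx'v]
        rintro rfl
        rcases hv with rfl | hv
        · exact SDvd.irrefl _ hv'
        · exact SDvd.irrefl _ (hv.trans hv')
      have := D.W_cocycle β (fun u => (x' u : L)) (a φ) u hβ hβm (hX _) (ha φ) (ham φ) (by
        intro v hv
        rw [hW v (Or.inr hv), hx'v v (by rintro rfl; exact SDvd.irrefl _ hv)]
        exact ih v hv)
      rwa [hW u (Or.inl rfl), hx'u, map_zero, zero_add] at this
    obtain ⟨s, b, hb, h1, h2⟩ := hs.exists_of_single (mem_filt_one.2 hu0)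
      (add_mem ((ha φ).1 u) (D.W_mem β _ _ u hβ (hX (x φ)) (ha φ))) hcocycle
    by_cases hs0 : ∃ p, s p ≠ 0
    · obtain ⟨p, hp⟩ := hs0
      obtain ⟨v, hv, hvu⟩ := h2 p hp
      -- If u_q + v' = u_p + v with v and v' of degree 0, then f(u_q) = f(u_p), hence q = p.
      have hsum : ∑ q, s q • α (hR.u q) = s p • α (hR.u p) := by
        refine Finset.sum_eq_single p (fun q _ hq => ?_) fun h => absurd (Finset.mem_univ p) h
        by_contra hne
        obtain ⟨v', hv', hvu'⟩ := h2 q fun h => hne (by rw [h, zero_smul])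
        refine hq (hR.eq_of_f_u ?_)
        have := congrArg (fun u : T.monoid => T.f u) (hvu'.trans hvu.symm)
        simpa [hv, hv'] using this
      rw [hsum] at h1
      rw [add_comm] at hvu
      subst hvu
      -- For v = 0 nothing is left to choose: the constants c_p make the first-order equation
      -- solvable. For v ≠ 0 the scalar φ_v does so.
      by_cases hv0 : v = 0
      · subst hv0
        have e : hR.u p + 0 = hR.u p := add_zero _
        have h3 : w φ (hR.u p) = -β (hR.u p) := D.W_irr β _ _ _ hβ (hX _) (ha _) (hR.u_notMem p)
        have h4 : a φ (hR.u p) = c p • α (hR.u p) := by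
          refine (twist_u hR hα.2 _ p).trans ?_
          rw [unitsOf_apply, if_pos rfl]
        rw [e, h3, h4, hβc p]
        refine ⟨-bc p, neg_mem (hbc p), ?_⟩
        rw [map_neg]
        abel
      · have hφv : (unitsOf hc φ p : FormalSums k T.monoid) v = φ v p := by
          rw [unitsOf_apply, if_neg hv0, if_pos hv]
        have hz : a φ (hR.u p + v) + w φ (hR.u p + v) = z φ p v + φ v p • α (hR.u p) := by
          simp only [z, hφv]
          abel
        have hφF : φ v p = sel p (hR.u p + v) (z φ p v) := by
          rw [hφ v]
          exact if_pos hv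
        rw [hz, show φ v p • α (hR.u p) = sel p (hR.u p + v) (z φ p v) • α (hR.u p) by
          rw [← hφF]]
        -- As z + φ_v α_{u_p} = s_p α_{u_p} + d b, the scalar φ_v - s_p makes z exact up to its
        -- multiple of α_{u_p}. A suitable scalar thus exists, and so the selected one works.
        refine hsel p _ _ ⟨φ v p - s p, b, hb, ?_⟩
        rw [sub_smul, add_sub, ← hz]
        exact (sub_eq_of_eq_add' h1).symm
    · push Not at hs0
      refine ⟨b, hb, ?_⟩
      rw [h1]
      simp [hs0]
  obtain ⟨ψ, hψ, C, hC, hCθ⟩ := exists_rescaling (hunits φ hφS) hS₀ (hSf.mono hS₀S)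
  have hpush : push ψ α = a φ := by
    rw [push_eq_twist hC]
    congr 1
    exact funext fun p => Units.ext (hCθ p)
  refine ⟨ψ, hψ, C, hC, fun u => x φ u, ⟨⟨(hX _).1, hSf.mono fun u hu => ?_⟩, (hX _).2⟩, ?_⟩
  · exact (hsupp φ hφS).2.1 u hu
  · rw [hpush]
    exact heqn

/-- Uniqueness on `m / m ^ 2` of the automorphism. -/
theorem sub_mem_of_solutions {α β : T.monoid → L} (hα : T.IsGraded D.gr (𝔾.ι 1) α)
    (hβ : T.IsGraded D.gr (𝔾.ι 1) β)
    (hne : ∀ p, ¬ ∃ b ∈ D.gr (0 - T.f (hR.u p)), D.d (0 - T.f (hR.u p)) b = α (hR.u p))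
    {ψ ψ' : T.ring k ≃ₐ[k] T.ring k} (hψ : ψ ∈ T.aut k) (hψ' : ψ' ∈ T.aut k)
    {x x' : T.monoid → L} (hx : T.IsGraded D.gr 0 x) (hx' : T.IsGraded D.gr 0 x')
    (h : ∀ u : T.monoid, D.d (0 - T.f u) (x u) + push ψ α u + D.W β x (push ψ α) u = 0)
    (h' : ∀ u : T.monoid, D.d (0 - T.f u) (x' u) + push ψ' α u + D.W β x' (push ψ' α) u = 0)
    {y : T.ring k} (hy : y ∈ T.adic k 1) : ψ y - ψ' y ∈ T.adic k 2 := by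
  obtain ⟨c, hc⟩ := hR.exists_isRescaling hψ
  obtain ⟨c', hc'⟩ := hR.exists_isRescaling hψ'
  refine sub_mem_adic_two hψ hψ' hc hc' (fun p => ?_) hy
  have key : ∀ {ψ : T.ring k ≃ₐ[k] T.ring k} {c : P → (T.ring k)ˣ} {x : T.monoid → L},
      IsRescaling ψ c → T.IsGraded D.gr 0 x →
      (∀ u : T.monoid, D.d (0 - T.f u) (x u) + push ψ α u + D.W β x (push ψ α) u = 0) →
      D.d (0 - T.f (hR.u p)) (x (hR.u p)) + coeff 0 (c p : T.ring k) • α (hR.u p) =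
        β (hR.u p) := by
    intro ψ c x hc hx h
    have ha : T.IsGraded D.gr (𝔾.ι 1) (push ψ α) := by
      rw [push_eq_twist hc]
      exact hα.twist fun q u hu => hc.1 q u hu
    have h1 := h (hR.u p)
    rw [D.W_irr β x _ _ hβ hx ha (hR.u_notMem p), push_eq_twist hc, twist_u hR hα.2] at h1
    exact eq_of_sub_eq_zero ((sub_eq_add_neg _ _).trans h1)
  -- Both solutions express the same β_{u_p}. Were the constant terms different, subtracting and
  -- dividing by their difference would make α_{u_p} a coboundary.
  by_contra hcc
  refine hne p ⟨(coeff 0 (c p : T.ring k) - coeff 0 (c' p : T.ring k))⁻¹ •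
    (x' (hR.u p) - x (hR.u p)), Submodule.smul_mem _ _ (sub_mem (hx'.1 _) (hx.1 _)), ?_⟩
  have h1 := (key hc hx h).trans (key hc' hx' h').symm
  have h2 : D.d (0 - T.f (hR.u p)) (x' (hR.u p)) - D.d (0 - T.f (hR.u p)) (x (hR.u p)) =
      (coeff 0 (c p : T.ring k) - coeff 0 (c' p : T.ring k)) • α (hR.u p) := by
    rw [sub_smul, sub_eq_sub_iff_add_eq_add, ← h1]
    exact add_comm _ _
  rw [map_smul, map_sub, h2, inv_smul_smul₀ (sub_ne_zero.2 hcc)]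

end DeformationTheory

end ToricDatum

/-! ### Koszul signs, sums over decompositions, and curvature along a formal flow -/

theorem koszul_zero : koszul 0 = 1 := by simp [koszul]

theorem koszul_one : koszul 1 = -1 := by simp [koszul, ZMod.val_one]

theorem ZMod.two_cases (x : ZMod 2) : x = 0 ∨ x = 1 := by
  revert x
  decide

theorem GradingDatum.σ_ι_one {G : Type*} [AddCommGroup G] (𝔾 : GradingDatum G) :
    𝔾.σ (𝔾.ι 1) = 1 := by
  rcases ZMod.two_cases (𝔾.σ (𝔾.ι 1)) with h | h
  · obtain ⟨n, hn⟩ := 𝔾.surj 1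
    have h1 : 𝔾.σ (𝔾.ι n) = 0 := by
      have : n = n • (1 : ℤ) := by simp
      rw [this, map_zsmul, map_zsmul, h, smul_zero]
    exact absurd (h1.symm.trans hn) (by decide)
  · exact h

theorem sum_antidiagonal_assoc {M N : Type*} [AddCommMonoid M] [Finset.HasAntidiagonal M]
    [AddCommMonoid N] (F : M → M → M → N) (u : M) :
    ∑ x ∈ antidiagonal u, ∑ y ∈ antidiagonal x.2, F x.1 y.1 y.2 =
      ∑ x ∈ antidiagonal u, ∑ y ∈ antidiagonal x.1, F y.1 y.2 x.2 := by
  rw [Finset.sum_sigma', Finset.sum_sigma']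
  refine Finset.sum_bij'
    (fun x _ => ⟨(x.1.1 + x.2.1, x.2.2), (x.1.1, x.2.1)⟩)
    (fun x _ => ⟨(x.2.1, x.2.2 + x.1.2), (x.2.2, x.1.2)⟩) ?_ ?_ ?_ ?_ ?_
  · rintro ⟨⟨a, b⟩, ⟨c, d⟩⟩ h
    simp only [Finset.mem_sigma, mem_antidiagonal] at h ⊢
    obtain ⟨h, rfl⟩ := h
    exact ⟨by rw [← h]; abel, trivial⟩
  · rintro ⟨⟨a, b⟩, ⟨c, d⟩⟩ h
    simp only [Finset.mem_sigma, mem_antidiagonal] at h ⊢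
    obtain ⟨h, rfl⟩ := h
    exact ⟨by rw [← h]; abel, trivial⟩
  · rintro ⟨⟨a, b⟩, ⟨c, d⟩⟩ h
    simp only [Finset.mem_sigma, mem_antidiagonal] at h
    obtain ⟨h, rfl⟩ := h
    rfl
  · rintro ⟨⟨a, b⟩, ⟨c, d⟩⟩ h
    simp only [Finset.mem_sigma, mem_antidiagonal] at h
    obtain ⟨h, rfl⟩ := h
    rfl
  · rintro ⟨⟨a, b⟩, ⟨c, d⟩⟩ h
    rfl

theorem sum_antidiagonal_swap {M N : Type*} [AddCommMonoid M] [Finset.HasAntidiagonal M]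
    [AddCommMonoid N] (F : M → M → N) (u : M) :
    ∑ x ∈ antidiagonal u, F x.1 x.2 = ∑ x ∈ antidiagonal u, F x.2 x.1 :=
  Finset.sum_bij' (fun x _ => x.swap) (fun x _ => x.swap)
    (fun _ hx => mem_antidiagonal.2 ((add_comm _ _).trans (mem_antidiagonal.1 hx)))
    (fun _ hx => mem_antidiagonal.2 ((add_comm _ _).trans (mem_antidiagonal.1 hx)))
    (fun _ _ => rfl) (fun _ _ => rfl) fun _ _ => rfl

theorem sum_antidiagonal_left_comm {M N : Type*} [AddCommMonoid M] [Finset.HasAntidiagonal M]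
    [AddCommMonoid N] (F : M → M → M → N) (u : M) :
    ∑ x ∈ antidiagonal u, ∑ y ∈ antidiagonal x.2, F x.1 y.1 y.2 =
      ∑ x ∈ antidiagonal u, ∑ y ∈ antidiagonal x.2, F y.1 x.1 y.2 := by
  rw [sum_antidiagonal_assoc, sum_antidiagonal_assoc fun a b c => F b a c]
  exact Finset.sum_congr rfl fun x _ => sum_antidiagonal_swap (fun a b => F a b x.2) x.1

theorem sum_range_product_eq_antidiagonal {N : Type*} [AddCommMonoid N] (F : ℕ → ℕ → N) (n : ℕ)
    (h : ∀ i j, n ≤ i + j → F i j = 0) :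
    ∑ i ∈ Finset.range n, ∑ j ∈ Finset.range n, F i j =
      ∑ m ∈ Finset.range n, ∑ x ∈ antidiagonal m, F x.1 x.2 := by
  rw [← Finset.sum_product', ← Finset.sum_filter_of_ne (p := fun x : ℕ × ℕ => x.1 + x.2 < n)
    fun x _ hx => not_le.1 fun hle => hx (h _ _ hle)]
  rw [← Finset.sum_fiberwise_of_maps_to (t := Finset.range n) (g := fun x : ℕ × ℕ => x.1 + x.2)
    fun x hx => Finset.mem_range.2 (Finset.mem_filter.1 hx).2]
  refine Finset.sum_congr rfl fun m hm => Finset.sum_congr ?_ fun _ _ => rfl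
  ext ⟨i, j⟩
  simp only [Finset.mem_filter, Finset.mem_product, Finset.mem_range, mem_antidiagonal] at hm ⊢
  omega

/-- The curvature of a formal solution of `dα_t/dt = -∂γ + [γ, α_t]` vanishes if it does so for
`t = 0`. -/
theorem curvature_flow_eq_zero {k E : Type*} [Field k] [CharZero k] [AddCommGroup E] [Module k E]
    (d : E →ₗ[k] E) (b : E →ₗ[k] E →ₗ[k] E) (γ : E) (α : ℕ → E)
    (hrel : ∀ n : ℕ, ((n : k) + 1) • α (n + 1) = (if n = 0 then -d γ else 0) + b γ (α n))
    (hdd : d (d γ) = 0) (hsymm : ∀ i j, b (α i) (α j) = b (α j) (α i))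
    (hsymm' : ∀ i j, b (b γ (α i)) (α j) = b (α j) (b γ (α i)))
    (hjac : ∀ i j, b γ (b (α i) (α j)) = b (b γ (α i)) (α j) + b (α i) (b γ (α j)))
    (hleib : ∀ i, d (b γ (α i)) = b (d γ) (α i) + b γ (d (α i)))
    (h0 : d (α 0) + (2 : k)⁻¹ • b (α 0) (α 0) = 0) (n : ℕ) :
    d (α n) + (2 : k)⁻¹ • ∑ x ∈ antidiagonal n, b (α x.1) (α x.2) = 0 := by
  induction n with
  | zero => simpa using h0
  | succ n ih =>
    -- For κ_t = dα_t + ½[α_t, α_t] the flow equation gives dκ_t/dt = [γ, κ_t]. In coefficients this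
    -- is (n + 1) κ_{n+1} = [γ, κ_n], so characteristic 0 finishes the induction.
    have hn : ((n : k) + 1) ≠ 0 := Nat.cast_add_one_ne_zero n
    have h1 : ((n : k) + 1) • d (α (n + 1)) = b (d γ) (α n) + b γ (d (α n)) := by
      rw [← map_smul, hrel, map_add, hleib]
      split_ifs
      · rw [map_neg, hdd, neg_zero, zero_add]
      · rw [map_zero, zero_add]
    have h2 : ∑ x ∈ antidiagonal (n + 1), (x.1 : k) • b (α x.1) (α x.2) =
        -b (d γ) (α n) + ∑ x ∈ antidiagonal n, b (b γ (α x.1)) (α x.2) := by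
      rw [Finset.Nat.sum_antidiagonal_succ]
      simp only [Nat.cast_zero, zero_smul, zero_add, Nat.cast_add, Nat.cast_one]
      have : ∀ x : ℕ × ℕ, ((x.1 : k) + 1) • b (α (x.1 + 1)) (α x.2) =
          (if x.1 = 0 then -b (d γ) (α x.2) else 0) + b (b γ (α x.1)) (α x.2) := by
        intro x
        rw [← LinearMap.smul_apply, ← map_smul, hrel, map_add, LinearMap.add_apply]
        split_ifs
        · rw [map_neg, LinearMap.neg_apply]
        · rw [map_zero, LinearMap.zero_apply]
      simp only [this]
      rw [Finset.sum_add_distrib, Finset.sum_eq_single (0, n)]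
      · simp
      · intro x hx hne
        rw [if_neg]
        intro h
        have := mem_antidiagonal.1 hx
        exact hne (Prod.ext h (by simpa [h] using this))
      · intro h
        exact absurd (mem_antidiagonal.2 (zero_add n)) h
    -- The two indices add up to n + 1, and by symmetry of the bracket each of them carries half of
    -- the weight.
    have h3 : ((n : k) + 1) • ∑ x ∈ antidiagonal (n + 1), b (α x.1) (α x.2) =
        (2 : k) • ∑ x ∈ antidiagonal (n + 1), (x.1 : k) • b (α x.1) (α x.2) := by
      have e : ((n : k) + 1) • ∑ x ∈ antidiagonal (n + 1), b (α x.1) (α x.2) =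
          ∑ x ∈ antidiagonal (n + 1), (x.1 : k) • b (α x.1) (α x.2) +
            ∑ x ∈ antidiagonal (n + 1), (x.2 : k) • b (α x.1) (α x.2) := by
        rw [Finset.smul_sum, ← Finset.sum_add_distrib]
        refine Finset.sum_congr rfl fun x hx => ?_
        rw [← add_smul]
        congr 1
        exact_mod_cast (mem_antidiagonal.1 hx).symm
      rw [e, sum_antidiagonal_swap (fun i j : ℕ => (j : k) • b (α i) (α j)), two_smul]
      exact congrArg₂ (· + ·) rfl (Finset.sum_congr rfl fun x _ => by rw [hsymm])
    have h4 : b γ ((2 : k)⁻¹ • ∑ x ∈ antidiagonal n, b (α x.1) (α x.2)) =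
        ∑ x ∈ antidiagonal n, b (b γ (α x.1)) (α x.2) := by
      rw [map_smul, map_sum]
      simp only [hjac]
      rw [Finset.sum_add_distrib, sum_antidiagonal_swap (fun i j => b (α i) (b γ (α j)))]
      simp only [← hsymm']
      rw [← two_smul k, inv_smul_smul₀ two_ne_zero]
    have h5 := congrArg (b γ) ih
    rw [map_add, h4, map_zero] at h5
    have h6 : ((n : k) + 1) • (d (α (n + 1)) +
        (2 : k)⁻¹ • ∑ x ∈ antidiagonal (n + 1), b (α x.1) (α x.2)) = 0 := by
      rw [smul_add, h1, smul_comm, h3, inv_smul_smul₀ two_ne_zero, h2, ← h5]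
      abel
    exact (smul_eq_zero.1 h6).resolve_left hn

namespace ToricDatum

variable {G : Type*} [AddCommGroup G] {𝔾 : GradingDatum G} {P : Type*} [Fintype P]

theorem σ_zero_sub (T : ToricDatum 𝔾 P) (u : P → ℤ) : 𝔾.σ (0 - T.f u) = 0 := by
  rw [map_sub, map_zero, T.f_even, sub_zero]

theorem σ_one_sub (T : ToricDatum 𝔾 P) (u : P → ℤ) : 𝔾.σ (𝔾.ι 1 - T.f u) = 1 := by
  rw [map_sub, 𝔾.σ_ι_one, T.f_even, sub_zero]

end ToricDatum

/-! ### Brackets of formal sums in a differential graded Lie algebra -/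

namespace DGLA

open ToricDatum

variable {k : Type*} [Field k] {G : Type*} [AddCommGroup G] [DecidableEq G] {𝔾 : GradingDatum G}
  {P : Type*} [Fintype P] {L : Type*} [AddCommGroup L] [Module k L] (𝔤 : DGLA k 𝔾 L)
  {T : ToricDatum 𝔾 P}

/-- The bracket on formal sums, as a bilinear map. -/
noncomputable def brL (T : ToricDatum 𝔾 P) :
    (T.monoid → L) →ₗ[k] (T.monoid → L) →ₗ[k] (T.monoid → L) :=
  LinearMap.mk₂ k (𝔤.brT T)
    (fun x y z => by funext u; simp [brT, Finset.sum_add_distrib])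
    (fun c x y => by funext u; simp [brT, Finset.smul_sum])
    (fun x y z => by funext u; simp [brT, Finset.sum_add_distrib])
    (fun c x y => by funext u; simp [brT, Finset.smul_sum])

theorem brT_apply (x y : T.monoid → L) (u : T.monoid) :
    𝔤.brT T x y u = ∑ v ∈ antidiagonal u, 𝔤.br (x v.1) (y v.2) := rfl

variable {𝔤}

/-- As f is even, the coefficients have odd degree, and the Koszul sign turns antisymmetry into
symmetry. -/
theorem br_comm_of_odd {x y : T.monoid → L} (hx : T.IsGraded 𝔤.gr (𝔾.ι 1) x)
    (hy : T.IsGraded 𝔤.gr (𝔾.ι 1) y) (u v : T.monoid) :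
    𝔤.br (x u) (y v) = 𝔤.br (y v) (x u) := by
  rw [𝔤.br_symm _ _ _ (hx.1 u) _ (hy.1 v), T.σ_one_sub, T.σ_one_sub, mul_one, koszul_one]
  simp

theorem brT_comm {x y : T.monoid → L} (hx : T.IsGraded 𝔤.gr (𝔾.ι 1) x)
    (hy : T.IsGraded 𝔤.gr (𝔾.ι 1) y) : 𝔤.brT T x y = 𝔤.brT T y x := by
  funext u
  rw [brT_apply, brT_apply, sum_antidiagonal_swap (fun a b => 𝔤.br (x a) (y b))]
  exact Finset.sum_congr rfl fun v _ => br_comm_of_odd hx hy _ _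

theorem brT_jacobi {γ x : T.monoid → L} {y : G} (hγ : T.IsGraded 𝔤.gr 0 γ)
    (hx : T.IsGraded 𝔤.gr y x) (z : T.monoid → L) :
    𝔤.brT T γ (𝔤.brT T x z) = 𝔤.brT T (𝔤.brT T γ x) z + 𝔤.brT T x (𝔤.brT T γ z) := by
  funext u
  have h : ∀ a b c : T.monoid, 𝔤.br (γ a) (𝔤.br (x b) (z c)) =
      𝔤.br (𝔤.br (γ a) (x b)) (z c) + 𝔤.br (x b) (𝔤.br (γ a) (z c)) := by
    intro a b c
    rw [𝔤.jacobi _ _ _ (hγ.1 a) _ (hx.1 b), T.σ_zero_sub, zero_mul, koszul_zero, one_smul]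
  simp only [Pi.add_apply, brT_apply, map_sum, LinearMap.sum_apply]
  simp only [h, Finset.sum_add_distrib]
  congr 1
  · exact sum_antidiagonal_assoc (fun a b c => 𝔤.br (𝔤.br (γ a) (x b)) (z c)) u
  · exact sum_antidiagonal_left_comm (fun a b c => 𝔤.br (x b) (𝔤.br (γ a) (z c))) u

theorem brT_leibniz {γ : T.monoid → L} (hγ : T.IsGraded 𝔤.gr 0 γ) (x : T.monoid → L)
    (u : T.monoid) : 𝔤.d (𝔤.brT T γ x u) =
      𝔤.brT T (fun v => 𝔤.d (γ v)) x u + 𝔤.brT T γ (fun v => 𝔤.d (x v)) u := by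
  rw [brT_apply, brT_apply, brT_apply, map_sum, ← Finset.sum_add_distrib]
  refine Finset.sum_congr rfl fun v _ => ?_
  rw [𝔤.leibniz _ _ (hγ.1 v.1), T.σ_zero_sub, koszul_zero, one_smul]

theorem brT_mem {x y : T.monoid → L} {a b : G} (hx : T.IsGraded 𝔤.gr a x)
    (hy : T.IsGraded 𝔤.gr b y) : T.IsGraded 𝔤.gr (a + b) (𝔤.brT T x y) := by
  refine ⟨fun u => Submodule.sum_mem _ fun v hv => ?_, ?_⟩
  · have h := 𝔤.br_mem _ _ _ (hx.1 v.1) _ (hy.1 v.2)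
    have e : a - T.f v.1 + (b - T.f v.2) = a + b - T.f u := by
      rw [← mem_antidiagonal.1 hv, AddSubmonoid.coe_add, map_add]
      abel
    rwa [e] at h
  · rw [brT_apply, antidiagonal_zero', Finset.sum_singleton, hx.2, map_zero, LinearMap.zero_apply]

/-- The bracket at `u` of formal sums without constant term depends only on proper divisors. -/
theorem brT_congr {x x' y y' : T.monoid → L} {u : T.monoid} (hx : x 0 = 0) (hx' : x' 0 = 0)
    (hy : y 0 = 0) (hy' : y' 0 = 0) (h : ∀ v, SDvd v u → x v = x' v ∧ y v = y' v) :
    𝔤.brT T x y u = 𝔤.brT T x' y' u := by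
  refine Finset.sum_congr rfl fun v hv => ?_
  have hv' := mem_antidiagonal.1 hv
  by_cases h1 : v.1 = 0
  · rw [h1, hx, hx', map_zero, LinearMap.zero_apply, LinearMap.zero_apply]
  by_cases h2 : v.2 = 0
  · rw [h2, hy, hy', map_zero, map_zero]
  rw [(h v.1 (SDvd.of_add hv' h2)).1, (h v.2 (SDvd.of_add' hv' h1)).2]

theorem brT_eq_zero_of_irr {x y : T.monoid → L} {u : T.monoid} (hx : x 0 = 0) (hy : y 0 = 0)
    (hu : u ∉ T.filt 2) : 𝔤.brT T x y u = 0 := by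
  refine Finset.sum_eq_zero fun v hv => ?_
  have hv' := mem_antidiagonal.1 hv
  by_cases h1 : v.1 = 0
  · rw [h1, hx, map_zero, LinearMap.zero_apply]
  · rw [eq_of_add_of_notMem hu h1 hv', hy, map_zero]

theorem exists_of_brT_ne_zero {x y : T.monoid → L} {u : T.monoid} (h : 𝔤.brT T x y u ≠ 0) :
    ∃ v w, v + w = u ∧ x v ≠ 0 ∧ y w ≠ 0 := by
  obtain ⟨v, hv, hne⟩ := Finset.exists_ne_zero_of_sum_ne_zero h
  refine ⟨v.1, v.2, mem_antidiagonal.1 hv, fun h => hne ?_, fun h => hne ?_⟩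
  · rw [h, map_zero, LinearMap.zero_apply]
  · rw [h, map_zero]

/-! ### The gauge action -/

theorem flowCoeff_succ (γ α : T.monoid → L) (n : ℕ) (u : T.monoid) :
    𝔤.flowCoeff T γ α (n + 1) u = ((n : k) + 1)⁻¹ •
      ((if n = 0 then -𝔤.d (γ u) else 0) + 𝔤.brT T γ (𝔤.flowCoeff T γ α n) u) := rfl

theorem flowCoeff_isGraded {γ α : T.monoid → L} (hγ : T.IsGraded 𝔤.gr 0 γ)
    (hα : T.IsGraded 𝔤.gr (𝔾.ι 1) α) (n : ℕ) :
    T.IsGraded 𝔤.gr (𝔾.ι 1) (𝔤.flowCoeff T γ α n) := by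
  induction n with
  | zero => exact hα
  | succ n ih =>
    have h := brT_mem hγ ih
    rw [zero_add] at h
    refine ⟨fun u => ?_, ?_⟩
    · rw [flowCoeff_succ]
      refine Submodule.smul_mem _ _ (add_mem ?_ (h.1 u))
      split_ifs
      · have h1 := 𝔤.d_mem _ _ (hγ.1 u)
        have e : 0 - T.f u + 𝔾.ι 1 = 𝔾.ι 1 - T.f u := by abel
        rw [e] at h1
        exact neg_mem h1
      · exact zero_mem _
    · rw [flowCoeff_succ, h.2, hγ.2]
      simp

theorem flowCoeff_supp {γ α : T.monoid → L} (S : AddSubmonoid T.monoid)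
    (hγ : ∀ u, γ u ≠ 0 → u ∈ S) (hα : ∀ u, α u ≠ 0 → u ∈ S) (n : ℕ) (u : T.monoid)
    (hu : 𝔤.flowCoeff T γ α n u ≠ 0) : u ∈ S := by
  induction n generalizing u with
  | zero => exact hα u hu
  | succ n ih =>
    by_contra hS
    refine hu ?_
    have h1 : γ u = 0 := not_not.1 (mt (hγ u) hS)
    have h2 : 𝔤.brT T γ (𝔤.flowCoeff T γ α n) u = 0 := by
      by_contra h
      obtain ⟨v, w, rfl, hv, hw⟩ := exists_of_brT_ne_zero h
      exact hS (add_mem (hγ v hv) (ih w hw))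
    rw [flowCoeff_succ, h1, h2]
    simp

/-- Each bracket with γ raises the order by one, as γ has no constant term. The first step is
separate because -dγ has order 1 by itself. -/
theorem flowCoeff_filt {γ α : T.monoid → L} (hγ : T.IsGraded 𝔤.gr 0 γ)
    (hα : T.IsGraded 𝔤.gr (𝔾.ι 1) α) (n : ℕ) (u : T.monoid)
    (hu : 𝔤.flowCoeff T γ α n u ≠ 0) : u ∈ T.filt n := by
  induction n generalizing u with
  | zero => exact Set.mem_univ _
  | succ n ih =>
    by_cases hn : n = 0
    · subst hn
      refine mem_filt_one.2 ?_
      rintro rfl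
      exact hu (flowCoeff_isGraded hγ hα 1).2
    · rw [flowCoeff_succ, if_neg hn, zero_add] at hu
      obtain ⟨v, w, rfl, hv, hw⟩ := exists_of_brT_ne_zero (right_ne_zero_of_smul hu)
      rw [add_comm v w]
      refine add_mem_filt (ih w hw) (mem_filt_one.2 ?_)
      rintro rfl
      exact hv hγ.2

theorem gauge_eq_sum {γ α : T.monoid → L} (hγ : T.IsGraded 𝔤.gr 0 γ)
    (hα : T.IsGraded 𝔤.gr (𝔾.ι 1) α) {n : ℕ} {u : T.monoid} (hu : u ∉ T.filt n) :
    𝔤.gauge T γ α u = ∑ i ∈ Finset.range n, 𝔤.flowCoeff T γ α i u := by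
  refine finsum_eq_sum_of_support_subset _ fun i hi => ?_
  rw [Finset.coe_range, Set.mem_Iio]
  by_contra h
  exact hu (filt_anti (not_lt.1 h) (flowCoeff_filt hγ hα i u hi))

theorem gauge_isGraded {γ α : T.monoid → L} (hγ : T.IsGraded 𝔤.gr 0 γ)
    (hα : T.IsGraded 𝔤.gr (𝔾.ι 1) α) : T.IsGraded 𝔤.gr (𝔾.ι 1) (𝔤.gauge T γ α) := by
  refine ⟨fun u => ?_, ?_⟩
  · obtain ⟨n, hn⟩ := exists_notMem_filt u
    rw [gauge_eq_sum hγ hα hn]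
    exact Submodule.sum_mem _ fun i _ => (flowCoeff_isGraded hγ hα i).1 u
  · obtain ⟨n, hn⟩ := exists_notMem_filt (0 : T.monoid)
    rw [gauge_eq_sum hγ hα hn]
    exact Finset.sum_eq_zero fun i _ => (flowCoeff_isGraded hγ hα i).2

theorem flow_curvature [CharZero k] {γ α : T.monoid → L} (hγ : T.IsGraded 𝔤.gr 0 γ)
    (hα : T.IsGraded 𝔤.gr (𝔾.ι 1) α) (hmc : ∀ u, 𝔤.d (α u) + (2 : k)⁻¹ • 𝔤.brT T α α u = 0)
    (n : ℕ) (u : T.monoid) : 𝔤.d (𝔤.flowCoeff T γ α n u) + (2 : k)⁻¹ • ∑ x ∈ antidiagonal n,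
      𝔤.brT T (𝔤.flowCoeff T γ α x.1) (𝔤.flowCoeff T γ α x.2) u = 0 := by
  have hg := fun i => flowCoeff_isGraded hγ hα i
  have h := curvature_flow_eq_zero (𝔤.d.compLeft T.monoid) (𝔤.brL T) γ (𝔤.flowCoeff T γ α)
    (fun n => by
      funext u
      rw [Pi.smul_apply, flowCoeff_succ, smul_inv_smul₀ (Nat.cast_add_one_ne_zero n)]
      split_ifs <;> rfl)
    (funext fun u => 𝔤.d_d (γ u)) (fun i j => brT_comm (hg i) (hg j))
    (fun i j => brT_comm (by
      have h := brT_mem hγ (hg i)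
      rwa [zero_add] at h) (hg j))
    (fun i j => brT_jacobi hγ (hg i) _) (fun i => funext fun u => brT_leibniz hγ _ u)
    (funext fun u => hmc u) n
  have h1 := congrFun h u
  simp only [Pi.add_apply, Pi.smul_apply, Finset.sum_apply] at h1
  exact h1

/-- At an exponent outside `T.filt n` only flow coefficients of index below n matter, and products
of total index at least n vanish. The curvature at time 1 is therefore a finite sum of coefficients
of the curvature of the flow, each of which is zero. -/
theorem gauge_mc [CharZero k] {γ α : T.monoid → L} (hγ : T.IsGraded 𝔤.gr 0 γ)
    (hα : T.IsGraded 𝔤.gr (𝔾.ι 1) α) (hmc : ∀ u, 𝔤.d (α u) + (2 : k)⁻¹ • 𝔤.brT T α α u = 0)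
    (u : T.monoid) : 𝔤.d (𝔤.gauge T γ α u) +
      (2 : k)⁻¹ • 𝔤.brT T (𝔤.gauge T γ α) (𝔤.gauge T γ α) u = 0 := by
  obtain ⟨n, hn⟩ := exists_notMem_filt u
  have h1 : 𝔤.brT T (𝔤.gauge T γ α) (𝔤.gauge T γ α) u = ∑ m ∈ Finset.range n,
      ∑ x ∈ antidiagonal m, 𝔤.brT T (𝔤.flowCoeff T γ α x.1) (𝔤.flowCoeff T γ α x.2) u := by
    rw [← sum_range_product_eq_antidiagonal
      (fun i j => 𝔤.brT T (𝔤.flowCoeff T γ α i) (𝔤.flowCoeff T γ α j) u)]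
    · simp only [brT_apply]
      rw [Finset.sum_congr rfl fun i _ => Finset.sum_comm, Finset.sum_comm]
      refine Finset.sum_congr rfl fun v hv => ?_
      have hv' := mem_antidiagonal.1 hv
      rw [gauge_eq_sum hγ hα (fun h => hn (hv' ▸ T.filt_add n h v.2)),
        gauge_eq_sum hγ hα (fun h => hn (hv' ▸ add_comm v.2 v.1 ▸ T.filt_add n h v.1))]
      simp only [map_sum, LinearMap.sum_apply]
      exact Finset.sum_comm
    · intro i j hij
      by_contra h
      obtain ⟨v, w, rfl, hv, hw⟩ := exists_of_brT_ne_zero h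
      exact hn (filt_anti hij (add_mem_filt (flowCoeff_filt hγ hα i v hv)
        (flowCoeff_filt hγ hα j w hw)))
  rw [h1, gauge_eq_sum hγ hα hn, map_sum, Finset.smul_sum, ← Finset.sum_add_distrib]
  exact Finset.sum_eq_zero fun m _ => flow_curvature hγ hα hmc m u

/-- The value γ_u enters at u only through the summand -dγ_u of the first flow coefficient; in a
bracket it would be paired with a vanishing constant term. The correction at n = 1 removes it. -/
theorem flowCoeff_congr {γ γ' α : T.monoid → L} (hγ : T.IsGraded 𝔤.gr 0 γ)
    (hγ' : T.IsGraded 𝔤.gr 0 γ') (hα : T.IsGraded 𝔤.gr (𝔾.ι 1) α) (n : ℕ) (u : T.monoid)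
    (h : ∀ v, SDvd v u → γ v = γ' v) :
    𝔤.flowCoeff T γ α n u + (if n = 1 then 𝔤.d (γ u) else 0) =
      𝔤.flowCoeff T γ' α n u + (if n = 1 then 𝔤.d (γ' u) else 0) := by
  induction n generalizing u with
  | zero => rfl
  | succ n ih =>
    have h1 : 𝔤.brT T γ (𝔤.flowCoeff T γ α n) u = 𝔤.brT T γ' (𝔤.flowCoeff T γ' α n) u := by
      refine brT_congr hγ.2 hγ'.2 (flowCoeff_isGraded hγ hα n).2 (flowCoeff_isGraded hγ' hα n).2
        fun v hv => ⟨h v hv, ?_⟩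
      have h2 := ih v fun v' hv' => h v' (hv'.trans hv)
      rw [h v hv] at h2
      exact add_right_cancel h2
    rw [flowCoeff_succ, flowCoeff_succ, h1]
    by_cases hn : n = 0
    · subst hn
      simp
    · simp [hn]

theorem gauge_congr {γ γ' α : T.monoid → L} (hγ : T.IsGraded 𝔤.gr 0 γ)
    (hγ' : T.IsGraded 𝔤.gr 0 γ') (hα : T.IsGraded 𝔤.gr (𝔾.ι 1) α) (u : T.monoid)
    (h : ∀ v, SDvd v u → γ v = γ' v) :
    𝔤.gauge T γ α u + 𝔤.d (γ u) = 𝔤.gauge T γ' α u + 𝔤.d (γ' u) := by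
  obtain ⟨n, hn⟩ := exists_notMem_filt u
  -- With n + 2 terms the index 1 of the correction is certainly in the range.
  have hn2 : u ∉ T.filt (n + 2) := fun h => hn (filt_anti (by omega) h)
  have h1 : ∀ γ : T.monoid → L, T.IsGraded 𝔤.gr 0 γ → 𝔤.gauge T γ α u + 𝔤.d (γ u) =
      ∑ i ∈ Finset.range (n + 2), (𝔤.flowCoeff T γ α i u + if i = 1 then 𝔤.d (γ u) else 0) := by
    intro γ hγ
    rw [gauge_eq_sum hγ hα hn2, Finset.sum_add_distrib, Finset.sum_ite_eq', if_pos]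
    exact Finset.mem_range.2 (by omega)
  rw [h1 γ hγ, h1 γ' hγ']
  exact Finset.sum_congr rfl fun i _ => flowCoeff_congr hγ hγ' hα i u h

theorem gauge_irr {γ α : T.monoid → L} (hγ : T.IsGraded 𝔤.gr 0 γ)
    (hα : T.IsGraded 𝔤.gr (𝔾.ι 1) α) {u : T.monoid} (hu : u ∉ T.filt 2) :
    𝔤.gauge T γ α u = α u - 𝔤.d (γ u) := by
  rw [gauge_eq_sum hγ hα hu, Finset.sum_range_succ, Finset.sum_range_one, flowCoeff_succ,
    brT_eq_zero_of_irr hγ.2 (flowCoeff_isGraded hγ hα 0).2 hu]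
  simp only [flowCoeff]
  simp [sub_eq_add_neg]

theorem gauge_supp {γ α : T.monoid → L} (S : AddSubmonoid T.monoid)
    (hγ : ∀ u, γ u ≠ 0 → u ∈ S) (hα : ∀ u, α u ≠ 0 → u ∈ S) {u : T.monoid}
    (hu : 𝔤.gauge T γ α u ≠ 0) : u ∈ S := by
  by_contra hS
  refine hu (finsum_eq_zero_of_forall_eq_zero fun n => ?_)
  exact not_not.1 (mt (flowCoeff_supp S hγ hα n u) hS)

variable (𝔤) in
/-- Gauge equivalence of Maurer–Cartan elements as an abstract deformation theory. -/
noncomputable def deformationTheory [CharZero k] (T : ToricDatum 𝔾 P) :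
    DeformationTheory k T L where
  gr := 𝔤.gr
  d := fun _ => 𝔤.d
  IsMC := fun α => ∀ u, 𝔤.d (α u) + (2 : k)⁻¹ • 𝔤.brT T α α u = 0
  -- The summand -d x_u cancels the linear term, so that the equation reads a = e^x·β.
  W := fun β x _ u => -𝔤.gauge T x β u - 𝔤.d (x u)
  isMC_twist := fun θ a _ h u => by
    have h1 : 𝔤.brT T (twist θ a) (twist θ a) u = twist θ (𝔤.brT T a a) u :=
      twist_conv θ a a (fun x y => 𝔤.br x y) (fun u v => by
        simp only [twist, map_sum, LinearMap.sum_apply, map_smul, LinearMap.smul_apply,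
          Finset.smul_sum, smul_smul]
        rw [Finset.sum_comm]
        exact Finset.sum_congr rfl fun i _ => Finset.sum_congr rfl fun j _ => by rw [mul_comm]) u
    rw [h1, twist, twist, map_sum, Finset.smul_sum, ← Finset.sum_add_distrib]
    refine Finset.sum_eq_zero fun y _ => ?_
    rw [map_smul, smul_comm, ← smul_add, h, smul_zero]
  W_congr := fun β x x' a a' u hβ hx hx' _ _ h => by
    have h1 := gauge_congr hx hx' hβ u fun v hv => (h v hv).1
    rw [← neg_add', ← neg_add', h1]
  W_mem := fun β x a u hβ hx _ => by
    have h1 := 𝔤.d_mem _ _ (hx.1 u)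
    have e : 0 - T.f u + 𝔾.ι 1 = 𝔾.ι 1 - T.f u := by abel
    rw [e] at h1
    exact sub_mem (neg_mem ((gauge_isGraded hx hβ).1 u)) h1
  W_cocycle := fun β x a u hβ hβm hx ha ham h => by
    have hg := gauge_isGraded hx hβ
    have h1 : ∀ v, 𝔤.d (x v) + a v + (-𝔤.gauge T x β v - 𝔤.d (x v)) =
        a v - 𝔤.gauge T x β v := fun v => by abel
    simp only [h1] at h ⊢
    -- Both a and e^x·β are Maurer–Cartan and they agree below u. Their brackets at u coincide, so
    -- subtracting the two curvature equations shows that their difference at u is closed.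
    have h2 : 𝔤.brT T a a u = 𝔤.brT T (𝔤.gauge T x β) (𝔤.gauge T x β) u :=
      brT_congr ha.2 hg.2 ha.2 hg.2 fun v hv => ⟨sub_eq_zero.1 (h v hv), sub_eq_zero.1 (h v hv)⟩
    have h3 := (ham u).trans (gauge_mc hx hβ hβm u).symm
    rw [h2] at h3
    rw [map_sub, add_right_cancel h3, sub_self]
  d_irr := fun a u ha ham hu => by
    have h := ham u
    rwa [brT_eq_zero_of_irr ha.2 ha.2 hu, smul_zero, add_zero] at h
  W_irr := fun β x a u hβ hx _ hu => by
    rw [gauge_irr hx hβ hu]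
    abel
  W_supp := fun β x a S _ _ _ hβ hx _ u hu => by
    by_contra hS
    refine hu ?_
    rw [not_not.1 (mt (gauge_supp S hx hβ) hS), not_not.1 (mt (hx u) hS)]
    simp

variable [DecidableEq P]

theorem memTensorM_isGraded {gr : G → Submodule k L} {y : G} {x : T.monoid → L}
    (h : T.MemTensorM gr y x) : T.IsGraded gr y x := ⟨h.1.1, h.2⟩

theorem versality [CharZero k] (hR : T.IsNice k) {α : T.monoid → L} (hα : α ∈ 𝔤.MC T)
    (hs : 𝔤.FirstOrderSpans hR α) :
    (∀ β ∈ 𝔤.MC' hR, ∃ ψ ∈ T.aut k, ∃ c : P → (T.ring k)ˣ,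
      IsRescaling ψ c ∧ 𝔤.GaugeEquiv T β (push ψ α)) ∧
    𝔤.RComplete hR α ∧
    ((∀ p, 𝔤.FirstOrderNeZero hR α p) → 𝔤.RVersal hR α) := by
  have h1 : ∀ β ∈ 𝔤.MC' hR, ∃ ψ ∈ T.aut k, ∃ c : P → (T.ring k)ˣ,
      IsRescaling ψ c ∧ 𝔤.GaugeEquiv T β (push ψ α) := by
    intro β hβ
    obtain ⟨ψ, hψ, c, hc, x, hx, h⟩ := (𝔤.deformationTheory T).exists_solution hR
      (memTensorM_isGraded hα.1) hα.2 hα.1.1.2 (memTensorM_isGraded hβ.1.1) hβ.1.2 hβ.1.1.1.2 hs hβ.2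
    refine ⟨ψ, hψ, c, hc, x, hx, funext fun u => ?_⟩
    have h2 : 𝔤.d (x u) + push ψ α u + (-𝔤.gauge T x β u - 𝔤.d (x u)) = 0 := h u
    rw [← sub_eq_zero, ← h2]
    abel
  have h2 : 𝔤.RComplete hR α := fun β hβ => by
    obtain ⟨ψ, hψ, c, -, h⟩ := h1 β hβ
    exact ⟨ψ, hψ, h⟩
  refine ⟨h1, h2, fun hne => ⟨h2, ?_⟩⟩
  rintro β hβ ψ hψ ψ' hψ' ⟨γ, hγ, h⟩ ⟨γ', hγ', h'⟩ y hy
  have key : ∀ {ψ : T.ring k ≃ₐ[k] T.ring k} {γ : T.monoid → L},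
      push ψ α = 𝔤.gauge T γ β → ∀ u : T.monoid,
      𝔤.d (γ u) + push ψ α u + (-𝔤.gauge T γ β u - 𝔤.d (γ u)) = 0 := by
    intro ψ γ h u
    rw [h]
    abel
  exact (𝔤.deformationTheory T).sub_mem_of_solutions hR (memTensorM_isGraded hα.1)
    (memTensorM_isGraded hβ.1.1) hne hψ hψ' (memTensorM_isGraded hγ) (memTensorM_isGraded hγ')
    (key h) (key h') hy

end DGLA

/-! ### Chains and their subdivisions -/

namespace MorChain

variable {Ob : Type*} {H : Ob → Ob → Type*}

/-- The number of entries of a chain. -/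
def length {X Y : Ob} : MorChain H X Y → ℕ
  | nil _ => 0
  | cons _ c => length c + 1

theorem nil_append {X Y : Ob} (c : MorChain H X Y) : (nil X).append c = c := rfl

theorem cons_append {X Y Z W : Ob} (a : H X Y) (c : MorChain H Y Z) (d : MorChain H Z W) :
    (cons a c).append d = cons a (c.append d) := rfl

theorem append_nil {X Y : Ob} (c : MorChain H X Y) : c.append (nil Y) = c := by
  induction c with
  | nil X => rfl
  | cons a c ih => rw [cons_append, ih]

theorem append_assoc {X Y Z W : Ob} (c : MorChain H X Y) (d : MorChain H Y Z)
    (e : MorChain H Z W) : (c.append d).append e = c.append (d.append e) := by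
  induction c with
  | nil X => rfl
  | cons a c ih => rw [cons_append, cons_append, ih, cons_append]

theorem length_append {X Y Z : Ob} (c : MorChain H X Y) (d : MorChain H Y Z) :
    (c.append d).length = c.length + d.length := by
  induction c with
  | nil X => simp [nil_append, length]
  | cons a c ih =>
    rw [cons_append, length, length, ih]
    omega

theorem length_cons {X Y Z : Ob} (a : H X Y) (c : MorChain H Y Z) :
    (cons a c).length = c.length + 1 := rfl

theorem mem_splits {X Z : Ob} {c : MorChain H X Z}
    {s : Σ Y, MorChain H X Y × MorChain H Y Z} : s ∈ c.splits ↔ s.2.1.append s.2.2 = c := by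
  constructor
  · intro h
    induction c with
    | nil X =>
      rw [splits, List.mem_singleton] at h
      rw [h]
      rfl
    | cons a c ih =>
      rw [splits, List.mem_cons, List.mem_map] at h
      rcases h with rfl | ⟨t, ht, rfl⟩
      · rfl
      · rw [cons_append, ih ht]
  · rintro h
    obtain ⟨Y, d, e⟩ := s
    dsimp only at h
    subst h
    induction d with
    | nil X =>
      cases e with
      | nil => exact List.mem_singleton_self _
      | cons a e => exact List.mem_cons_self
    | cons a d ih => exact List.mem_cons_of_mem _ (List.mem_map.2 ⟨⟨_, d, e⟩, ih e, rfl⟩)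

theorem nodup_splits {X Z : Ob} (c : MorChain H X Z) : c.splits.Nodup := by
  induction c with
  | nil X => exact List.nodup_singleton _
  | cons a c ih =>
    refine List.nodup_cons.2 ⟨?_, ih.map ?_⟩
    · intro h
      obtain ⟨⟨Y, d, e⟩, -, h⟩ := List.mem_map.1 h
      have h2 := congrArg (fun s : Σ Y, MorChain H _ Y × MorChain H Y _ => s.2.1.length) h
      exact absurd h2 (Nat.succ_ne_zero _)
    · rintro ⟨Y, d, e⟩ ⟨Y', d', e'⟩ h
      simp only [Sigma.mk.injEq] at h
      obtain ⟨rfl, h⟩ := h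
      simp only [heq_eq_eq, Prod.mk.injEq, cons.injEq, true_and] at h
      rw [h.1, h.2]

variable {V : Type*} [AddCommMonoid V]

/-- The sum of a function over all ways to cut a chain into two consecutive parts. -/
def sumSplits {X Y : Ob} (c : MorChain H X Y)
    (g : ∀ Z, MorChain H X Z → MorChain H Z Y → V) : V :=
  (c.splits.map fun s => g s.1 s.2.1 s.2.2).sum

theorem sumSplits_nil {X : Ob} (g : ∀ Z, MorChain H X Z → MorChain H Z X → V) :
    (nil X).sumSplits g = g X (nil X) (nil X) := by
  simp [sumSplits, splits]

theorem sumSplits_cons {X Y Z : Ob} (a : H X Y) (c : MorChain H Y Z)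
    (g : ∀ W, MorChain H X W → MorChain H W Z → V) :
    (cons a c).sumSplits g =
      g X (nil X) (cons a c) + c.sumSplits fun W s t => g W (cons a s) t := by
  simp only [sumSplits, splits, List.map_cons, List.sum_cons, List.map_map]
  rfl

theorem sumSplits_add {X Y : Ob} (c : MorChain H X Y)
    (g h : ∀ Z, MorChain H X Z → MorChain H Z Y → V) :
    (c.sumSplits fun Z s t => g Z s t + h Z s t) = c.sumSplits g + c.sumSplits h := by
  simp only [sumSplits, List.sum_map_add]

theorem sumSplits_zero {X Y : Ob} (c : MorChain H X Y) :
    (c.sumSplits fun _ _ _ => (0 : V)) = 0 := by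
  simp [sumSplits]

theorem sumSplits_map {W : Type*} [AddCommMonoid W] (f : V →+ W) {X Y : Ob} (c : MorChain H X Y)
    (g : ∀ Z, MorChain H X Z → MorChain H Z Y → V) :
    (c.sumSplits fun Z s t => f (g Z s t)) = f (c.sumSplits g) := by
  simp only [sumSplits, map_list_sum, List.map_map]
  rfl

theorem sumSplits_finsetSum {ι : Type*} (s : Finset ι) {X Y : Ob} (c : MorChain H X Y)
    (g : ι → ∀ Z, MorChain H X Z → MorChain H Z Y → V) :
    (c.sumSplits fun Z a b => ∑ i ∈ s, g i Z a b) = ∑ i ∈ s, c.sumSplits (g i) := by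
  classical
  induction s using Finset.induction_on with
  | empty => simp [sumSplits_zero]
  | insert i s hi ih => simp only [Finset.sum_insert hi, sumSplits_add, ih]

theorem sumSplits_congr {X Y : Ob} {c : MorChain H X Y}
    {g h : ∀ Z, MorChain H X Z → MorChain H Z Y → V}
    (hgh : ∀ Z s t, s.append t = c → g Z s t = h Z s t) : c.sumSplits g = c.sumSplits h :=
  congrArg List.sum (List.map_congr_left fun _ hs => hgh _ _ _ (mem_splits.1 hs))

theorem sumSplits_eq_zero {X Y : Ob} {c : MorChain H X Y}
    {g : ∀ Z, MorChain H X Z → MorChain H Z Y → V}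
    (hg : ∀ Z s t, s.append t = c → g Z s t = 0) : c.sumSplits g = 0 :=
  (sumSplits_congr hg).trans (sumSplits_zero c)

/-- Coassociativity of the deconcatenation coproduct. -/
theorem sumSplits_assoc {X Y : Ob} (c : MorChain H X Y)
    (g : ∀ Z W, MorChain H X Z → MorChain H Z W → MorChain H W Y → V) :
    (c.sumSplits fun W s t => s.sumSplits fun Z d e => g Z W d e t) =
      c.sumSplits fun Z s t => t.sumSplits fun W d e => g Z W s d e := by
  induction c with
  | nil X => simp only [sumSplits_nil]
  | cons a c ih =>
    simp only [sumSplits_cons, sumSplits_nil, sumSplits_add]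
    rw [ih fun Z W s d e => g Z W (cons a s) d e, add_assoc]

theorem sumSplits_append_cons {X Y Z W : Ob} (c : MorChain H X Y) (a : H Y Z) (d : MorChain H Z W)
    (g : ∀ U, MorChain H X U → MorChain H U W → V) :
    (c.append (cons a d)).sumSplits g =
      (c.sumSplits fun U s t => g U s (t.append (cons a d))) +
        d.sumSplits fun U s t => g U (c.append (cons a s)) t := by
  induction c with
  | nil X => simp only [nil_append, sumSplits_cons, sumSplits_nil]
  | cons b c ih => simp only [cons_append, sumSplits_cons, ih, add_assoc]

theorem sumSplits_mem {R : Type*} [Semiring R] [Module R V] (S : Submodule R V) {X Y : Ob}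
    {c : MorChain H X Y} {g : ∀ Z, MorChain H X Z → MorChain H Z Y → V}
    (hg : ∀ Z s t, s.append t = c → g Z s t ∈ S) : c.sumSplits g ∈ S := by
  refine list_sum_mem fun v hv => ?_
  obtain ⟨s, hs, rfl⟩ := List.mem_map.1 hv
  exact hg _ _ _ (mem_splits.1 hs)

end MorChain

/-! ### Inserting a cochain into a chain -/

namespace PreCat

open MorChain

variable {k : Type*} [Field k] {G : Type*} [AddCommGroup G] [DecidableEq G] {𝔾 : GradingDatum G}
  {Ob : Type*} {H : Ob → Ob → Type*} [∀ X Y, AddCommGroup (H X Y)] [∀ X Y, Module k (H X Y)]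
  (C : PreCat k 𝔾 H) {V : Type*} [AddCommGroup V] [Module k V]

/-- The effect of the sign operator on an entry. -/
noncomputable def sgn (ε : ZMod 2) (X Y : Ob) : H X Y →ₗ[k] H X Y :=
  if ε = 0 then LinearMap.id else C.shiftSign X Y

theorem sgn_zero {X Y : Ob} (a : H X Y) : C.sgn 0 X Y a = a := by simp [sgn]

theorem sgn_one (X Y : Ob) : C.sgn 1 X Y = C.shiftSign X Y := by simp [sgn]

theorem sign_nil (ε : ZMod 2) (X : Ob) : C.sign ε (nil X : MorChain H X X) = nil X := by
  simp [sign, MorChain.map]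

theorem sign_cons (ε : ZMod 2) {X Y Z : Ob} (a : H X Y) (c : MorChain H Y Z) :
    C.sign ε (cons a c) = cons (C.sgn ε X Y a) (C.sign ε c) := by
  by_cases h : ε = 0 <;> simp [sign, sgn, h, MorChain.map]

theorem sign_append (ε : ZMod 2) {X Y Z : Ob} (c : MorChain H X Y) (d : MorChain H Y Z) :
    C.sign ε (c.append d) = (C.sign ε c).append (C.sign ε d) := by
  induction c with
  | nil X => rw [sign_nil, nil_append, nil_append]
  | cons a c ih => rw [cons_append, sign_cons, sign_cons, cons_append, ih]

/-- The sum of the values of `φ` on the chains obtained by applying `χ`, of parity `ε`, to a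
consecutive part. -/
noncomputable def ins (ε : ZMod 2) (χ : Cochain H) {X Y : Ob} (φ : MorChain H X Y → V)
    (c : MorChain H X Y) : V :=
  c.sumSplits fun _ s t => t.sumSplits fun _ d e =>
    φ ((C.sign ε s).append (cons (χ _ _ d) e))

theorem circ_apply (ε : ZMod 2) (φ χ : Cochain H) (X Y : Ob) (c : MorChain H X Y) :
    C.circ ε φ χ X Y c = C.ins ε χ (φ X Y) c := rfl

theorem ins_nil (ε : ZMod 2) (χ : Cochain H) {X : Ob} (φ : MorChain H X X → V) :
    C.ins ε χ φ (nil X) = φ (cons (χ X X (nil X)) (nil X)) := by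
  simp only [ins, sumSplits_nil, sign_nil, nil_append]

/-- Either the inserted cochain acts on an initial segment, possibly empty, or it acts to the right
of a, which then acquires the sign. -/
theorem ins_cons (ε : ZMod 2) (χ : Cochain H) {X Y Z : Ob} (φ : MorChain H X Z → V)
    (a : H X Y) (c : MorChain H Y Z) :
    C.ins ε χ φ (cons a c) = ((cons a c).sumSplits fun _ d e => φ (cons (χ _ _ d) e)) +
      C.ins ε χ (fun c => φ (cons (C.sgn ε X Y a) c)) c := by
  rw [ins, sumSplits_cons]
  simp only [sign_nil, nil_append, sign_cons, cons_append]
  rfl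

theorem ins_add (ε : ZMod 2) (χ : Cochain H) {X Y : Ob} (φ φ' : MorChain H X Y → V)
    (c : MorChain H X Y) :
    C.ins ε χ (fun c => φ c + φ' c) c = C.ins ε χ φ c + C.ins ε χ φ' c := by
  simp only [ins, sumSplits_add]

theorem ins_zero (ε : ZMod 2) (χ : Cochain H) {X Y : Ob} (c : MorChain H X Y) :
    C.ins ε χ (fun _ => (0 : V)) c = 0 := by
  simp only [ins, sumSplits_zero]

theorem ins_finsetSum {ι : Type*} (s : Finset ι) (ε : ZMod 2) (χ : Cochain H) {X Y : Ob}
    (φ : ι → MorChain H X Y → V) (c : MorChain H X Y) :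
    C.ins ε χ (fun c => ∑ i ∈ s, φ i c) c = ∑ i ∈ s, C.ins ε χ (φ i) c := by
  simp only [ins, sumSplits_finsetSum]

theorem ins_map {W : Type*} [AddCommGroup W] (f : V →+ W) (ε : ZMod 2) (χ : Cochain H) {X Y : Ob}
    (φ : MorChain H X Y → V) (c : MorChain H X Y) :
    C.ins ε χ (fun c => f (φ c)) c = f (C.ins ε χ φ c) := by
  simp only [ins, sumSplits_map]

/-- Inserting is a coderivation. -/
theorem ins_sumSplits (ε : ZMod 2) (χ : Cochain H) {X Y : Ob}
    (θ : ∀ Z, MorChain H X Z → MorChain H Z Y → V) (c : MorChain H X Y) :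
    C.ins ε χ (fun c => c.sumSplits θ) c = c.sumSplits fun Z s t =>
      C.ins ε χ (fun s => θ Z s t) s + C.ins ε χ (fun t => θ Z (C.sign ε s) t) t := by
  induction c with
  | nil X => simp only [ins_nil, sumSplits_cons, sumSplits_nil, sign_nil, add_comm]
  | cons a c ih =>
    rw [ins_cons]
    simp only [sumSplits_cons, ins_add, ih, ins_nil, ins_cons, sign_nil, sign_cons, sumSplits_add]
    rw [← sumSplits_assoc c fun Z W d e t => θ W (cons (χ _ _ (cons a d)) e) t]
    abel

end PreCat

/-! ### Admissible subdivisions and pullback of multilinear maps along a formal functor -/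

namespace ToricDatum

variable {G : Type*} [AddCommGroup G] {𝔾 : GradingDatum G} {P : Type*} [Fintype P]
  {T : ToricDatum 𝔾 P}

/-- Parts of non-zero weight may be empty, so removing a part need not shorten the chain; but then
it lowers the weight. Hence the induction is on the weight first and on the length second. -/
theorem sdvd_lex_induction {p : T.monoid → ℕ → Prop}
    (h : ∀ u n, (∀ v m, SDvd v u ∨ (v = u ∧ m < n) → p v m) → p u n) (u : T.monoid) (n : ℕ) :
    p u n := by
  induction u using sdvd_wf.induction generalizing n with
  | _ u ih =>
    induction n using Nat.strong_induction_on with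
    | _ n ih' =>
      refine h u n fun v m hvm => ?_
      rcases hvm with hv | ⟨rfl, hm⟩
      · exact ih v hv m
      · exact ih' m hm

theorem lex_lt_of_split {Ob : Type*} {H : Ob → Ob → Type*} {u : T.monoid}
    {x : T.monoid × T.monoid} (hx : x ∈ antidiagonal u) {X Y Z : Ob} {s : MorChain H X Z}
    {t : MorChain H Z Y} {c : MorChain H X Y} (hst : s.append t = c)
    (h : x.1 = 0 → s.length ≠ 0) : SDvd x.2 u ∨ (x.2 = u ∧ t.length < c.length) := by
  have hx' := mem_antidiagonal.1 hx
  by_cases h1 : x.1 = 0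
  · refine Or.inr ⟨by rwa [h1, zero_add] at hx', ?_⟩
    rw [← hst, MorChain.length_append]
    have := h h1
    omega
  · exact Or.inl (SDvd.of_add' hx' h1)

end ToricDatum

namespace Pieces

variable {M : Type*} {Ob : Type*} {H : Ob → Ob → Type*}

/-- All parts of weight `0` have exactly one entry. -/
def Adm [Zero M] {X Y : Ob} : Pieces M H X Y → Prop
  | nil _ => True
  | cons w c r => (w = 0 → c.length = 1) ∧ Adm r

/-- The number of parts. -/
def count {X Y : Ob} : Pieces M H X Y → ℕ
  | nil _ => 0
  | cons _ _ r => count r + 1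

variable {G : Type*} [AddCommGroup G] {𝔾 : GradingDatum G} {P : Type*} [Fintype P]
  {T : ToricDatum 𝔾 P}

/-- Removing the first part makes the pair (weight, length) smaller, and there are finitely many
choices for that part. Without admissibility empty parts of weight 0 could be repeated indefinitely.
-/
theorem finite_adm (u : T.monoid) {X Y : Ob} (c : MorChain H X Y) :
    {p : Pieces T.monoid H X Y | p.Adm ∧ p.chain = c ∧ p.weight = u}.Finite := by
  suffices h : ∀ (u : T.monoid) (n : ℕ) (X : Ob) (c : MorChain H X Y), c.length = n →
      {p : Pieces T.monoid H X Y | p.Adm ∧ p.chain = c ∧ p.weight = u}.Finite from h u _ X c rfl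
  intro u n
  induction u, n using ToricDatum.sdvd_lex_induction with
  | _ u n ih =>
    rintro X c rfl
    have h0 : {p : Pieces T.monoid H X Y | p.count = 0}.Finite := by
      refine Set.Subsingleton.finite fun p hp q hq => ?_
      cases p with
      | nil =>
        cases q with
        | nil => rfl
        | cons => exact absurd hq (Nat.succ_ne_zero _)
      | cons => exact absurd hp (Nat.succ_ne_zero _)
    have h1 : (⋃ x ∈ {x | x ∈ antidiagonal u}, ⋃ s ∈ {s | s ∈ c.splits},
        {p : Pieces T.monoid H X Y | (x.1 = 0 → s.2.1.length = 1) ∧ ∃ r : Pieces T.monoid H s.1 Y,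
          (r.Adm ∧ r.chain = s.2.2 ∧ r.weight = x.2) ∧ p = cons x.1 s.2.1 r}).Finite := by
      refine (antidiagonal u).finite_toSet.biUnion fun x hx =>
        (c.splits.finite_toSet).biUnion fun s hs => ?_
      by_cases hadm : x.1 = 0 → s.2.1.length = 1
      · refine ((ih _ _ (ToricDatum.lex_lt_of_split hx (MorChain.mem_splits.1 hs)
          fun h => by rw [hadm h]; exact one_ne_zero) _ s.2.2 rfl).image
          (cons x.1 s.2.1)).subset ?_
        rintro _ ⟨-, r, hr, rfl⟩
        exact ⟨r, hr, rfl⟩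
      · exact Set.finite_empty.subset fun p hp => hadm hp.1
    refine (h0.union h1).subset ?_
    rintro p ⟨hp, hpc, hpw⟩
    cases p with
    | nil => exact Or.inl rfl
    | cons w d r =>
      refine Or.inr ?_
      simp only [Set.mem_iUnion]
      exact ⟨(w, r.weight), mem_antidiagonal.2 hpw, ⟨_, d, r.chain⟩, MorChain.mem_splits.2 hpc,
        hp.1, r, ⟨hp.2, rfl, rfl⟩, rfl⟩

/-- The admissible subdivisions of a chain of given weight. -/
noncomputable def adm (u : T.monoid) {X Y : Ob} (c : MorChain H X Y) :
    Finset (Pieces T.monoid H X Y) := (finite_adm u c).toFinset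

theorem mem_adm {u : T.monoid} {X Y : Ob} {c : MorChain H X Y} {p : Pieces T.monoid H X Y} :
    p ∈ adm u c ↔ p.Adm ∧ p.chain = c ∧ p.weight = u := by simp [adm]

/-- A subdivision is either empty, which gives the first summand, or determined by its first part
and a subdivision of the rest. All later facts about pullbacks are proved by this recursion. -/
theorem sum_adm {V : Type*} [AddCommGroup V] (F : T.monoid → Cochain H) {X Y : Ob}
    (φ : MorChain H X Y → V) (u : T.monoid) (c : MorChain H X Y) :
    ∑ p ∈ adm u c, φ (p.apply F) = (if u = 0 ∧ c.length = 0 then φ c else 0) +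
      ∑ x ∈ antidiagonal u, c.sumSplits fun _ s t => if x.1 = 0 → s.length = 1 then
        ∑ r ∈ adm x.2 t, φ (.cons (F x.1 _ _ s) (r.apply F)) else 0 := by
  rw [← Finset.sum_filter_add_sum_filter_not _ (fun p => p.count = 0)]
  congr 1
  · split_ifs with h
    · obtain ⟨rfl, hc⟩ := h
      cases c with
      | nil =>
        rw [Finset.sum_eq_single (nil X)]
        · rfl
        · intro p hp hne
          cases p with
          | nil => exact absurd rfl hne
          | cons => exact absurd (Finset.mem_filter.1 hp).2 (Nat.succ_ne_zero _)
        · intro hn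
          have hmem : (nil X : Pieces T.monoid H X X) ∈ adm (0 : T.monoid) (MorChain.nil X) :=
            mem_adm.2 ⟨by simp [Adm], rfl, rfl⟩
          exact (hn (Finset.mem_filter.2 ⟨hmem, rfl⟩)).elim
      | cons => exact absurd hc (Nat.succ_ne_zero _)
    · refine Finset.sum_eq_zero fun p hp => ?_
      obtain ⟨hp, hp0⟩ := Finset.mem_filter.1 hp
      obtain ⟨-, hpc, hpw⟩ := mem_adm.1 hp
      cases p with
      | nil =>
        subst hpc hpw
        exact absurd ⟨rfl, rfl⟩ h
      | cons => exact absurd hp0 (Nat.succ_ne_zero _)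
  · classical
    simp only [MorChain.sumSplits, ← List.sum_toFinset _ c.nodup_splits]
    simp only [← Finset.sum_filter]
    rw [Finset.sum_congr rfl fun x _ => Finset.sum_sigma' _ _ _, Finset.sum_sigma']
    symm
    refine Finset.sum_bij (fun y _ => cons y.1.1 y.2.1.2.1 y.2.2) ?_ ?_ ?_ ?_
    · rintro ⟨x, ⟨Z, s, t⟩, r⟩ hy
      simp only [Finset.mem_sigma, Finset.mem_filter, List.mem_toFinset, mem_adm,
        MorChain.mem_splits, mem_antidiagonal] at hy ⊢
      obtain ⟨hx, ⟨hst, hadm⟩, hr, hrc, hrw⟩ := hy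
      refine ⟨⟨⟨hadm, hr⟩, ?_, ?_⟩, Nat.succ_ne_zero _⟩
      · rw [chain, hrc, hst]
      · rw [weight, hrw, hx]
    · rintro ⟨⟨v, w⟩, ⟨Z, s, t⟩, r⟩ hy ⟨⟨v', w'⟩, ⟨Z', s', t'⟩, r'⟩ hy' h
      simp only [Finset.mem_sigma, Finset.mem_filter, mem_adm] at hy hy'
      simp only at h
      obtain ⟨-, -, -, h1, h2⟩ := hy
      obtain ⟨-, -, -, h1', h2'⟩ := hy'
      simp only [cons.injEq] at h
      obtain ⟨rfl, rfl, h3, h4⟩ := h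
      obtain rfl := eq_of_heq h3
      obtain rfl := eq_of_heq h4
      rw [← h1, ← h2, ← h1', ← h2']
    · intro p hp
      obtain ⟨hp, hp0⟩ := Finset.mem_filter.1 hp
      obtain ⟨h1, h2, h3⟩ := mem_adm.1 hp
      cases p with
      | nil => exact absurd rfl hp0
      | cons w d r =>
        refine ⟨⟨(w, r.weight), ⟨_, d, r.chain⟩, r⟩, ?_, rfl⟩
        simp only [Finset.mem_sigma, Finset.mem_filter, List.mem_toFinset, mem_adm,
          MorChain.mem_splits, mem_antidiagonal]
        exact ⟨h3, ⟨h2, h1.1⟩, h1.2, trivial, trivial⟩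
    · exact fun _ _ => rfl

end Pieces

/-! ### Simultaneous cuts of a chain and of a weight -/

namespace MorChain

variable {Ob : Type*} {H : Ob → Ob → Type*} {V : Type*} [AddCommMonoid V]
  {M : Type*} [AddCommMonoid M] [Finset.HasAntidiagonal M]

/-- The sum of a function over all ways to cut a chain into two consecutive parts, and a weight
into the sum of two weights. -/
def wsum (u : M) {X Y : Ob} (c : MorChain H X Y)
    (g : M → M → ∀ Z, MorChain H X Z → MorChain H Z Y → V) : V :=
  ∑ x ∈ antidiagonal u, c.sumSplits (g x.1 x.2)

variable {X Y : Ob} {u : M} {c : MorChain H X Y}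

theorem wsum_congr {g h : M → M → ∀ Z, MorChain H X Z → MorChain H Z Y → V}
    (hgh : ∀ v w Z s t, v + w = u → s.append t = c → g v w Z s t = h v w Z s t) :
    wsum u c g = wsum u c h :=
  Finset.sum_congr rfl fun _ hx => sumSplits_congr fun Z s t hst =>
    hgh _ _ Z s t (mem_antidiagonal.1 hx) hst

theorem wsum_zero : (wsum u c fun _ _ _ _ _ => (0 : V)) = 0 := by
  simp only [wsum, sumSplits_zero, Finset.sum_const_zero]

theorem wsum_eq_zero {g : M → M → ∀ Z, MorChain H X Z → MorChain H Z Y → V}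
    (hg : ∀ v w Z s t, v + w = u → s.append t = c → g v w Z s t = 0) : wsum u c g = 0 :=
  (wsum_congr hg).trans wsum_zero

theorem wsum_add (g h : M → M → ∀ Z, MorChain H X Z → MorChain H Z Y → V) :
    (wsum u c fun v w Z s t => g v w Z s t + h v w Z s t) = wsum u c g + wsum u c h := by
  simp only [wsum, sumSplits_add, Finset.sum_add_distrib]

theorem wsum_sub {V : Type*} [AddCommGroup V]
    (g h : M → M → ∀ Z, MorChain H X Z → MorChain H Z Y → V) :
    (wsum u c fun v w Z s t => g v w Z s t - h v w Z s t) = wsum u c g - wsum u c h := by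
  rw [eq_sub_iff_add_eq, ← wsum_add]
  simp only [sub_add_cancel]

theorem wsum_assoc
    (g : M → M → M → ∀ Z W, MorChain H X Z → MorChain H Z W → MorChain H W Y → V) :
    (wsum u c fun v w W s t => wsum v s fun a b Z d e => g a b w Z W d e t) =
      wsum u c fun v w Z s t => wsum w t fun a b W d e => g v a b Z W s d e := by
  simp only [wsum, sumSplits_finsetSum]
  rw [sum_antidiagonal_assoc fun v a b =>
    c.sumSplits fun Z s t => t.sumSplits fun W d e => g v a b Z W s d e]
  exact Finset.sum_congr rfl fun x _ => Finset.sum_congr rfl fun y _ =>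
    sumSplits_assoc c fun Z W => g y.1 y.2 x.2 Z W

theorem sum_wsum_left (g : M → M → M → ∀ Z, MorChain H X Z → MorChain H Z Y → V) :
    ∑ x ∈ antidiagonal u, wsum x.2 c (g x.1) =
      wsum u c fun v w Z s t => ∑ x ∈ antidiagonal v, g x.1 x.2 w Z s t := by
  simp only [wsum, sumSplits_finsetSum]
  exact sum_antidiagonal_assoc (fun a v w => c.sumSplits (g a v w)) u

theorem sum_wsum_right (g : M → M → M → ∀ Z, MorChain H X Z → MorChain H Z Y → V) :
    ∑ x ∈ antidiagonal u, wsum x.2 c (g x.1) =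
      wsum u c fun v w Z s t => ∑ x ∈ antidiagonal w, g x.1 v x.2 Z s t := by
  simp only [wsum, sumSplits_finsetSum]
  exact sum_antidiagonal_left_comm (fun a v w => c.sumSplits (g a v w)) u

theorem wsum_nil_left [DecidableEq M] (g : M → ∀ Z, MorChain H X Z → MorChain H Z Y → V) :
    (wsum u c fun v w Z s t => if v = 0 ∧ s.length = 0 then g w Z s t else 0) =
      g u X (nil X) c := by
  rw [wsum, Finset.sum_eq_single (0, u)]
  · cases c with
    | nil => simp [sumSplits_nil, length]
    | cons a c => simp [sumSplits_cons, length, sumSplits_zero]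
  · rintro ⟨v, w⟩ hx hne
    have hv : v ≠ 0 := by
      rintro rfl
      have := mem_antidiagonal.1 hx
      rw [zero_add] at this
      exact hne (by rw [← this])
    simp [hv, sumSplits_zero]
  · exact fun h => absurd (mem_antidiagonal.2 (zero_add u)) h

theorem sumSplits_of_length_eq_zero {c : MorChain H X Y} (h : c.length = 0)
    (g : ∀ Z, MorChain H X Z → MorChain H Z Y → V) :
    c.sumSplits g = g X (nil X) c := by
  cases c with
  | nil => exact sumSplits_nil g
  | cons => exact absurd h (Nat.succ_ne_zero _)

end MorChain

namespace MorChain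

open Pieces (adm)

variable {Ob : Type*} {H : Ob → Ob → Type*} {G : Type*} [AddCommGroup G] {𝔾 : GradingDatum G}
  {P : Type*} [Fintype P] {T : ToricDatum 𝔾 P} {V : Type*} [AddCommGroup V]

/-- The sum of the values of `φ` on the chains obtained by applying `F` to all parts of an
admissible subdivision. -/
noncomputable def pull (F : T.monoid → Cochain H) {X Y : Ob} (φ : MorChain H X Y → V)
    (u : T.monoid) (c : MorChain H X Y) : V := ∑ p ∈ adm u c, φ (p.apply F)

variable (F : T.monoid → Cochain H) {X Y : Ob}

theorem pull_eq (φ : MorChain H X Y → V) (u : T.monoid) (c : MorChain H X Y) :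
    pull F φ u c = (if u = 0 ∧ c.length = 0 then φ c else 0) +
      wsum u c fun v w _ s t => if v = 0 → s.length = 1 then
        pull F (fun e => φ (.cons (F v _ _ s) e)) w t else 0 := Pieces.sum_adm F φ u c

theorem pull_add (φ φ' : MorChain H X Y → V) (u : T.monoid) (c : MorChain H X Y) :
    pull F (fun c => φ c + φ' c) u c = pull F φ u c + pull F φ' u c := Finset.sum_add_distrib

theorem pull_zero (u : T.monoid) (c : MorChain H X Y) : pull F (fun _ => (0 : V)) u c = 0 :=
  Finset.sum_const_zero

theorem pull_finsetSum {ι : Type*} (s : Finset ι) (φ : ι → MorChain H X Y → V) (u : T.monoid)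
    (c : MorChain H X Y) : pull F (fun c => ∑ i ∈ s, φ i c) u c = ∑ i ∈ s, pull F (φ i) u c :=
  Finset.sum_comm

theorem pull_map {W : Type*} [AddCommGroup W] (f : V →+ W) (φ : MorChain H X Y → V) (u : T.monoid)
    (c : MorChain H X Y) : pull F (fun c => f (φ c)) u c = f (pull F φ u c) :=
  (map_sum f _ _).symm

/-- In bar notation, F̂ is a coalgebra map: a cut of the image chain falls between two parts, and so
comes from a cut of the subdivision. -/
theorem pull_sumSplits (θ : ∀ Z, MorChain H X Z → MorChain H Z Y → V) (u : T.monoid)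
    (c : MorChain H X Y) : pull F (fun c => c.sumSplits θ) u c =
      wsum u c fun v w Z s t => pull F (fun d => pull F (θ Z d) w t) v s := by
  suffices h : ∀ (u : T.monoid) (n : ℕ) (X : Ob) (θ : ∀ Z, MorChain H X Z → MorChain H Z Y → V)
      (c : MorChain H X Y), c.length = n → pull F (fun c => c.sumSplits θ) u c =
        wsum u c fun v w Z s t => pull F (fun d => pull F (θ Z d) w t) v s from h u _ X θ c rfl
  intro u n
  induction u, n using ToricDatum.sdvd_lex_induction with
  | _ u n ih =>
    rintro X θ c rfl
    -- A cut of the image chain lies either before the first image F(s), or after it; in the second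
    -- case induction applies to the remaining chain.
    have h1 : (wsum u c fun v w Z s t => if v = 0 → s.length = 1 then
        pull F (fun e => (cons (F v _ _ s) e).sumSplits θ) w t else 0) =
        (wsum u c fun v w Z s t => if v = 0 → s.length = 1 then
          pull F (fun e => θ X (nil X) (cons (F v _ _ s) e)) w t else 0) +
        wsum u c fun v w Z s t => wsum w t fun a b W d e => if v = 0 → s.length = 1 then
          pull F (fun d => pull F (θ W (cons (F v _ _ s) d)) b e) a d else 0 := by
      rw [← wsum_add]
      refine wsum_congr fun v w Z s t hu hc => ?_
      by_cases h : v = 0 → s.length = 1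
      · simp only [if_pos h, sumSplits_cons]
        rw [pull_add, ih w t.length (ToricDatum.lex_lt_of_split (x := (v, w)) (mem_antidiagonal.2 hu) hc
          fun h0 => by rw [h h0]; exact one_ne_zero) Z _ t rfl]
      · simp only [if_neg h, wsum_zero, add_zero]
    have h2 : (wsum u c fun v w Z s t => pull F (fun d => pull F (θ Z d) w t) v s) =
        pull F (θ X (nil X)) u c + wsum u c fun v w Z s t => wsum w t fun a b W d e =>
          if v = 0 → s.length = 1 then
            pull F (fun d => pull F (θ W (cons (F v _ _ s) d)) b e) a d else 0 := by
      rw [← wsum_assoc fun v a b Z W s d e => if v = 0 → s.length = 1 then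
            pull F (fun d => pull F (θ W (cons (F v _ _ s) d)) b e) a d else 0,
        ← wsum_nil_left fun w Z s t => pull F (θ Z s) w t, ← wsum_add]
      exact wsum_congr fun v w Z s t _ _ => pull_eq F (fun d => pull F (θ Z d) w t) v s
    rw [h2, pull_eq, h1, pull_eq F (θ X (nil X)), add_assoc]
    congr 1
    split_ifs with h
    · rw [sumSplits_of_length_eq_zero h.2]
    · rfl

end MorChain

theorem idCochain_eq_zero {Ob : Type*} {H : Ob → Ob → Type*} [∀ X Y, AddCommGroup (H X Y)]
    {X Y : Ob} {c : MorChain H X Y} (h : c.length ≠ 1) : idCochain H X Y c = 0 := by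
  cases c with
  | nil => rfl
  | cons a c =>
    cases c with
    | nil => exact absurd rfl h
    | cons => rfl

namespace MorChain

section

variable {Ob : Type*} {H : Ob → Ob → Type*} {V : Type*} [AddCommMonoid V]
  {M : Type*} [AddCommMonoid M] [Finset.HasAntidiagonal M] {X Y : Ob} {u : M} {c : MorChain H X Y}

theorem wsum_eq_left (g : M → M → ∀ Z, MorChain H X Z → MorChain H Z Y → V)
    (hg : ∀ v w Z s t, v + w = u → w ≠ 0 → g v w Z s t = 0) :
    wsum u c g = c.sumSplits (g u 0) := by
  rw [wsum, Finset.sum_eq_single (u, 0)]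
  · rintro ⟨v, w⟩ hx hne
    refine sumSplits_eq_zero fun Z s t _ => hg _ _ _ _ _ (mem_antidiagonal.1 hx) ?_
    rintro rfl
    have := mem_antidiagonal.1 hx
    rw [add_zero] at this
    exact hne (by rw [← this])
  · exact fun h => absurd (mem_antidiagonal.2 (add_zero u)) h

theorem wsum_eq_right (g : M → M → ∀ Z, MorChain H X Z → MorChain H Z Y → V)
    (hg : ∀ v w Z s t, v + w = u → v ≠ 0 → g v w Z s t = 0) :
    wsum u c g = c.sumSplits (g 0 u) := by
  rw [wsum, Finset.sum_eq_single (0, u)]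
  · rintro ⟨v, w⟩ hx hne
    refine sumSplits_eq_zero fun Z s t _ => hg _ _ _ _ _ (mem_antidiagonal.1 hx) ?_
    rintro rfl
    have := mem_antidiagonal.1 hx
    rw [zero_add] at this
    exact hne (by rw [← this])
  · exact fun h => absurd (mem_antidiagonal.2 (zero_add u)) h

theorem sumSplits_idCochain_nil [∀ X Y, AddCommGroup (H X Y)]
    (g : ∀ Z, H X Z → MorChain H Z X → V) (hg : ∀ Z t, g Z 0 t = 0) :
    ((nil X).sumSplits fun Z s t => g Z (idCochain H X Z s) t) = 0 :=
  (sumSplits_nil _).trans (hg _ _)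

theorem sumSplits_idCochain_cons [∀ X Y, AddCommGroup (H X Y)] {Z : Ob}
    (g : ∀ Z, H X Z → MorChain H Z Y → V) (hg : ∀ Z t, g Z 0 t = 0) (a : H X Z)
    (c : MorChain H Z Y) :
    ((cons a c).sumSplits fun Z s t => g Z (idCochain H X Z s) t) = g Z a c := by
  rw [sumSplits_cons, idCochain_eq_zero (H := H) (c := nil X) (by simp [length]), hg, zero_add]
  cases c with
  | nil => exact sumSplits_nil _
  | cons b c =>
    rw [sumSplits_cons, sumSplits_eq_zero, add_zero]
    · rfl
    · exact fun Z s t _ => hg Z t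

end

variable {k : Type*} [Field k] {Ob : Type*} {H : Ob → Ob → Type*} [∀ X Y, AddCommGroup (H X Y)]
  [∀ X Y, Module k (H X Y)] {V : Type*} [AddCommGroup V] [Module k V] {X Y : Ob}

variable (k) in
/-- `φ` is linear in each entry. -/
def Multilinear (φ : MorChain H X Y → V) : Prop :=
  ∀ {Z W : Ob} (c : MorChain H X Z) (c' : MorChain H W Y),
    IsLinearMap k fun a : H Z W => φ (c.append (.cons a c'))

theorem Multilinear.cons {Z : Ob} {φ : MorChain H X Y → V} (hφ : Multilinear k φ) (b : H X Z) :
    Multilinear k fun e => φ (.cons b e) := fun c c' => hφ (.cons b c) c'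

theorem Multilinear.head {Z : Ob} {φ : MorChain H X Y → V} (hφ : Multilinear k φ)
    (c : MorChain H Z Y) : IsLinearMap k fun a : H X Z => φ (.cons a c) := hφ (nil X) c

variable {G : Type*} [AddCommGroup G] {𝔾 : GradingDatum G}
  {P : Type*} [Fintype P] {T : ToricDatum 𝔾 P} (F : T.monoid → Cochain H)

theorem pull_smul (r : k) (φ : MorChain H X Y → V) (u : T.monoid) (c : MorChain H X Y) :
    pull F (fun c => r • φ c) u c = r • pull F φ u c :=
  pull_map F (LinearMap.lsmul k V r).toAddMonoidHom φ u c

/-- The pullback as a linear function of the first entry. -/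
noncomputable def Multilinear.pullHead {Z : Ob} {φ : MorChain H X Y → V} (hφ : Multilinear k φ)
    (u : T.monoid) (c : MorChain H Z Y) : H X Z →ₗ[k] V where
  toFun b := pull F (fun e => φ (.cons b e)) u c
  map_add' a b := by simp only [(hφ.head _).map_add, pull_add]
  map_smul' r a := by simp only [(hφ.head _).map_smul, pull_smul, RingHom.id_apply]

variable {F}

theorem pull_head_zero {Z : Ob} {φ : MorChain H X Y → V} (hφ : Multilinear k φ) (u : T.monoid)
    (c : MorChain H Z Y) : pull F (fun e => φ (.cons 0 e)) u c = 0 := (hφ.pullHead F u c).map_zero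

/-- The admissibility condition may be dropped: for an inadmissible first part F_0 = id gives 0, and
φ is linear in that entry. -/
theorem pull_eq' (hF : F 0 = idCochain H) {φ : MorChain H X Y → V} (hφ : Multilinear k φ)
    (u : T.monoid) (c : MorChain H X Y) :
    pull F φ u c = (if u = 0 ∧ c.length = 0 then φ c else 0) +
      wsum u c fun v w _ s t => pull F (fun e => φ (.cons (F v _ _ s) e)) w t := by
  rw [pull_eq]
  congr 1
  refine wsum_congr fun v w Z s t _ _ => ?_
  split_ifs with h
  · rfl
  · push Not at h
    rw [h.1, hF, idCochain_eq_zero h.2, pull_head_zero hφ]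

/-- Total weight 0 forces every part to have weight 0, where F is the identity. -/
theorem pull_weight_zero (hF : F 0 = idCochain H) {φ : MorChain H X Y → V}
    (hφ : Multilinear k φ) (c : MorChain H X Y) : pull F φ 0 c = φ c := by
  induction c with
  | nil X =>
    rw [pull_eq' hF hφ, if_pos ⟨rfl, rfl⟩, wsum, ToricDatum.antidiagonal_zero',
      Finset.sum_singleton, hF, sumSplits_idCochain_nil fun Z b t => pull F (fun e => φ (.cons b e)) 0 t, add_zero]
    exact fun Z t => pull_head_zero hφ 0 t
  | cons a c ih =>
    rw [pull_eq' hF hφ, if_neg (fun h => Nat.succ_ne_zero _ h.2), wsum,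
      ToricDatum.antidiagonal_zero', Finset.sum_singleton, hF,
      sumSplits_idCochain_cons (fun Z b t => pull F (fun e => φ (.cons b e)) 0 t), zero_add,
      ih (hφ.cons a)]
    exact fun Z t => pull_head_zero hφ 0 t

end MorChain

/-! ### Pullbacks and insertions; the curvature of a formal functor -/

namespace PreCat

open MorChain

variable {k : Type*} [Field k] {G : Type*} [AddCommGroup G] [DecidableEq G] {𝔾 : GradingDatum G}
  {Ob : Type*} {H : Ob → Ob → Type*} [∀ X Y, AddCommGroup (H X Y)] [∀ X Y, Module k (H X Y)]
  (C : PreCat k 𝔾 H) {V : Type*} [AddCommGroup V] [Module k V]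
  {P : Type*} [Fintype P] {T : ToricDatum 𝔾 P} {X Y : Ob}

theorem ins_congr (ε : ZMod 2) (χ : Cochain H) {φ φ' : MorChain H X Y → V} {c : MorChain H X Y}
    (h : ∀ c, c.length ≠ 0 → φ c = φ' c) : C.ins ε χ φ c = C.ins ε χ φ' c := by
  refine sumSplits_congr fun Z s t _ => sumSplits_congr fun W d e _ => h _ ?_
  rw [length_append, length_cons]
  omega

/-- Inserting as a linear function of the first entry. -/
noncomputable def insHead {Z : Ob} {φ : MorChain H X Y → V} (hφ : Multilinear k φ) (ε : ZMod 2)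
    (χ : Cochain H) (c : MorChain H Z Y) : H X Z →ₗ[k] V where
  toFun b := C.ins ε χ (fun e => φ (.cons b e)) c
  map_add' a b := by simp only [(hφ.head _).map_add, ins_add]
  map_smul' r a := by
    simp only [(hφ.head _).map_smul, RingHom.id_apply]
    exact C.ins_map (LinearMap.lsmul k V r).toAddMonoidHom ε χ _ c

theorem ins_head_zero {Z : Ob} {φ : MorChain H X Y → V} (hφ : Multilinear k φ) (ε : ZMod 2)
    (χ : Cochain H) (c : MorChain H Z Y) : C.ins ε χ (fun e => φ (.cons 0 e)) c = 0 :=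
  (C.insHead hφ ε χ c).map_zero

/-- Look at the first image: either χ consumes an initial run of images, or the first image stays in
front of χ and receives the sign. -/
theorem pull_ins {F : T.monoid → Cochain H} (hF : F 0 = idCochain H) (χ : Cochain H)
    {φ : MorChain H X Y → V} (hφ : Multilinear k φ) (u : T.monoid) (c : MorChain H X Y) :
    pull F (C.ins 1 χ φ) u c =
      (wsum u c fun v w _ s t => pull F (fun e => φ (.cons (pull F (χ _ _) v s) e)) w t) +
      wsum u c fun v w _ s t =>
        pull F (C.ins 1 χ fun e => φ (.cons (C.sgn 1 _ _ (F v _ _ s)) e)) w t := by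
  have h1 : (wsum u c fun v w _ s t => pull F (fun e => φ (.cons (pull F (χ _ _) v s) e)) w t) =
      pull F (fun c => c.sumSplits fun _ d e => φ (.cons (χ _ _ d) e)) u c := by
    rw [pull_sumSplits]
    exact wsum_congr fun v w Z s t _ _ =>
      (pull_map F (hφ.pullHead F w t).toAddMonoidHom (χ _ _) v s).symm
  rw [h1, pull_eq, pull_eq F fun c => c.sumSplits fun _ d e => φ (.cons (χ _ _ d) e), add_assoc,
    ← wsum_add]
  congr 1
  · split_ifs with h
    · cases c with
      | nil => rw [ins_nil, sumSplits_nil]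
      | cons => exact absurd h.2 (Nat.succ_ne_zero _)
    · rfl
  · refine wsum_congr fun v w Z s t _ _ => ?_
    split_ifs with h
    · rw [← pull_add]
      exact congrArg (fun ψ => pull F ψ w t) (funext fun e => C.ins_cons 1 χ φ _ e)
    · push Not at h
      have h2 : (C.ins 1 χ fun e => φ (.cons (0 : H X Z) e)) = fun _ => 0 :=
        funext fun e => C.ins_head_zero hφ 1 χ e
      rw [h.1, hF, idCochain_eq_zero h.2, map_zero, h2, pull_zero, add_zero]

/-- The counterpart for the opposite order of composition: χ acts inside the first part or to the
right of it. In the second case the sign on the entries of that part passes through F, which is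
even. -/
theorem ins_pull {F : T.monoid → Cochain H} (hF : F 0 = idCochain H)
    (hFs : ∀ v X Y c, F v X Y (C.sign 1 c) = C.sgn 1 X Y (F v X Y c)) (χ : Cochain H)
    {φ : MorChain H X Y → V} (hφ : Multilinear k φ) (u : T.monoid) (c : MorChain H X Y) :
    C.ins 1 χ (pull F φ u) c =
      (wsum u c fun v w _ s t => pull F (fun e => φ (.cons (C.ins 1 χ (F v _ _) s) e)) w t) +
      wsum u c fun v w _ s t =>
        C.ins 1 χ (pull F (fun e => φ (.cons (C.sgn 1 _ _ (F v _ _ s)) e)) w) t := by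
  have h1 : C.ins 1 χ (pull F φ u) c = C.ins 1 χ (fun c => ∑ x ∈ antidiagonal u,
      c.sumSplits fun _ s t => pull F (fun e => φ (.cons (F x.1 _ _ s) e)) x.2 t) c := by
    refine C.ins_congr 1 χ fun c hc => ?_
    rw [pull_eq' hF hφ, if_neg (fun h => hc h.2), zero_add]
    rfl
  rw [h1, ins_finsetSum, ← wsum_add]
  refine Finset.sum_congr rfl fun x _ => ?_
  rw [ins_sumSplits]
  refine sumSplits_congr fun Z s t _ => ?_
  rw [hFs]
  congr 1
  exact C.ins_map (hφ.pullHead F x.2 t).toAddMonoidHom 1 χ (F x.1 _ _) s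

/-- The failure of `F` to be a functor from `β` to `α`. -/
noncomputable def curv (F α β : T.monoid → Cochain H) : T.monoid → Cochain H :=
  fun u X Y c => ∑ x ∈ antidiagonal u,
    (pull F (α x.1 X Y) x.2 c - C.ins 1 (β x.1) (F x.2 X Y) c)

/-- The failure of the pullback along `F` to intertwine the insertions of `α` and `β`. -/
noncomputable def defect (F α β : T.monoid → Cochain H) (φ : MorChain H X Y → V) (u : T.monoid)
    (c : MorChain H X Y) : V := ∑ x ∈ antidiagonal u,
  (pull F (C.ins 1 (α x.1) φ) x.2 c - C.ins 1 (β x.1) (pull F φ x.2) c)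

variable {F α β : T.monoid → Cochain H}

/-- Subtracting `ins_pull` from `pull_ins` shows that α̂F̂ - F̂β̂ is a coderivation along F̂, hence
is determined by its projection to chains of length one, the curvature. -/
theorem defect_eq (hF : F 0 = idCochain H)
    (hFs : ∀ v X Y c, F v X Y (C.sign 1 c) = C.sgn 1 X Y (F v X Y c))
    {φ : MorChain H X Y → V} (hφ : Multilinear k φ) (u : T.monoid) (c : MorChain H X Y) :
    C.defect F α β φ u c = wsum u c fun v w _ s t =>
      pull F (fun e => φ (.cons (C.curv F α β v _ _ s) e)) w t +
      C.defect F α β (fun e => φ (.cons (C.sgn 1 _ _ (F v _ _ s)) e)) w t := by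
  have h1 : ∀ x ∈ antidiagonal u, pull F (C.ins 1 (α x.1) φ) x.2 c -
      C.ins 1 (β x.1) (pull F φ x.2) c =
      (wsum x.2 c fun v w _ s t => (hφ.pullHead F w t)
        (pull F (α x.1 _ _) v s - C.ins 1 (β x.1) (F v _ _) s)) +
      wsum x.2 c fun v w _ s t =>
        (pull F (C.ins 1 (α x.1) fun e => φ (.cons (C.sgn 1 _ _ (F v _ _ s)) e)) w t -
        C.ins 1 (β x.1) (pull F (fun e => φ (.cons (C.sgn 1 _ _ (F v _ _ s)) e)) w) t) := by
    intro x _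
    rw [C.pull_ins hF _ hφ, C.ins_pull hF hFs _ hφ]
    simp only [map_sub]
    rw [wsum_sub, wsum_sub]
    exact add_sub_add_comm _ _ _ _
  rw [defect, Finset.sum_congr rfl h1, Finset.sum_add_distrib,
    sum_wsum_left fun a v w _ s t => (hφ.pullHead F w t)
        (pull F (α a _ _) v s - C.ins 1 (β a) (F v _ _) s),
    sum_wsum_right fun a v w _ s t =>
        (pull F (C.ins 1 (α a) fun e => φ (.cons (C.sgn 1 _ _ (F v _ _ s)) e)) w t -
        C.ins 1 (β a) (pull F (fun e => φ (.cons (C.sgn 1 _ _ (F v _ _ s)) e)) w) t), ← wsum_add]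
  refine wsum_congr fun v w Z s t _ _ => ?_
  rw [← map_sum]
  rfl

theorem defect_head_zero {Z : Ob} {φ : MorChain H X Y → V} (hφ : Multilinear k φ)
    (u : T.monoid) (c : MorChain H Z Y) : C.defect F α β (fun e => φ (.cons 0 e)) u c = 0 := by
  have h : (fun e : MorChain H Z Y => φ (.cons 0 e)) = fun _ => 0 :=
    funext fun e => (hφ.head e).map_zero
  have h1 : ∀ χ : Cochain H, C.ins 1 χ (fun _ : MorChain H Z Y => (0 : V)) = fun _ => 0 :=
    fun χ => funext fun e => C.ins_zero 1 χ e
  have h2 : ∀ w, pull F (fun _ : MorChain H Z Y => (0 : V)) w = fun _ => 0 :=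
    fun w => funext fun e => pull_zero F w e
  simp only [defect, h, h1, h2, sub_zero, Finset.sum_const_zero]

theorem ins_cochain_zero (ε : ZMod 2) {φ : MorChain H X Y → V} (hφ : Multilinear k φ)
    (c : MorChain H X Y) : C.ins ε 0 φ c = 0 :=
  sumSplits_eq_zero fun _ s _ _ => sumSplits_eq_zero fun _ _ e _ => (hφ (C.sign ε s) e).map_zero

/-- If `F` is a functor up to weight `u`, then the defect at `u` is the insertion of its
curvature. -/
theorem defect_eq_ins (hF : F 0 = idCochain H)
    (hFs : ∀ v X Y c, F v X Y (C.sign 1 c) = C.sgn 1 X Y (F v X Y c)) {u : T.monoid}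
    (h : ∀ v, ToricDatum.SDvd v u → C.curv F α β v = 0) {v : T.monoid}
    (hv : v = u ∨ ToricDatum.SDvd v u) {φ : MorChain H X Y → V} (hφ : Multilinear k φ)
    (c : MorChain H X Y) : C.defect F α β φ v c = C.ins 1 (C.curv F α β v) φ c := by
  suffices key : ∀ (v : T.monoid) (n : ℕ), (v = u ∨ ToricDatum.SDvd v u) →
      ∀ (X : Ob) (φ : MorChain H X Y → V), Multilinear k φ → ∀ c : MorChain H X Y, c.length = n →
      C.defect F α β φ v c = C.ins 1 (C.curv F α β v) φ c from key v _ hv X φ hφ c rfl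
  intro v n
  induction v, n using ToricDatum.sdvd_lex_induction with
  | _ v n ih =>
    rintro hv X φ hφ c rfl
    have hlt : ∀ {a}, ToricDatum.SDvd a v → C.curv F α β a = 0 := fun {a} ha =>
      h a (hv.elim (fun e => e ▸ ha) fun e => ha.trans e)
    rw [C.defect_eq hF hFs hφ, wsum_add]
    -- The curvature vanishes at strict divisors, so it must take the whole weight v; the remaining
    -- parts have weight 0, where F is the identity.
    have h1 : (wsum v c fun a b _ s t => pull F (fun e => φ (.cons (C.curv F α β a _ _ s) e)) b t) =
        c.sumSplits fun _ s t => φ (.cons (C.curv F α β v _ _ s) t) := by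
      rw [wsum_eq_left]
      · exact sumSplits_congr fun Z s t _ => pull_weight_zero hF (hφ.cons _) t
      · intro a b Z s t hab hb
        rw [hlt (ToricDatum.SDvd.of_add hab hb)]
        exact pull_head_zero hφ b t
    have h2 : (wsum v c fun a b _ s t =>
        C.defect F α β (fun e => φ (.cons (C.sgn 1 _ _ (F a _ _ s)) e)) b t) =
        wsum v c fun a b _ s t =>
          C.ins 1 (C.curv F α β b) (fun e => φ (.cons (C.sgn 1 _ _ (F a _ _ s)) e)) t := by
      refine wsum_congr fun a b Z s t hab hst => ?_
      by_cases h0 : a = 0 ∧ s.length = 0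
      · rw [h0.1, hF, idCochain_eq_zero (by rw [h0.2]; exact Nat.zero_ne_one), map_zero,
          C.defect_head_zero hφ, C.ins_head_zero hφ]
      · have hb := ToricDatum.lex_lt_of_split (x := (a, b)) (mem_antidiagonal.2 hab) hst
          fun h1 h2 => h0 ⟨h1, h2⟩
        refine ih b t.length hb ?_ Z _ (hφ.cons _) t rfl
        rcases hb with hb | ⟨hb, -⟩
        · exact Or.inr (hv.elim (fun e => e ▸ hb) fun e => hb.trans e)
        · exact (show b = v from hb) ▸ hv
    -- In the other sum the curvature also takes the whole weight. The first part then has weight 0,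
    -- so it is a single unchanged entry, and what remains is the recursion for an insertion.
    rw [h1, h2, wsum_eq_right]
    · rw [hF]
      cases c with
      | nil =>
        rw [sumSplits_idCochain_nil fun Z b t => C.ins 1 (C.curv F α β v)
          (fun e => φ (.cons (C.sgn 1 _ _ b) e)) t, ins_nil, sumSplits_nil, add_zero]
        intro Z t
        rw [map_zero, C.ins_head_zero hφ]
      | cons a c =>
        rw [sumSplits_idCochain_cons fun Z b t => C.ins 1 (C.curv F α β v)
          (fun e => φ (.cons (C.sgn 1 _ _ b) e)) t, ins_cons]
        intro Z t
        rw [map_zero, C.ins_head_zero hφ]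
    · intro a b Z s t hab ha
      rw [hlt (ToricDatum.SDvd.of_add' hab ha)]
      exact C.ins_cochain_zero 1 (hφ.cons _) t

end PreCat

theorem koszul_add (a b : ZMod 2) : koszul (a + b) = koszul a * koszul b := by
  revert a b
  decide

theorem koszul_mul_self (a : ZMod 2) : koszul a * koszul a = 1 := by
  revert a
  decide

namespace PreCat

open MorChain

variable {k : Type*} [Field k] {G : Type*} [AddCommGroup G] [DecidableEq G] {𝔾 : GradingDatum G}
  {Ob : Type*} {H : Ob → Ob → Type*} [∀ X Y, AddCommGroup (H X Y)] [∀ X Y, Module k (H X Y)]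
  (C : PreCat k 𝔾 H) {V : Type*} [AddCommGroup V] [Module k V]
  {P : Type*} [Fintype P] {T : ToricDatum 𝔾 P} {X Y : Ob}

/-! ### Signs -/

theorem gr_induction {p : H X Y → Prop} (hmem : ∀ g, ∀ a ∈ C.gr X Y g, p a)
    (hadd : ∀ a b, p a → p b → p (a + b)) (a : H X Y) : p a := by
  have ha : a ∈ ⨆ g, C.gr X Y g := by
    rw [(C.internal X Y).submodule_iSup_eq_top]
    exact Submodule.mem_top
  exact Submodule.iSup_induction _ (motive := p) ha hmem (hmem 0 0 (zero_mem _)) hadd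

theorem shiftSign_of_mem {g : G} {a : H X Y} (ha : a ∈ C.gr X Y g) :
    C.shiftSign X Y a = koszul (𝔾.σ g + 1) • a := by
  have h : (LinearEquiv.ofBijective (DirectSum.coeLinearMap (C.gr X Y)) (C.internal X Y)).symm a =
      DirectSum.lof k G (fun g => C.gr X Y g) g ⟨a, ha⟩ := by
    refine (LinearEquiv.symm_apply_eq _).2 ?_
    exact (DirectSum.coeLinearMap_lof (C.gr X Y) g ⟨a, ha⟩).symm
  rw [shiftSign, LinearMap.comp_apply, LinearEquiv.coe_coe, h, DirectSum.toModule_lof]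
  rfl

theorem sgn_one_of_mem {g : G} {a : H X Y} (ha : a ∈ C.gr X Y g) :
    C.sgn 1 X Y a = koszul (𝔾.σ g + 1) • a := by rw [sgn_one, C.shiftSign_of_mem ha]

theorem sgn_sgn (a : H X Y) : C.sgn 1 X Y (C.sgn 1 X Y a) = a := by
  refine C.gr_induction (p := fun a => C.sgn 1 X Y (C.sgn 1 X Y a) = a) (fun g a ha => ?_)
    (fun a b ha hb => ?_) a
  · rw [C.sgn_one_of_mem ha, map_zsmul, C.sgn_one_of_mem ha, smul_smul, koszul_mul_self, one_smul]
  · rw [map_add, map_add, ha, hb]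

theorem sgn_mem (ε : ZMod 2) {g : G} {a : H X Y} (ha : a ∈ C.gr X Y g) :
    C.sgn ε X Y a ∈ C.gr X Y g := by
  rcases ZMod.two_cases ε with rfl | rfl
  · rwa [sgn_zero]
  · rw [C.sgn_one_of_mem ha]
    exact zsmul_mem ha _

theorem Homog.append {C : PreCat k 𝔾 H} {X Y Z : Ob} {c : MorChain H X Y} {d : MorChain H Y Z}
    {t t' : G} (hc : C.Homog c t) (hd : C.Homog d t') : C.Homog (c.append d) (t + t') := by
  induction hc with
  | nil X => rwa [zero_add]
  | cons a c g t ha _ ih =>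
    rw [add_assoc]
    exact Homog.cons a _ g _ ha (ih hd)

theorem Homog.of_append {C : PreCat k 𝔾 H} {X Y Z : Ob} {c : MorChain H X Y} {d : MorChain H Y Z}
    {t : G} (h : C.Homog (c.append d) t) :
    ∃ t₁ t₂, C.Homog c t₁ ∧ C.Homog d t₂ ∧ t₁ + t₂ = t := by
  induction c generalizing t with
  | nil X => exact ⟨0, t, Homog.nil X, h, zero_add t⟩
  | cons a c ih =>
    rw [cons_append] at h
    cases h with
    | cons _ _ g t ha hc =>
      obtain ⟨t₁, t₂, h₁, h₂, rfl⟩ := ih hc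
      exact ⟨_, t₂, Homog.cons a c g t₁ ha h₁, h₂, add_assoc _ _ _⟩

theorem Homog.sign {C : PreCat k 𝔾 H} (ε : ZMod 2) {c : MorChain H X Y} {t : G}
    (h : C.Homog c t) : C.Homog (C.sign ε c) t := by
  induction h with
  | nil X =>
    rw [sign_nil]
    exact Homog.nil X
  | cons a c g t ha _ ih =>
    rw [sign_cons]
    exact Homog.cons _ _ g t (C.sgn_mem ε ha) ih

theorem multilinear_of_mem {y : G} {φ : Cochain H} (hφ : φ ∈ C.CC y) (X Y : Ob) :
    Multilinear k (φ X Y) := fun c c' => hφ.1 c c'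

/-- The sign operator on all entries measures the total shifted parity, which a cochain of degree y
changes by the parity of y. -/
theorem cochain_sign {y : G} {φ : Cochain H} (hφ : φ ∈ C.CC y) (c : MorChain H X Y) :
    φ X Y (C.sign 1 c) = koszul (𝔾.σ y) • C.sgn 1 X Y (φ X Y c) := by
  -- The prefix p collects homogeneous entries whose signs have already been extracted; linearity
  -- reduces each new entry to the homogeneous case.
  suffices h : ∀ (Z : Ob) (c : MorChain H Z Y) (p : MorChain H X Z) (t : G), C.Homog p t →
      koszul (𝔾.σ t) • φ X Y (p.append (C.sign 1 c)) =
        koszul (𝔾.σ y) • C.sgn 1 X Y (φ X Y (p.append c)) by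
    have h1 := h X c (nil X) 0 (Homog.nil X)
    rwa [map_zero, koszul_zero, one_smul, nil_append, nil_append] at h1
  clear c
  intro Z c
  induction c with
  | nil Z =>
    intro p t hp
    rw [sign_nil, append_nil, C.sgn_one_of_mem (hφ.2 p t hp), smul_smul, ← koszul_add]
    congr 2
    rw [map_add, map_add, 𝔾.σ_ι_one, add_assoc _ (1 : ZMod 2) 1, CharTwo.add_self_eq_zero, add_zero,
      add_comm (𝔾.σ t), ← add_assoc, CharTwo.add_self_eq_zero, zero_add]
  | @cons X₁ Y₁ Z₁ a c ih =>
    intro p t hp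
    rw [sign_cons]
    refine C.gr_induction (p := fun a : H X₁ Y₁ => koszul (𝔾.σ t) •
      φ X Z₁ (p.append (cons (C.sgn 1 X₁ Y₁ a) (C.sign 1 c))) =
        koszul (𝔾.σ y) • C.sgn 1 X Z₁ (φ X Z₁ (p.append (cons a c)))) (fun g a ha => ?_)
      (fun a b ha hb => ?_) a
    · have h1 := ih (p.append (cons a (nil _))) (t + (g - 𝔾.ι 1 + 0))
        (hp.append (Homog.cons a _ g 0 ha (Homog.nil _)))
      rw [append_assoc, append_assoc, cons_append, cons_append, nil_append, nil_append, add_zero,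
        map_add, map_sub, 𝔾.σ_ι_one, CharTwo.sub_eq_add, koszul_add, mul_smul] at h1
      have h2 : φ _ _ (p.append (cons (koszul (𝔾.σ g + 1) • a) (C.sign 1 c))) =
          koszul (𝔾.σ g + 1) • φ _ _ (p.append (cons a (C.sign 1 c))) :=
        map_zsmul ((hφ.1 p (C.sign 1 c)).mk' _) _ _
      rw [C.sgn_one_of_mem ha, h2, h1]
    · simp only [map_add, (hφ.1 p _).map_add, smul_add, ha, hb]

theorem cochain_sign_odd {y : G} (hy : 𝔾.σ y = 1) {φ : Cochain H} (hφ : φ ∈ C.CC y)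
    (c : MorChain H X Y) : φ X Y (C.sign 1 c) = -C.sgn 1 X Y (φ X Y c) := by
  rw [C.cochain_sign hφ, hy, koszul_one, neg_one_smul]

theorem cochain_sign_even {y : G} (hy : 𝔾.σ y = 0) {φ : Cochain H} (hφ : φ ∈ C.CC y)
    (c : MorChain H X Y) : φ X Y (C.sign 1 c) = C.sgn 1 X Y (φ X Y c) := by
  rw [C.cochain_sign hφ, hy, koszul_zero, one_smul]

/-! ### Two insertions -/

/-- The sum over the insertions of `χ` and, to the right of it, of `χ'`, both odd. -/
noncomputable def insIns (χ χ' : Cochain H) (φ : MorChain H X Y → V) (c : MorChain H X Y) : V :=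
  c.sumSplits fun _ p r => r.sumSplits fun _ d e =>
    C.ins 1 χ' (fun c' => φ (p.append (cons (C.sgn 1 _ _ (χ _ _ d)) c'))) e

theorem insIns_nil (χ χ' : Cochain H) (φ : MorChain H X X → V) :
    C.insIns χ χ' φ (nil X) =
      C.ins 1 χ' (fun c' => φ (cons (C.sgn 1 _ _ (χ _ _ (nil X))) c')) (nil X) := by
  rw [insIns, sumSplits_nil, sumSplits_nil]
  rfl

theorem insIns_cons (χ χ' : Cochain H) {Z : Ob} (φ : MorChain H X Y → V) (a : H X Z)
    (c : MorChain H Z Y) : C.insIns χ χ' φ (cons a c) =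
      ((cons a c).sumSplits fun _ d e =>
        C.ins 1 χ' (fun c' => φ (cons (C.sgn 1 _ _ (χ _ _ d)) c')) e) +
      C.insIns χ χ' (fun c => φ (cons a c)) c := by
  rw [insIns, sumSplits_cons]
  rfl

/-- Two odd insertions are either nested, giving the Gerstenhaber product, or disjoint. Disjoint
ones occur in both orders with opposite signs, so they cancel after symmetrising. -/
theorem ins_ins {χ χ' : Cochain H} (hχ : ∀ X Y c, χ X Y (C.sign 1 c) = -C.sgn 1 X Y (χ X Y c))
    {φ : MorChain H X Y → V} (hφ : Multilinear k φ) (c : MorChain H X Y) :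
    C.ins 1 χ' (C.ins 1 χ φ) c =
      C.ins 0 (C.circ 1 χ χ') φ c - C.insIns χ χ' φ c + C.insIns χ' χ φ c := by
  -- Here χ acts on an initial segment d. The coderivation rule places χ' inside d or to the right
  -- of it; in the latter case moving the sign through the odd χ costs a minus.
  have h1 : ∀ {X} {φ : MorChain H X Y → V}, Multilinear k φ → ∀ c : MorChain H X Y,
      C.ins 1 χ' (fun c => c.sumSplits fun _ d e => φ (cons (χ _ _ d) e)) c =
        (c.sumSplits fun _ d e => φ (cons (C.circ 1 χ χ' _ _ d) e)) -
          c.sumSplits fun _ d e => C.ins 1 χ' (fun c' => φ (cons (C.sgn 1 _ _ (χ _ _ d)) c')) e := by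
    intro X φ hφ c
    rw [ins_sumSplits, eq_sub_iff_add_eq, ← sumSplits_add]
    refine sumSplits_congr fun Z d e _ => ?_
    have h2 := C.ins_map (((hφ.head e).mk' _).toAddMonoidHom) 1 χ' (χ X Z) d
    have h3 := (C.insHead hφ 1 χ' e).map_neg (C.sgn 1 _ _ (χ X Z d))
    rw [hχ]
    refine (congrArg₂ (· + ·) (congrArg₂ (· + ·) h2 h3) rfl).trans ?_
    exact neg_add_cancel_right _ _
  induction c with
  | nil X =>
    rw [ins_nil, ins_cons, insIns_nil, insIns_nil, ← C.ins_nil 1 χ'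
      (fun c => c.sumSplits fun _ d e => φ (cons (χ _ _ d) e)), h1 hφ, sumSplits_nil,
      sumSplits_nil, C.ins_nil 1 χ', C.ins_nil 0]
  | cons a c ih =>
    rw [ins_cons]
    -- When both odd operators act to the right of a, its sign is applied twice and disappears;
    -- accordingly the composite is inserted with parity 0.
    simp only [C.ins_cons 1 χ φ, sumSplits_add, ins_add, sgn_sgn]
    rw [ih (hφ.cons a) h1]
    have h2 := (C.ins_cons 1 χ' (fun c => c.sumSplits fun _ d e => φ (cons (χ _ _ d) e)) a c).symm
    rw [add_add_add_comm, h2, h1 hφ, ins_cons, insIns_cons, insIns_cons]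
    simp only [sgn_zero]
    abel

/-- Inserting, as a linear function of the inserted cochain. -/
noncomputable def insCochain {φ : MorChain H X Y → V} (hφ : Multilinear k φ) (ε : ZMod 2)
    (c : MorChain H X Y) : Cochain H →ₗ[k] V where
  toFun χ := C.ins ε χ φ c
  map_add' χ χ' := by
    simp only [ins, Pi.add_apply, (hφ _ _).map_add, sumSplits_add]
  map_smul' r χ := by
    simp only [ins, Pi.smul_apply, (hφ _ _).map_smul, RingHom.id_apply]
    have h : ∀ {X Z : Ob} (c : MorChain H X Z) (g : ∀ W, MorChain H X W → MorChain H W Z → V),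
        (c.sumSplits fun W s t => r • g W s t) = r • c.sumSplits g := fun c g =>
      sumSplits_map (LinearMap.lsmul k V r).toAddMonoidHom c g
    simp only [h]

variable {F α β : T.monoid → Cochain H}

theorem sum_ins_ins (hβ : ∀ v X Y c, β v X Y (C.sign 1 c) = -C.sgn 1 X Y (β v X Y c))
    (hβm : ∀ u, ∑ v ∈ antidiagonal u, C.circ 1 (β v.1) (β v.2) = 0)
    {φ : MorChain H X Y → V} (hφ : Multilinear k φ) (u : T.monoid) (c : MorChain H X Y) :
    ∑ v ∈ antidiagonal u, C.ins 1 (β v.1) (C.ins 1 (β v.2) φ) c = 0 := by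
  rw [sum_antidiagonal_swap fun a b => C.ins 1 (β a) (C.ins 1 (β b) φ) c]
  simp only [C.ins_ins (hβ _) hφ]
  rw [Finset.sum_add_distrib, Finset.sum_sub_distrib,
    sum_antidiagonal_swap fun a b => C.insIns (β b) (β a) φ c, sub_add_cancel]
  have h := map_sum (C.insCochain hφ 0 c) (fun v : T.monoid × T.monoid => C.circ 1 (β v.1) (β v.2))
    (antidiagonal u)
  rw [hβm, map_zero] at h
  exact h.symm

/-- With K = αF̂ - Fβ̂, one has α(α̂F̂ - F̂β̂) + Kβ̂ = αα̂F̂ - Fβ̂β̂ = 0. As K vanishes below u,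
only the terms with α_0, β_0 and K_u survive at u. -/
theorem curv_cocycle (hF : F 0 = idCochain H)
    (hFs : ∀ v X Y c, F v X Y (C.sign 1 c) = C.sgn 1 X Y (F v X Y c))
    (hFl : ∀ v X Y, Multilinear k (F v X Y)) (hαl : ∀ v X Y, Multilinear k (α v X Y))
    (hβ : ∀ v X Y c, β v X Y (C.sign 1 c) = -C.sgn 1 X Y (β v X Y c))
    (hαm : ∀ u, ∑ v ∈ antidiagonal u, C.circ 1 (α v.1) (α v.2) = 0)
    (hβm : ∀ u, ∑ v ∈ antidiagonal u, C.circ 1 (β v.1) (β v.2) = 0) {u : T.monoid}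
    (h : ∀ v, ToricDatum.SDvd v u → C.curv F α β v = 0) :
    C.circ 1 (α 0) (C.curv F α β u) + C.circ 1 (C.curv F α β u) (β 0) = 0 := by
  funext X Y c
  have h1 : ∑ y ∈ antidiagonal u, C.defect F α β (α y.1 X Y) y.2 c =
      C.ins 1 (C.curv F α β u) (α 0 X Y) c := by
    rw [Finset.sum_eq_single (0, u)]
    · exact C.defect_eq_ins hF hFs h (Or.inl rfl) (hαl 0 X Y) c
    · rintro ⟨a, b⟩ hx hne
      have hab := mem_antidiagonal.1 hx
      have hb : ToricDatum.SDvd b u := ToricDatum.SDvd.of_add' hab (by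
        rintro rfl
        rw [zero_add] at hab
        exact hne (by rw [← hab]))
      rw [C.defect_eq_ins hF hFs h (Or.inr hb) (hαl a X Y) c, h b hb]
      exact C.ins_cochain_zero 1 (hαl a X Y) c
    · exact fun hn => absurd (mem_antidiagonal.2 (zero_add u)) hn
  have h2 : ∑ y ∈ antidiagonal u, ∑ x ∈ antidiagonal y.2,
      pull F (C.ins 1 (α x.1) (α y.1 X Y)) x.2 c = 0 := by
    rw [sum_antidiagonal_assoc fun a b d => pull F (C.ins 1 (α b) (α a X Y)) d c]
    refine Finset.sum_eq_zero fun z _ => ?_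
    rw [← pull_finsetSum]
    have h3 : (fun c => ∑ i ∈ antidiagonal z.1, C.ins 1 (α i.2) (α i.1 X Y) c) = fun _ => 0 := by
      funext c
      have := congrFun (congrFun (congrFun (hαm z.1) X) Y) c
      simp only [Finset.sum_apply] at this
      exact this
    rw [h3, pull_zero]
  -- Replacing αF̂ by K + Fβ̂ leaves Kβ̂, because the remaining term contains β̂β̂ = 0.
  have h3 : ∑ y ∈ antidiagonal u, ∑ x ∈ antidiagonal y.2,
      C.ins 1 (β x.1) (pull F (α y.1 X Y) x.2) c = C.ins 1 (β 0) (C.curv F α β u X Y) c := by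
    rw [sum_antidiagonal_left_comm fun a b d => C.ins 1 (β b) (pull F (α a X Y) d) c]
    have h4 : ∀ x ∈ antidiagonal u, ∑ y ∈ antidiagonal x.2,
        C.ins 1 (β x.1) (pull F (α y.1 X Y) y.2) c = C.ins 1 (β x.1) (C.curv F α β x.2 X Y) c +
          ∑ y ∈ antidiagonal x.2, C.ins 1 (β x.1) (C.ins 1 (β y.1) (F y.2 X Y)) c := by
      intro x _
      rw [← ins_finsetSum, ← ins_finsetSum, ← ins_add]
      refine congrArg (fun ψ => C.ins 1 (β x.1) ψ c) (funext fun e => ?_)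
      rw [curv, Finset.sum_sub_distrib, sub_add_cancel]
    have h5 : ∑ z ∈ antidiagonal u, ∑ y ∈ antidiagonal z.1,
        C.ins 1 (β y.1) (C.ins 1 (β y.2) (F z.2 X Y)) c = 0 :=
      Finset.sum_eq_zero fun z _ => C.sum_ins_ins hβ hβm (hFl z.2 X Y) z.1 c
    rw [Finset.sum_congr rfl h4, Finset.sum_add_distrib,
      sum_antidiagonal_assoc fun a b d => C.ins 1 (β a) (C.ins 1 (β b) (F d X Y)) c,
      h5, add_zero,
      Finset.sum_eq_single (0, u)]
    · rintro ⟨a, b⟩ hx hne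
      have hab := mem_antidiagonal.1 hx
      have hb : ToricDatum.SDvd b u := ToricDatum.SDvd.of_add' hab (by
        rintro rfl
        rw [zero_add] at hab
        exact hne (by rw [← hab]))
      rw [h b hb]
      exact C.ins_zero 1 _ c
    · exact fun hn => absurd (mem_antidiagonal.2 (zero_add u)) hn
  simp only [defect, Finset.sum_sub_distrib] at h1
  rw [h2, h3, zero_sub] at h1
  change C.ins 1 (C.curv F α β u) (α 0 X Y) c + C.ins 1 (β 0) (C.curv F α β u X Y) c = 0
  rw [← h1, neg_add_cancel]

end PreCat

/-! ### Multilinearity and supports of pullbacks -/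

namespace MorChain

variable {k : Type*} [Field k] {Ob : Type*} {H : Ob → Ob → Type*} {V : Type*} [AddCommGroup V]
  [Module k V] {E : Type*} [AddCommGroup E] [Module k E] {X Y : Ob}

theorem isLinearMap_sumSplits {c : MorChain H X Y}
    {g : E → ∀ Z, MorChain H X Z → MorChain H Z Y → V}
    (h : ∀ Z s t, s.append t = c → IsLinearMap k fun a => g a Z s t) :
    IsLinearMap k fun a => c.sumSplits (g a) where
  map_add a b := by
    rw [← sumSplits_add]
    exact sumSplits_congr fun Z s t hc => (h Z s t hc).map_add a b
  map_smul r a := by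
    refine Eq.trans ?_ (sumSplits_map (LinearMap.lsmul k V r).toAddMonoidHom c (g a))
    exact sumSplits_congr fun Z s t hc => (h Z s t hc).map_smul r a

theorem isLinearMap_finsetSum {ι : Type*} {s : Finset ι} {g : ι → E → V}
    (h : ∀ i ∈ s, IsLinearMap k (g i)) : IsLinearMap k fun a => ∑ i ∈ s, g i a where
  map_add a b := by
    rw [← Finset.sum_add_distrib]
    exact Finset.sum_congr rfl fun i hi => (h i hi).map_add a b
  map_smul r a := by
    rw [Finset.smul_sum]
    exact Finset.sum_congr rfl fun i hi => (h i hi).map_smul r a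

theorem isLinearMap_add {f g : E → V} (hf : IsLinearMap k f) (hg : IsLinearMap k g) :
    IsLinearMap k fun a => f a + g a := (hf.mk' f + hg.mk' g).isLinear

theorem isLinearMap_comp {D : Type*} [AddCommGroup D] [Module k D] (f : E →ₗ[k] V) {g : D → E}
    (hg : IsLinearMap k g) : IsLinearMap k fun a => f (g a) := (f ∘ₗ hg.mk' g).isLinear

theorem isLinearMap_zero : IsLinearMap k fun _ : E => (0 : V) := (0 : E →ₗ[k] V).isLinear

variable [∀ X Y, AddCommGroup (H X Y)] [∀ X Y, Module k (H X Y)]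
  {G : Type*} [AddCommGroup G] {𝔾 : GradingDatum G}
  {P : Type*} [Fintype P] {T : ToricDatum 𝔾 P} {F : T.monoid → Cochain H}

/-- The varying entry lies either beyond the first part, where induction applies, or inside it,
where F and then φ are linear. -/
theorem Multilinear.pull (hF : F 0 = idCochain H) (hFl : ∀ v X Y, Multilinear k (F v X Y))
    {φ : MorChain H X Y → V} (hφ : Multilinear k φ) (u : T.monoid) :
    Multilinear k (pull F φ u) := by
  intro Z W c c'
  suffices h : ∀ (u : T.monoid) (n : ℕ) (X : Ob) (φ : MorChain H X Y → V), Multilinear k φ →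
      ∀ c : MorChain H X Z, c.length + c'.length + 1 = n →
      IsLinearMap k fun a : H Z W => MorChain.pull F φ u (c.append (.cons a c')) from
    h u _ X φ hφ c rfl
  intro u n
  induction u, n using ToricDatum.sdvd_lex_induction with
  | _ u n ih =>
    rintro X φ hφ c rfl
    have h1 : ∀ a : H Z W, (c.append (.cons a c')).length = c.length + c'.length + 1 := fun a => by
      rw [length_append, length_cons, add_assoc]
    have h2 : ∀ a : H Z W, MorChain.pull F φ u (c.append (.cons a c')) = ∑ x ∈ antidiagonal u,
        ((c.sumSplits fun _ s t => MorChain.pull F (fun e => φ (.cons (F x.1 _ _ s) e)) x.2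
            (t.append (.cons a c'))) +
          c'.sumSplits fun _ s t => MorChain.pull F
            (fun e => φ (.cons (F x.1 _ _ (c.append (.cons a s))) e)) x.2 t) := fun a => by
      rw [pull_eq' hF hφ, if_neg (fun h => by rw [h1] at h; exact Nat.succ_ne_zero _ h.2), zero_add]
      exact Finset.sum_congr rfl fun x _ => sumSplits_append_cons _ _ _ _
    simp only [h2]
    refine isLinearMap_finsetSum fun x hx => isLinearMap_add
      (isLinearMap_sumSplits fun U s t hst => ?_) (isLinearMap_sumSplits fun U s t hst => ?_)
    · by_cases h0 : x.1 = 0 ∧ s.length = 0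
      · rw [h0.1, hF, idCochain_eq_zero (by rw [h0.2]; exact Nat.zero_ne_one)]
        simp only [pull_head_zero hφ]
        exact isLinearMap_zero
      · have hlt := ToricDatum.lex_lt_of_split hx (s := s) (t := t.append (.cons (0 : H Z W) c'))
          (c := c.append (.cons 0 c')) (by rw [← append_assoc, hst]) fun h3 h4 => h0 ⟨h3, h4⟩
        rw [h1, length_append, length_cons, ← add_assoc] at hlt
        exact ih _ _ hlt _ _ (hφ.cons _) t rfl
    · exact isLinearMap_comp (hφ.pullHead F x.2 t) (hFl x.1 X U c s)

/-- If the total weight is outside S, some part has weight outside S, where F vanishes. -/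
theorem pull_eq_zero_of_notMem (hF : F 0 = idCochain H) {S : AddSubmonoid T.monoid}
    (hS : ∀ v, F v ≠ 0 → v ∈ S) {φ : MorChain H X Y → V} (hφ : Multilinear k φ) {u : T.monoid}
    (hu : u ∉ S) (c : MorChain H X Y) : pull F φ u c = 0 := by
  suffices h : ∀ (u : T.monoid) (n : ℕ), u ∉ S → ∀ (X : Ob) (φ : MorChain H X Y → V),
      Multilinear k φ → ∀ c : MorChain H X Y, c.length = n → pull F φ u c = 0 from
    h u _ hu X φ hφ c rfl
  intro u n
  induction u, n using ToricDatum.sdvd_lex_induction with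
  | _ u n ih =>
    rintro hu X φ hφ c rfl
    rw [pull_eq' hF hφ, if_neg (fun h : u = 0 ∧ c.length = 0 => hu (h.1 ▸ S.zero_mem)), zero_add]
    refine wsum_eq_zero fun v w Z s t hvw hst => ?_
    by_cases h0 : v = 0 ∧ s.length = 0
    · rw [h0.1, hF, idCochain_eq_zero (by rw [h0.2]; exact Nat.zero_ne_one), pull_head_zero hφ]
    by_cases hv : v ∈ S
    · exact ih w t.length (ToricDatum.lex_lt_of_split (x := (v, w)) (mem_antidiagonal.2 hvw) hst
        fun h1 h2 => h0 ⟨h1, h2⟩) (fun hw => hu (hvw ▸ S.add_mem hv hw)) _ _ (hφ.cons _) t rfl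
    · rw [not_not.1 (mt (hS v) hv)]
      exact pull_head_zero hφ w t

end MorChain

/-! ### Degrees of insertions and pullbacks; linearisation of the curvature -/

namespace PreCat

open MorChain

variable {k : Type*} [Field k] {G : Type*} [AddCommGroup G] [DecidableEq G] {𝔾 : GradingDatum G}
  {Ob : Type*} {H : Ob → Ob → Type*} [∀ X Y, AddCommGroup (H X Y)] [∀ X Y, Module k (H X Y)]
  (C : PreCat k 𝔾 H) {V : Type*} [AddCommGroup V] [Module k V]
  {P : Type*} [Fintype P] {T : ToricDatum 𝔾 P} {X Y : Ob}

theorem multilinear_ins (ε : ZMod 2) {χ : Cochain H} (hχ : ∀ X Y, Multilinear k (χ X Y))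
    {φ : MorChain H X Y → V} (hφ : Multilinear k φ) : Multilinear k (C.ins ε χ φ) := by
  intro Z W c c'
  simp only [ins, sumSplits_append_cons, sign_append, sign_cons, append_assoc, cons_append]
  refine isLinearMap_add (isLinearMap_sumSplits fun U s t _ => isLinearMap_add
    (isLinearMap_sumSplits fun U' d e _ => ?_) (isLinearMap_sumSplits fun U' d e _ => ?_))
    (isLinearMap_sumSplits fun U s t _ => isLinearMap_sumSplits fun U' d e _ => ?_)
  · have h := hφ ((C.sign ε s).append (.cons (χ _ _ d) e)) c'
    simpa only [append_assoc, cons_append] using h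
  · exact isLinearMap_comp ((hφ (C.sign ε s) e).mk' _) (hχ _ _ t d)
  · exact isLinearMap_comp ((hφ (C.sign ε c) ((C.sign ε s).append (.cons (χ _ _ d) e))).mk' _)
      (C.sgn ε Z W).isLinear

/-- `φ` has degree `y`, for the shifted gradings on the morphism spaces. -/
def HasDegree (gr : G → Submodule k V) (y : G) (φ : MorChain H X Y → V) : Prop :=
  ∀ c t, C.Homog c t → φ c ∈ gr (t + y)

variable {C}

theorem hasDegree_of_mem {y : G} {φ : Cochain H} (hφ : φ ∈ C.CC y) (X Y : Ob) :
    C.HasDegree (C.gr X Y) (y + 𝔾.ι 1) (φ X Y) := fun c t hc => by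
  rw [← add_assoc]
  exact hφ.2 c t hc

theorem mem_CC {y : G} {φ : Cochain H} (h : ∀ X Y, Multilinear k (φ X Y))
    (h' : ∀ X Y, C.HasDegree (C.gr X Y) (y + 𝔾.ι 1) (φ X Y)) : φ ∈ C.CC y :=
  ⟨fun c c' => h _ _ c c', fun c t hc => by
    rw [add_assoc]
    exact h' _ _ c t hc⟩

theorem HasDegree.ins {gr : G → Submodule k V} {y y' : G} {φ : MorChain H X Y → V}
    (hφ : C.HasDegree gr y φ) (ε : ZMod 2) {χ : Cochain H} (hχ : χ ∈ C.CC y') :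
    C.HasDegree gr (y + y') (C.ins ε χ φ) := by
  intro c τ hc
  refine sumSplits_mem _ fun Z s r hs => sumSplits_mem _ fun W d e hd => ?_
  subst hs hd
  obtain ⟨t₁, t, h₁, ht, rfl⟩ := hc.of_append
  obtain ⟨t₂, t₃, h₂, h₃, rfl⟩ := ht.of_append
  have h := hφ _ _ ((h₁.sign ε).append (Homog.cons _ e _ t₃ (hχ.2 d t₂ h₂) h₃))
  have e1 : t₁ + (t₂ + y' + 𝔾.ι 1 - 𝔾.ι 1 + t₃) + y = t₁ + (t₂ + t₃) + (y + y') := by abel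
  rwa [e1] at h

theorem HasDegree.pull {gr : G → Submodule k V} {y : G} {φ : MorChain H X Y → V}
    (hφ : C.HasDegree gr y φ) {F : T.monoid → Cochain H} (hF : ∀ v : T.monoid, F v ∈ C.CC (0 - T.f v))
    (u : T.monoid) : C.HasDegree gr (y - T.f u) (pull F φ u) := by
  intro c τ hc
  suffices h : ∀ (u : T.monoid) (n : ℕ) (X : Ob) (φ : MorChain H X Y → V) (y : G),
      C.HasDegree gr y φ → ∀ (c : MorChain H X Y) (τ : G), C.Homog c τ → c.length = n →
      MorChain.pull F φ u c ∈ gr (τ + (y - T.f u)) from h u _ X φ y hφ c τ hc rfl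
  intro u n
  induction u, n using ToricDatum.sdvd_lex_induction with
  | _ u n ih =>
    rintro X φ y hφ c τ hc rfl
    rw [pull_eq]
    refine add_mem ?_ (Submodule.sum_mem _ fun x hx => sumSplits_mem _ fun Z s t hst => ?_)
    · split_ifs with h
      · rw [h.1]
        simpa using hφ c τ hc
      · exact zero_mem _
    · dsimp only
      split_ifs with h
      · have hlt := ToricDatum.lex_lt_of_split hx hst fun h0 => by rw [h h0]; exact one_ne_zero
        subst hst
        obtain ⟨t₁, t₂, h₁, h₂, rfl⟩ := hc.of_append
        -- Fixing the first entry F(s) shifts the degree of φ by the shifted degree of F(s); this is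
        -- why y varies in the induction.
        have h3 := ih _ _ hlt _ (fun e => φ (.cons (F x.1 _ _ s) e))
          (y + (t₁ + (0 - T.f x.1))) (fun e t he => by
            have h4 := hφ _ _ (Homog.cons _ e _ t ((hF x.1).2 s t₁ h₁) he)
            have e1 : t₁ + (0 - T.f x.1) + 𝔾.ι 1 - 𝔾.ι 1 + t + y =
              t + (y + (t₁ + (0 - T.f x.1))) := by abel
            rwa [e1] at h4) t t₂ h₂ rfl
        have e2 : t₂ + (y + (t₁ + (0 - T.f x.1)) - T.f x.2) = t₁ + t₂ + (y - T.f u) := by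
          rw [← mem_antidiagonal.1 hx, AddSubmonoid.coe_add, map_add]
          abel
        rwa [e2] at h3
      · exact zero_mem _

theorem circ_mem (ε : ZMod 2) {y y' : G} {φ χ : Cochain H} (hφ : φ ∈ C.CC y) (hχ : χ ∈ C.CC y') :
    C.circ ε φ χ ∈ C.CC (y + y') := by
  refine mem_CC (fun X Y => C.multilinear_ins ε (C.multilinear_of_mem hχ)
    (C.multilinear_of_mem hφ X Y)) fun X Y => ?_
  have h := (hasDegree_of_mem hφ X Y).ins ε hχ
  rwa [add_right_comm] at h

theorem curv_mem {F α β : T.monoid → Cochain H} (hF0 : F 0 = idCochain H)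
    (hF : ∀ v : T.monoid, F v ∈ C.CC (0 - T.f v)) (hα : ∀ v : T.monoid, α v ∈ C.CC (𝔾.ι 1 - T.f v))
    (hβ : ∀ v : T.monoid, β v ∈ C.CC (𝔾.ι 1 - T.f v)) (u : T.monoid) :
    C.curv F α β u ∈ C.CC (𝔾.ι 1 - T.f u) := by
  have h : C.curv F α β u = ∑ x ∈ antidiagonal u,
      ((fun X Y c => pull F (α x.1 X Y) x.2 c) - C.circ 1 (F x.2) (β x.1)) := by
    funext X Y c
    simp only [curv, Finset.sum_apply]
    rfl
  rw [h]
  refine Submodule.sum_mem _ fun x hx => sub_mem ?_ ?_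
  · refine mem_CC (fun X Y => Multilinear.pull hF0
      (fun v X Y => C.multilinear_of_mem (hF v) X Y) (C.multilinear_of_mem (hα x.1) X Y) x.2)
      fun X Y => ?_
    have h1 := (hasDegree_of_mem (hα x.1) X Y).pull hF x.2
    have e : 𝔾.ι 1 - T.f x.1 + 𝔾.ι 1 - T.f x.2 = 𝔾.ι 1 - T.f u + 𝔾.ι 1 := by
      rw [← mem_antidiagonal.1 hx, AddSubmonoid.coe_add, map_add]
      abel
    rwa [e] at h1
  · have h1 := circ_mem 1 (hF x.2) (hβ x.1)
    have e : 0 - T.f x.2 + (𝔾.ι 1 - T.f x.1) = 𝔾.ι 1 - T.f u := by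
      rw [← mem_antidiagonal.1 hx, AddSubmonoid.coe_add, map_add]
      abel
    rwa [e] at h1

variable (C)

theorem idCochain_mem : idCochain H ∈ C.CC 0 := by
  refine ⟨fun {X Y Z W} c c' => ?_, fun {X Y} c t hc => ?_⟩
  · by_cases h : c.length = 0 ∧ c'.length = 0
    · cases c with
      | nil =>
        cases c' with
        | nil => exact ⟨fun _ _ => rfl, fun _ _ => rfl⟩
        | cons => exact absurd h.2 (Nat.succ_ne_zero _)
      | cons => exact absurd h.1 (Nat.succ_ne_zero _)
    · have h1 : ∀ a : H Y Z, idCochain H X W (c.append (.cons a c')) = 0 := fun a =>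
        idCochain_eq_zero (by
          rw [length_append, length_cons]
          omega)
      simp only [h1]
      exact isLinearMap_zero
  · cases hc with
    | nil => exact zero_mem _
    | cons a c g t ha hc =>
      cases hc with
      | nil =>
        have e : g - 𝔾.ι 1 + 0 + 0 + 𝔾.ι 1 = g := by abel
        rw [e]
        exact ha
      | cons => exact zero_mem _

/-! ### Dependence of the curvature on the functor -/

variable {F F' α α' β : T.monoid → Cochain H}

/-- If F and F' agree below u, their difference at u uses F_u - F'_u exactly once and identities
elsewhere: it is an insertion, with parity 0. -/
theorem pull_sub_pull (hF : F 0 = idCochain H) (hF' : F' 0 = idCochain H) {u : T.monoid}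
    (h : ∀ v, ToricDatum.SDvd v u → F v = F' v) {v : T.monoid}
    (hv : v = u ∨ ToricDatum.SDvd v u) {φ : MorChain H X Y → V} (hφ : Multilinear k φ)
    (c : MorChain H X Y) : pull F φ v c - pull F' φ v c = C.ins 0 (F v - F' v) φ c := by
  suffices key : ∀ (v : T.monoid) (n : ℕ), (v = u ∨ ToricDatum.SDvd v u) →
      ∀ (X : Ob) (φ : MorChain H X Y → V), Multilinear k φ → ∀ c : MorChain H X Y, c.length = n →
      pull F φ v c - pull F' φ v c = C.ins 0 (F v - F' v) φ c from key v _ hv X φ hφ c rfl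
  intro v n
  induction v, n using ToricDatum.sdvd_lex_induction with
  | _ v n ih =>
    rintro hv X φ hφ c rfl
    have hlt : ∀ {a}, ToricDatum.SDvd a v → F a - F' a = 0 := fun {a} ha =>
      sub_eq_zero.2 (h a (hv.elim (fun e => e ▸ ha) fun e => ha.trans e))
    have h1 : (wsum v c fun a b _ s t => (hφ.pullHead F b t) ((F a - F' a) _ _ s)) =
        c.sumSplits fun _ s t => φ (.cons ((F v - F' v) _ _ s) t) := by
      rw [wsum_eq_left]
      · exact sumSplits_congr fun Z s t _ => pull_weight_zero hF
          (φ := fun e => φ (.cons ((F v - F' v) _ _ s) e)) (hφ.cons _) t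
      · intro a b Z s t hab hb
        rw [hlt (ToricDatum.SDvd.of_add hab hb)]
        exact pull_head_zero hφ b t
    have h2 : (wsum v c fun a b _ s t => pull F (fun e => φ (.cons (F' a _ _ s) e)) b t -
        pull F' (fun e => φ (.cons (F' a _ _ s) e)) b t) =
        wsum v c fun a b _ s t => C.ins 0 (F b - F' b) (fun e => φ (.cons (F' a _ _ s) e)) t := by
      refine wsum_congr fun a b Z s t hab hst => ?_
      by_cases h0 : a = 0 ∧ s.length = 0
      · rw [h0.1, hF', idCochain_eq_zero (by rw [h0.2]; exact Nat.zero_ne_one),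
          pull_head_zero hφ, pull_head_zero hφ, C.ins_head_zero hφ, sub_zero]
      · have hb := ToricDatum.lex_lt_of_split (x := (a, b)) (mem_antidiagonal.2 hab) hst
          fun h1 h2 => h0 ⟨h1, h2⟩
        refine ih b t.length hb ?_ Z _ (hφ.cons _) t rfl
        rcases hb with hb | ⟨hb, -⟩
        · exact Or.inr (hv.elim (fun e => e ▸ hb) fun e => hb.trans e)
        · exact (show b = v from hb) ▸ hv
    -- Telescoping: first F is replaced by F' in the first part only, then the two pullbacks of the
    -- rest are compared.
    have h3 : pull F φ v c - pull F' φ v c =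
        (wsum v c fun a b _ s t => (hφ.pullHead F b t) ((F a - F' a) _ _ s)) +
        wsum v c fun a b _ s t => pull F (fun e => φ (.cons (F' a _ _ s) e)) b t -
          pull F' (fun e => φ (.cons (F' a _ _ s) e)) b t := by
      rw [pull_eq' hF hφ, pull_eq' hF' hφ, add_sub_add_left_eq_sub, ← wsum_sub, ← wsum_add]
      refine wsum_congr fun a b Z s t _ _ => ?_
      rw [Pi.sub_apply, Pi.sub_apply, Pi.sub_apply, map_sub]
      exact (sub_add_sub_cancel _ _ _).symm
    rw [h3, h1, h2, wsum_eq_right]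
    · rw [hF']
      cases c with
      | nil =>
        rw [sumSplits_idCochain_nil fun Z b t => C.ins 0 (F v - F' v)
          (fun e => φ (.cons b e)) t, ins_nil, sumSplits_nil, add_zero]
        exact fun Z t => C.ins_head_zero hφ 0 _ t
      | cons a c =>
        rw [sumSplits_idCochain_cons fun Z b t => C.ins 0 (F v - F' v)
          (fun e => φ (.cons b e)) t, ins_cons, sgn_zero]
        exact fun Z t => C.ins_head_zero hφ 0 _ t
    · intro a b Z s t hab ha
      rw [hlt (ToricDatum.SDvd.of_add' hab ha)]
      exact C.ins_cochain_zero 0 (hφ.cons _) t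

/-- The values F_u and α_u enter the curvature at u linearly, F_u by way of its bracket with the
constant terms of the structure maps. Everything else lives at strict divisors. -/
theorem curv_sub_curv (hF : F 0 = idCochain H) (hF' : F' 0 = idCochain H)
    (hα : ∀ v X Y, Multilinear k (α v X Y)) (hα' : ∀ v X Y, Multilinear k (α' v X Y))
    {u : T.monoid} (h : ∀ v, ToricDatum.SDvd v u → F v = F' v ∧ α v = α' v) :
    C.curv F α β u - C.curv F' α' β u = α u - α' u +
      (C.circ 0 (α' 0) (F u - F' u) - C.circ 1 (F u - F' u) (β 0)) := by
  have hsub : ∀ (χ φ φ' : Cochain H) (X Y : Ob) (c : MorChain H X Y),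
      C.ins 1 χ (φ X Y) c - C.ins 1 χ (φ' X Y) c = C.ins 1 χ ((φ - φ') X Y) c := by
    intro χ φ φ' X Y c
    rw [sub_eq_iff_eq_add, ← ins_add]
    refine congrArg (fun ψ => C.ins 1 χ ψ c) (funext fun e => ?_)
    exact (sub_add_cancel (φ X Y e) (φ' X Y e)).symm
  funext X Y c
  have h1 : ∀ x ∈ antidiagonal u,
      (pull F (α x.1 X Y) x.2 c - C.ins 1 (β x.1) (F x.2 X Y) c) -
        (pull F' (α' x.1 X Y) x.2 c - C.ins 1 (β x.1) (F' x.2 X Y) c) =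
      pull F ((α x.1 - α' x.1) X Y) x.2 c + (C.ins 0 (F x.2 - F' x.2) (α' x.1 X Y) c -
        C.ins 1 (β x.1) ((F x.2 - F' x.2) X Y) c) := by
    intro x hx
    have hx2 : x.2 = u ∨ ToricDatum.SDvd x.2 u := by
      have hx' := mem_antidiagonal.1 hx
      by_cases h0 : x.1 = 0
      · rw [h0, zero_add] at hx'
        exact Or.inl hx'
      · exact Or.inr (ToricDatum.SDvd.of_add' hx' h0)
    have h2 : pull F (α x.1 X Y) x.2 c =
        pull F ((α x.1 - α' x.1) X Y) x.2 c + pull F (α' x.1 X Y) x.2 c := by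
      rw [← pull_add]
      refine congrArg (fun ψ => pull F ψ x.2 c) (funext fun e => ?_)
      exact (sub_add_cancel (α x.1 X Y e) (α' x.1 X Y e)).symm
    rw [h2, ← C.pull_sub_pull hF hF' (fun v hv => (h v hv).1) hx2 (hα' x.1 X Y), ← hsub]
    abel
  change (∑ x ∈ antidiagonal u, (pull F (α x.1 X Y) x.2 c - C.ins 1 (β x.1) (F x.2 X Y) c)) -
    ∑ x ∈ antidiagonal u, (pull F' (α' x.1 X Y) x.2 c - C.ins 1 (β x.1) (F' x.2 X Y) c) = _
  rw [← Finset.sum_sub_distrib, Finset.sum_congr rfl h1, Finset.sum_add_distrib,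
    Finset.sum_eq_single (u, 0), Finset.sum_eq_single (0, u)]
  · congr 1
    refine pull_weight_zero hF (k := k) (fun c c' => ?_) c
    exact ((hα u X Y c c').mk' _ - (hα' u X Y c c').mk' _).isLinear
  · rintro ⟨a, b⟩ hx hne
    have hab := mem_antidiagonal.1 hx
    have hb : ToricDatum.SDvd b u := ToricDatum.SDvd.of_add' hab (by
      rintro rfl
      rw [zero_add] at hab
      exact hne (by rw [← hab]))
    rw [(h b hb).1, sub_self, C.ins_cochain_zero 0 (hα' a X Y), zero_sub]
    exact neg_eq_zero.2 (C.ins_zero 1 _ c)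
  · exact fun hn => absurd (mem_antidiagonal.2 (zero_add u)) hn
  · rintro ⟨a, b⟩ hx hne
    have hab := mem_antidiagonal.1 hx
    have ha : ToricDatum.SDvd a u := ToricDatum.SDvd.of_add hab (by
      rintro rfl
      rw [add_zero] at hab
      exact hne (by rw [← hab]))
    rw [(h a ha).2, sub_self]
    exact pull_zero F b c
  · exact fun hn => absurd (mem_antidiagonal.2 (add_zero u)) hn

theorem curv_eq_zero_of_notMem (hF : F 0 = idCochain H)
    (hαl : ∀ v X Y, Multilinear k (α v X Y)) (hFl : ∀ v X Y, Multilinear k (F v X Y))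
    {S : AddSubmonoid T.monoid} (hFS : ∀ v, F v ≠ 0 → v ∈ S) (hα : ∀ v, α v ≠ 0 → v ∈ S)
    (hβ : ∀ v, β v ≠ 0 → v ∈ S) {u : T.monoid} (hu : u ∉ S) : C.curv F α β u = 0 := by
  funext X Y c
  refine Finset.sum_eq_zero fun x hx => ?_
  have hx' := mem_antidiagonal.1 hx
  by_cases h1 : x.1 ∈ S
  · have h2 : x.2 ∉ S := fun h2 => hu (hx' ▸ S.add_mem h1 h2)
    rw [pull_eq_zero_of_notMem hF hFS (hαl x.1 X Y) h2, not_not.1 (mt (hFS x.2) h2), zero_sub]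
    exact neg_eq_zero.2 (C.ins_zero 1 _ c)
  · rw [not_not.1 (mt (hα x.1) h1), not_not.1 (mt (hβ x.1) h1),
      C.ins_cochain_zero 1 (hFl x.2 X Y), sub_zero]
    exact pull_zero F x.2 c

theorem sumSplits_idCochain_head {W : Ob} (χ : ∀ Z, MorChain H X Z → H W Z)
    (c : MorChain H X Y) : (c.sumSplits fun Z d e => idCochain H W Y (.cons (χ Z d) e)) = χ Y c := by
  induction c with
  | nil X =>
    rw [sumSplits_nil]
    rfl
  | cons a c ih =>
    rw [sumSplits_cons, ih fun Z d => χ Z (.cons a d),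
      idCochain_eq_zero (by rw [length_cons, length_cons]; omega), zero_add]

/-- The identity cochain sees only chains of length one, so χ has to consume the whole chain. -/
theorem circ_idCochain (ε : ZMod 2) (χ : Cochain H) : C.circ ε (idCochain H) χ = χ := by
  funext X Y c
  rw [circ_apply]
  cases c with
  | nil =>
    rw [ins_nil]
    rfl
  | cons a c =>
    rw [ins_cons, sumSplits_idCochain_head (χ X), C.ins_congr (φ' := fun _ => 0), ins_zero, add_zero]
    intro d hd
    rw [idCochain_eq_zero]
    rw [length_cons]
    omega

theorem curv_id (hF : F 0 = idCochain H) (hF' : ∀ v, v ≠ 0 → F v = 0)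
    (hαl : ∀ v X Y, Multilinear k (α v X Y)) (u : T.monoid) :
    C.curv F α β u = α u - β u := by
  funext X Y c
  rw [curv, Finset.sum_eq_single (u, 0)]
  · rw [pull_weight_zero hF (hαl u X Y), hF]
    have h := congrFun (congrFun (congrFun (C.circ_idCochain 1 (β u)) X) Y) c
    rw [circ_apply] at h
    rw [h]
    rfl
  · rintro ⟨a, b⟩ hx hne
    have hb : b ≠ 0 := by
      rintro rfl
      have := mem_antidiagonal.1 hx
      rw [add_zero] at this
      exact hne (by rw [← this])
    rw [pull_eq_zero_of_notMem hF (S := ⊥)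
      (fun v hv => AddSubmonoid.mem_bot.2 (by_contra fun h => hv (hF' v h))) (hαl a X Y)
      (fun h => hb (AddSubmonoid.mem_bot.1 h)), hF' b hb, zero_sub]
    exact neg_eq_zero.2 (C.ins_zero 1 _ c)
  · exact fun hn => absurd (mem_antidiagonal.2 (add_zero u)) hn

end PreCat

/-! ### Deformations of an `A_∞` category as a deformation theory -/

namespace PreCat

open MorChain

variable {k : Type*} [Field k] {G : Type*} [AddCommGroup G] [DecidableEq G] {𝔾 : GradingDatum G}
  {Ob : Type*} {H : Ob → Ob → Type*} [∀ X Y, AddCommGroup (H X Y)] [∀ X Y, Module k (H X Y)]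
  (C : PreCat k 𝔾 H)

/-- The Gerstenhaber product as a linear function of its second argument. -/
noncomputable def circLeft (ε : ZMod 2) {φ : Cochain H} (hφ : ∀ X Y, Multilinear k (φ X Y)) :
    Cochain H →ₗ[k] Cochain H where
  toFun χ := C.circ ε φ χ
  map_add' χ χ' := funext fun X => funext fun Y => funext fun c =>
    (C.insCochain (hφ X Y) ε c).map_add χ χ'
  map_smul' r χ := funext fun X => funext fun Y => funext fun c =>
    (C.insCochain (hφ X Y) ε c).map_smul r χ

/-- The Gerstenhaber product as a linear function of its first argument. -/
noncomputable def circRight (ε : ZMod 2) (χ : Cochain H) : Cochain H →ₗ[k] Cochain H where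
  toFun φ := C.circ ε φ χ
  map_add' φ φ' := funext fun X => funext fun Y => funext fun c =>
    C.ins_add ε χ (φ X Y) (φ' X Y) c
  map_smul' r φ := funext fun X => funext fun Y => funext fun c =>
    C.ins_map (LinearMap.lsmul k (H X Y) r).toAddMonoidHom ε χ (φ X Y) c

end PreCat

namespace AInfCat

open MorChain ToricDatum

variable {k : Type*} [Field k] {G : Type*} [AddCommGroup G] [DecidableEq G] {𝔾 : GradingDatum G}
  {Ob : Type*} {H : Ob → Ob → Type*} [∀ X Y, AddCommGroup (H X Y)] [∀ X Y, Module k (H X Y)]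
  {P : Type*} [Fintype P] {T : ToricDatum 𝔾 P} (A : AInfCat k 𝔾 H)

theorem multilinear_μ (X Y : Ob) : Multilinear k (A.μ X Y) := A.multilinear_of_mem A.μ_mem X Y

/-- The Hochschild differential as a linear map. -/
noncomputable def hochschildL (y : G) : Cochain H →ₗ[k] Cochain H :=
  A.circLeft (𝔾.σ y) A.multilinear_μ - koszul (𝔾.σ y) • A.circRight 1 A.μ

theorem hochschildL_apply (y : G) (φ : Cochain H) : A.hochschildL y φ =
    A.circ (𝔾.σ y) A.μ φ - koszul (𝔾.σ y) • A.circ 1 φ A.μ := rfl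

theorem hochschildL_zero_sub (u : P → ℤ) (φ : Cochain H) :
    A.hochschildL (0 - T.f u) φ = A.circ 0 A.μ φ - A.circ 1 φ A.μ := by
  rw [hochschildL_apply, T.σ_zero_sub, koszul_zero, one_smul]

theorem hochschildL_one_sub (u : P → ℤ) (φ : Cochain H) :
    A.hochschildL (𝔾.ι 1 - T.f u) φ = A.circ 1 A.μ φ + A.circ 1 φ A.μ := by
  rw [hochschildL_apply, T.σ_one_sub, koszul_one, neg_one_smul, sub_neg_eq_add]

theorem hochschildL_mem {u : P → ℤ} {φ : Cochain H} (hφ : φ ∈ A.CC (0 - T.f u)) :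
    A.hochschildL (0 - T.f u) φ ∈ A.CC (𝔾.ι 1 - T.f u) := by
  rw [hochschildL_apply]
  have h1 := PreCat.circ_mem (𝔾.σ (0 - T.f u)) A.μ_mem hφ
  have h2 := PreCat.circ_mem 1 hφ A.μ_mem
  have e1 : 𝔾.ι 1 + (0 - T.f u) = 𝔾.ι 1 - T.f u := by abel
  have e2 : 0 - T.f u + 𝔾.ι 1 = 𝔾.ι 1 - T.f u := by abel
  rw [e1] at h1
  rw [e2] at h2
  exact sub_mem h1 (zsmul_mem h2 _)

open scoped Classical in
/-- The structure maps `id + ∑ r^u x_u` of a formal functor. -/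
noncomputable def idAdd (x : T.monoid → Cochain H) : T.monoid → Cochain H :=
  fun u => (if u = 0 then idCochain H else 0) + x u

theorem idAdd_zero {x : T.monoid → Cochain H} (hx : x 0 = 0) : idAdd x 0 = idCochain H := by
  rw [idAdd, if_pos rfl, hx, add_zero]

theorem idAdd_of_ne (x : T.monoid → Cochain H) {u : T.monoid} (hu : u ≠ 0) :
    idAdd x u = x u := by rw [idAdd, if_neg hu, zero_add]

theorem total_zero {a : T.monoid → Cochain H} (ha : a 0 = 0) : A.total a 0 = A.μ := by
  rw [total, if_pos rfl, ha, add_zero]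

theorem total_of_ne (a : T.monoid → Cochain H) {u : T.monoid} (hu : u ≠ 0) :
    A.total a u = a u := by rw [total, if_neg hu, zero_add]

theorem total_sub_total (a a' : T.monoid → Cochain H) (u : T.monoid) :
    A.total a u - A.total a' u = a u - a' u := add_sub_add_left_eq_sub _ _ _

theorem idAdd_sub_idAdd (x x' : T.monoid → Cochain H) (u : T.monoid) :
    idAdd x u - idAdd x' u = x u - x' u := add_sub_add_left_eq_sub _ _ _

theorem total_congr {a a' : T.monoid → Cochain H} {u : T.monoid} (h : a u = a' u) :
    A.total a u = A.total a' u := by rw [total, h, total]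

theorem idAdd_congr {x x' : T.monoid → Cochain H} {u : T.monoid} (h : x u = x' u) :
    idAdd x u = idAdd x' u := by rw [idAdd, h, idAdd]

variable {A}

theorem idAdd_mem {x : T.monoid → Cochain H} (hx : T.IsGraded A.CC 0 x) (u : T.monoid) :
    idAdd x u ∈ A.CC (0 - T.f u) := by
  by_cases h : u = 0
  · rw [h, idAdd_zero hx.2]
    simpa using A.idCochain_mem
  · rw [idAdd_of_ne x h]
    exact hx.1 u

theorem total_mem {a : T.monoid → Cochain H} (ha : T.IsGraded A.CC (𝔾.ι 1) a) (u : T.monoid) :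
    A.total a u ∈ A.CC (𝔾.ι 1 - T.f u) := by
  by_cases h : u = 0
  · rw [h, A.total_zero ha.2]
    simpa using A.μ_mem
  · rw [A.total_of_ne a h]
    exact ha.1 u

theorem total_multilinear {a : T.monoid → Cochain H} (ha : T.IsGraded A.CC (𝔾.ι 1) a)
    (u : T.monoid) (X Y : Ob) : Multilinear k (A.total a u X Y) :=
  A.multilinear_of_mem (total_mem ha u) X Y

theorem idAdd_multilinear {x : T.monoid → Cochain H} (hx : T.IsGraded A.CC 0 x)
    (u : T.monoid) (X Y : Ob) : Multilinear k (idAdd x u X Y) :=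
  A.multilinear_of_mem (idAdd_mem hx u) X Y

/-- A rescaling fixes the constant term μ, since θ^0 = 1. -/
theorem twist_total (θ : P → (FormalSums k T.monoid)ˣ) (a : T.monoid → Cochain H) :
    A.total (twist θ a) = twist θ (A.total a) := by
  classical
  funext u
  simp only [twist, total, smul_add, Finset.sum_add_distrib]
  congr 1
  rw [Finset.sum_eq_single (0, u)]
  · rw [if_pos rfl, AddSubmonoid.coe_zero, pw_zero, Units.val_one, FormalSums.one_apply]
    by_cases h : u = 0 <;> simp [h]
  · rintro ⟨v, w⟩ hx hne
    rw [if_neg, smul_zero]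
    rintro rfl
    have := mem_antidiagonal.1 hx
    rw [zero_add] at this
    exact hne (by rw [← this])
  · exact fun hn => absurd (mem_antidiagonal.2 (zero_add u)) hn

theorem isMC_twist (θ : P → (FormalSums k T.monoid)ˣ) {a : T.monoid → Cochain H}
    (ha : T.IsGraded A.CC (𝔾.ι 1) a)
    (h : ∀ u, ∑ v ∈ antidiagonal u, A.circ 1 (A.total a v.1) (A.total a v.2) = 0) (u : T.monoid) :
    ∑ v ∈ antidiagonal u, A.circ 1 (A.total (twist θ a) v.1) (A.total (twist θ a) v.2) = 0 := by
  rw [twist_total, twist_conv θ (A.total a) (A.total a) (A.circ 1)]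
  · simp only [h, twist, smul_zero, Finset.sum_const_zero]
  · intro u v
    rw [twist]
    refine (map_sum (A.circRight 1 (twist θ (A.total a) v)) _ _).trans
      (Finset.sum_congr rfl fun i _ => ?_)
    rw [map_smul]
    have h1 : A.circRight 1 (twist θ (A.total a) v) (A.total a i.1) =
        ∑ j ∈ antidiagonal v, (pw θ j.1 : FormalSums k T.monoid) j.2 •
          A.circ 1 (A.total a i.1) (A.total a j.1) := by
      refine (map_sum (A.circLeft 1 (total_multilinear ha i.1)) _ _).trans
        (Finset.sum_congr rfl fun j _ => ?_)
      rw [map_smul]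
      rfl
    rw [h1, Finset.smul_sum]
    exact Finset.sum_congr rfl fun j _ => smul_smul _ _ _

theorem hochschildL_of_irr {a : T.monoid → Cochain H} (ha : a 0 = 0) {u : T.monoid}
    (h : ∑ v ∈ antidiagonal u, A.circ 1 (A.total a v.1) (A.total a v.2) = 0)
    (hu : u ∉ T.filt 2) : A.hochschildL (𝔾.ι 1 - T.f u) (a u) = 0 := by
  by_cases h0 : u = 0
  · rw [h0, ha, map_zero]
  rw [hochschildL_one_sub, ← A.total_of_ne a h0, ← A.total_zero ha, ← h]
  -- At an irreducible exponent only these two decompositions occur, and they give the two halves of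
  -- the Hochschild differential.
  have hne : ((0, u) : T.monoid × T.monoid) ≠ (u, 0) := fun e => h0 (congrArg Prod.snd e)
  rw [← Finset.sum_pair (f := fun v : T.monoid × T.monoid =>
    A.circ 1 (A.total a v.1) (A.total a v.2)) hne]
  refine Finset.sum_subset (fun x hx => ?_) fun x hx hn => ?_
  · rcases Finset.mem_insert.1 hx with rfl | hx
    · exact mem_antidiagonal.2 (zero_add u)
    · rw [Finset.mem_singleton.1 hx]
      exact mem_antidiagonal.2 (add_zero u)
  · refine absurd ?_ hn
    have hx' := mem_antidiagonal.1 hx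
    by_cases h1 : x.1 = 0
    · refine Finset.mem_insert.2 (Or.inl (Prod.ext h1 ?_))
      rwa [h1, zero_add] at hx'
    · have h2 := eq_of_add_of_notMem hu h1 hx'
      refine Finset.mem_insert.2 (Or.inr (Finset.mem_singleton.2 (Prod.ext ?_ h2)))
      rwa [h2, add_zero] at hx'

/-- The curvature of a formal functor, with its linear part removed. -/
noncomputable def nonlinear (A : AInfCat k 𝔾 H) (β x a : T.monoid → Cochain H) :
    T.monoid → Cochain H := fun u =>
  A.curv (idAdd x) (A.total a) (A.total β) u - A.hochschildL (0 - T.f u) (x u) - a u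

theorem add_nonlinear (β x a : T.monoid → Cochain H) (u : T.monoid) :
    A.hochschildL (0 - T.f u) (x u) + a u + A.nonlinear β x a u =
      A.curv (idAdd x) (A.total a) (A.total β) u := by
  rw [nonlinear]
  abel

/-- By `curv_sub_curv`, the change of the curvature at u is exactly the linear part that has been
subtracted. -/
theorem nonlinear_congr {β x x' a a' : T.monoid → Cochain H} {u : T.monoid}
    (hβ : T.IsGraded A.CC (𝔾.ι 1) β) (hx : T.IsGraded A.CC 0 x) (hx' : T.IsGraded A.CC 0 x')
    (ha : T.IsGraded A.CC (𝔾.ι 1) a) (ha' : T.IsGraded A.CC (𝔾.ι 1) a')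
    (h : ∀ v, SDvd v u → x v = x' v ∧ a v = a' v) :
    A.nonlinear β x a u = A.nonlinear β x' a' u := by
  have h1 := A.curv_sub_curv (β := A.total β) (idAdd_zero hx.2) (idAdd_zero hx'.2)
    (total_multilinear ha) (total_multilinear ha') fun v hv =>
      ⟨idAdd_congr (h v hv).1, A.total_congr (h v hv).2⟩
  rw [total_sub_total, idAdd_sub_idAdd, A.total_zero ha'.2, A.total_zero hβ.2,
    ← hochschildL_zero_sub (T := T) A u, map_sub] at h1
  rw [← sub_eq_zero, nonlinear, nonlinear]
  rw [sub_eq_iff_eq_add] at h1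
  rw [h1]
  abel

/-- No non-zero exponent strictly divides u, so by locality x and a may be replaced by 0; the
curvature of the identity functor is then -β_u. -/
theorem nonlinear_irr {β x a : T.monoid → Cochain H} {u : T.monoid}
    (hβ : T.IsGraded A.CC (𝔾.ι 1) β) (hx : T.IsGraded A.CC 0 x)
    (ha : T.IsGraded A.CC (𝔾.ι 1) a) (hu : u ∉ T.filt 2) : A.nonlinear β x a u = -β u := by
  have h0 : ∀ y, T.IsGraded A.CC y 0 := fun y => ⟨fun u => zero_mem _, rfl⟩
  rw [nonlinear_congr hβ hx (h0 0) ha (h0 (𝔾.ι 1))]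
  · rw [nonlinear, A.curv_id (idAdd_zero rfl) (fun v hv => idAdd_of_ne 0 hv)
      (total_multilinear (h0 (𝔾.ι 1))), total_sub_total, Pi.zero_apply, map_zero]
    abel
  · rintro v ⟨w, hw, hvw⟩
    have hv := eq_of_add_of_notMem hu hw ((add_comm w v).trans hvw)
    rw [hv, hx.2, ha.2]
    exact ⟨rfl, rfl⟩

theorem nonlinear_supp {β x a : T.monoid → Cochain H} (S : AddSubmonoid T.monoid)
    (hx0 : T.IsGraded A.CC 0 x) (ha0 : T.IsGraded A.CC (𝔾.ι 1) a)
    (hβ : ∀ u, β u ≠ 0 → u ∈ S) (hx : ∀ u, x u ≠ 0 → u ∈ S) (ha : ∀ u, a u ≠ 0 → u ∈ S)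
    {u : T.monoid} (hu : A.nonlinear β x a u ≠ 0) : u ∈ S := by
  have h1 : ∀ {b : T.monoid → Cochain H}, (∀ u, b u ≠ 0 → u ∈ S) → ∀ u, A.total b u ≠ 0 →
      u ∈ S := by
    intro b hb u hu
    by_cases h : u = 0
    · exact h ▸ S.zero_mem
    · rw [A.total_of_ne b h] at hu
      exact hb u hu
  have h2 : ∀ u, idAdd x u ≠ 0 → u ∈ S := by
    intro u hu
    by_cases h : u = 0
    · exact h ▸ S.zero_mem
    · rw [idAdd_of_ne x h] at hu
      exact hx u hu
  by_contra hS
  refine hu ?_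
  rw [nonlinear, A.curv_eq_zero_of_notMem (idAdd_zero hx0.2) (total_multilinear ha0)
    (idAdd_multilinear hx0) h2 (h1 ha) (h1 hβ) hS, not_not.1 (mt (hx u) hS),
    not_not.1 (mt (ha u) hS), map_zero, sub_zero, sub_zero]

theorem curv_mem_of_isGraded {β x a : T.monoid → Cochain H}
    (hβ : T.IsGraded A.CC (𝔾.ι 1) β) (hx : T.IsGraded A.CC 0 x)
    (ha : T.IsGraded A.CC (𝔾.ι 1) a) (u : T.monoid) :
    A.curv (idAdd x) (A.total a) (A.total β) u ∈ A.CC (𝔾.ι 1 - T.f u) :=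
  PreCat.curv_mem (idAdd_zero hx.2) (idAdd_mem hx) (total_mem ha) (total_mem hβ) u

variable (A) in
/-- Formal functors between deformations of an `A_∞` category as an abstract deformation theory. -/
noncomputable def deformationTheory (T : ToricDatum 𝔾 P) :
    DeformationTheory k T (Cochain H) where
  gr := A.CC
  d := A.hochschildL
  IsMC := fun a => ∀ u, ∑ v ∈ antidiagonal u, A.circ 1 (A.total a v.1) (A.total a v.2) = 0
  W := A.nonlinear
  isMC_twist := fun θ _ ha h => isMC_twist θ ha h
  W_congr := fun _ _ _ _ _ _ hβ hx hx' ha ha' h => nonlinear_congr hβ hx hx' ha ha' h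
  W_mem := fun _ _ _ u hβ hx ha =>
    sub_mem (sub_mem (curv_mem_of_isGraded hβ hx ha u) (A.hochschildL_mem (hx.1 u))) (ha.1 u)
  W_cocycle := fun β x a u hβ hβm hx ha ham h => by
    simp only [add_nonlinear] at h ⊢
    rw [hochschildL_one_sub]
    have h1 := A.curv_cocycle (idAdd_zero hx.2)
      (fun v X Y c => A.cochain_sign_even (T.σ_zero_sub v) (idAdd_mem hx v) c)
      (idAdd_multilinear hx) (total_multilinear ha)
      (fun v X Y c => A.cochain_sign_odd (T.σ_one_sub v) (total_mem hβ v) c) ham hβm h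
    rwa [A.total_zero ha.2, A.total_zero hβ.2] at h1
  d_irr := fun a u ha ham hu => hochschildL_of_irr ha.2 (ham u) hu
  W_irr := fun _ _ _ _ hβ hx ha hu => nonlinear_irr hβ hx ha hu
  W_supp := fun _ _ _ S _ hx0 ha0 hβ hx ha _ hu => nonlinear_supp S hx0 ha0 hβ hx ha hu

/-! ### Formal functors -/

/-- An inadmissible part of weight 0 is sent to 0 by F_0 = id. The formally infinite sum over all
subdivisions therefore reduces to the finite sum over admissible ones. -/
theorem apply_eq_zero_of_not_adm {F : T.monoid → Cochain H} (hF : F 0 = idCochain H) {X Y : Ob}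
    {p : Pieces T.monoid H X Y} (hp : ¬ p.Adm) {V : Type*} [AddCommGroup V] [Module k V]
    {φ : MorChain H X Y → V} (hφ : Multilinear k φ) : φ (p.apply F) = 0 := by
  induction p with
  | nil X => exact absurd (by simp [Pieces.Adm]) hp
  | cons w c r ih =>
    by_cases h : w = 0 → c.length = 1
    · exact ih (fun hr => hp ⟨h, hr⟩) (φ := fun e => φ (.cons (F w _ _ c) e)) (hφ.cons _)
    · push Not at h
      change φ (.cons (F w _ _ c) (r.apply F)) = 0
      rw [h.1, hF, idCochain_eq_zero h.2]
      exact (hφ.head _).map_zero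

theorem finsum_pieces {F α : T.monoid → Cochain H} (hF : F 0 = idCochain H)
    (hα : ∀ v X Y, Multilinear k (α v X Y)) (u : T.monoid) {X Y : Ob} (c : MorChain H X Y) :
    ∑ᶠ (x : T.monoid × Pieces T.monoid H X Y) (_ : x.2.chain = c ∧ x.1 + x.2.weight = u),
        α x.1 X Y (x.2.apply F) = ∑ v ∈ antidiagonal u, pull F (α v.1 X Y) v.2 c := by
  classical
  let t : Finset (T.monoid × Pieces T.monoid H X Y) :=
    ((antidiagonal u).sigma fun v => Pieces.adm v.2 c).image fun y => (y.1.1, y.2)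
  have h1 : ∑ v ∈ antidiagonal u, pull F (α v.1 X Y) v.2 c =
      ∑ x ∈ t, α x.1 X Y (x.2.apply F) := by
    simp only [pull]
    rw [Finset.sum_sigma', Finset.sum_image]
    rintro ⟨⟨a, b⟩, p⟩ h ⟨⟨a', b'⟩, p'⟩ h' e
    simp only [Finset.coe_sigma, Set.mem_sigma_iff, Finset.mem_coe, Pieces.mem_adm] at h h'
    obtain ⟨rfl, rfl⟩ := Prod.mk.inj e
    have h2 : b = b' := h.2.2.2.symm.trans h'.2.2.2
    subst h2
    rfl
  rw [h1]
  refine finsum_mem_eq_sum_of_inter_support_eq (s := {x : T.monoid × Pieces T.monoid H X Y |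
    x.2.chain = c ∧ x.1 + x.2.weight = u}) (fun x => α x.1 X Y (x.2.apply F)) ?_
  ext x
  refine and_congr_left fun hx => ?_
  simp only [Set.mem_ofPred_eq, t, Finset.coe_image, Finset.coe_sigma, Set.mem_image,
    Set.mem_sigma_iff, Finset.mem_coe, Pieces.mem_adm, mem_antidiagonal]
  constructor
  · rintro ⟨h2, h3⟩
    refine ⟨⟨(x.1, x.2.weight), x.2⟩, ⟨h3, by_contra fun h4 => ?_⟩, rfl⟩
    exact hx (apply_eq_zero_of_not_adm hF (fun h5 => h4 ⟨h5, h2, rfl⟩) (hα x.1 X Y))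
  · rintro ⟨⟨⟨a, b⟩, p⟩, ⟨h2, -, h4, h5⟩, rfl⟩
    exact ⟨h4, by rw [h5]; exact h2⟩

theorem isFunctor_iff {β a F : T.monoid → Cochain H} (ha : T.IsGraded A.CC (𝔾.ι 1) a) :
    A.IsFunctor β a F ↔ T.MemTensorR A.CC 0 F ∧ F 0 = idCochain H ∧
      ∀ u, A.curv F (A.total a) (A.total β) u = 0 := by
  refine and_congr_right fun _ => and_congr_right fun hF => forall_congr' fun u => ?_
  have h : ∀ X Y c, A.curv F (A.total a) (A.total β) u X Y c =
      ∑ v ∈ antidiagonal u, pull F (A.total a v.1 X Y) v.2 c -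
        ∑ v ∈ antidiagonal u, A.circ 1 (F v.1) (A.total β v.2) X Y c := by
    intro X Y c
    rw [sum_antidiagonal_swap fun v w => A.circ 1 (F v) (A.total β w) X Y c,
      ← Finset.sum_sub_distrib]
    rfl
  constructor
  · intro h1
    funext X Y c
    rw [h, ← h1, finsum_pieces hF (total_multilinear ha), sub_self]
    rfl
  · intro h1 X Y c
    rw [finsum_pieces hF (total_multilinear ha), ← sub_eq_zero, ← h, h1]
    rfl

variable [DecidableEq P]

theorem push_isGraded (hR : T.IsNice k) {ψ : T.ring k ≃ₐ[k] T.ring k} (hψ : ψ ∈ T.aut k)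
    {α : T.monoid → Cochain H} (hα : T.IsGraded A.CC (𝔾.ι 1) α) :
    T.IsGraded A.CC (𝔾.ι 1) (push ψ α) := by
  obtain ⟨c, hc⟩ := hR.exists_isRescaling hψ
  rw [push_eq_twist hc]
  exact hα.twist fun p u hu => hc.1 p u hu

/-- The correspondence is F = id + x. It alters only the coefficient at 0, so the finiteness
conditions agree. -/
theorem exists_functor_iff {β a : T.monoid → Cochain H} (ha : T.IsGraded A.CC (𝔾.ι 1) a) :
    (∃ F, A.IsFunctor β a F) ↔ ∃ x, T.MemTensorM A.CC 0 x ∧ ∀ u : T.monoid,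
      A.hochschildL (0 - T.f u) (x u) + a u + A.nonlinear β x a u = 0 := by
  have hfin : ∀ {x y : T.monoid → Cochain H}, (∀ u, u ≠ 0 → x u = y u) →
      (∀ n, {u | u ∉ T.filt n ∧ x u ≠ 0}.Finite) → ∀ n, {u | u ∉ T.filt n ∧ y u ≠ 0}.Finite := by
    intro x y hxy hx n
    refine ((hx n).insert 0).subset fun u hu => ?_
    by_cases h : u = 0
    · exact Or.inl h
    · exact Or.inr ⟨hu.1, by rw [hxy u h]; exact hu.2⟩
  constructor
  · rintro ⟨F, hF⟩
    obtain ⟨hFR, hF0, h⟩ := (isFunctor_iff ha).1 hF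
    classical
    let x : T.monoid → Cochain H := fun u => if u = 0 then 0 else F u
    have hx : idAdd x = F := by
      funext u
      by_cases hu : u = 0
      · rw [hu, idAdd_zero (if_pos rfl), hF0]
      · rw [idAdd_of_ne x hu]
        exact if_neg hu
    refine ⟨x, ⟨⟨fun u => ?_, hfin (fun u hu => (if_neg hu).symm) hFR.2⟩, if_pos rfl⟩, fun u => ?_⟩
    · by_cases hu : u = 0
      · rw [show x u = 0 from if_pos hu]
        exact zero_mem _
      · rw [show x u = F u from if_neg hu]
        exact hFR.1 u
    · rw [add_nonlinear, hx, h]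
  · rintro ⟨x, hx, h⟩
    have hx' : T.IsGraded A.CC 0 x := ⟨hx.1.1, hx.2⟩
    refine ⟨idAdd x, (isFunctor_iff ha).2 ⟨⟨idAdd_mem hx', hfin (fun u hu => (idAdd_of_ne x hu).symm)
      hx.1.2⟩, idAdd_zero hx.2, fun u => ?_⟩⟩
    rw [← add_nonlinear, h]

theorem versality (hR : T.IsNice k) {α : T.monoid → Cochain H} (hα : α ∈ A.Deformations T)
    (hs : A.FirstOrderSpans hR α) :
    (∀ β ∈ A.Deformations' hR, ∃ ψ ∈ T.aut k, ∃ c : P → (T.ring k)ˣ,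
      IsRescaling ψ c ∧ ∃ F, A.IsFunctor β (push ψ α) F) ∧
    A.RComplete hR α ∧
    ((∀ p, A.FirstOrderNeZero hR α p) → A.RVersal hR α) := by
  have hα' : T.IsGraded A.CC (𝔾.ι 1) α := ⟨hα.1.1.1, hα.1.2⟩
  have h1 : ∀ β ∈ A.Deformations' hR, ∃ ψ ∈ T.aut k, ∃ c : P → (T.ring k)ˣ,
      IsRescaling ψ c ∧ ∃ F, A.IsFunctor β (push ψ α) F := by
    intro β hβ
    obtain ⟨ψ, hψ, c, hc, x, hx, h⟩ := (A.deformationTheory T).exists_solution hR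
      hα' hα.2 hα.1.1.2 ⟨hβ.1.1.1.1, hβ.1.1.2⟩ hβ.1.2 hβ.1.1.1.2 hs hβ.2
    exact ⟨ψ, hψ, c, hc, (exists_functor_iff (push_isGraded hR hψ hα')).2 ⟨x, hx, h⟩⟩
  have h2 : A.RComplete hR α := fun β hβ => by
    obtain ⟨ψ, hψ, c, -, h⟩ := h1 β hβ
    exact ⟨ψ, hψ, h⟩
  refine ⟨h1, h2, fun hne => ⟨h2, ?_⟩⟩
  intro β hβ ψ hψ ψ' hψ' hF hF' y hy
  obtain ⟨x, hx, h⟩ := (exists_functor_iff (push_isGraded hR hψ hα')).1 hF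
  obtain ⟨x', hx', h'⟩ := (exists_functor_iff (push_isGraded hR hψ' hα')).1 hF'
  exact (A.deformationTheory T).sub_mem_of_solutions hR hα' ⟨hβ.1.1.1.1, hβ.1.1.2⟩ hne hψ hψ'
    ⟨hx.1.1, hx.2⟩ ⟨hx'.1.1, hx'.2⟩ h h' hy

end AInfCat

/-! ### The theorem in both settings -/

theorem mainTheorem3 {k : Type*} [Field k] [CharZero k]
    {G : Type*} [AddCommGroup G] [DecidableEq G] {𝔾 : GradingDatum G}
    {P : Type*} [Fintype P] [DecidableEq P] (T : ToricDatum 𝔾 P) (hR : T.IsNice k) :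
    (∀ {L : Type*} [AddCommGroup L] [Module k L] (𝔤 : DGLA k 𝔾 L),
      ∀ α ∈ 𝔤.MC T, 𝔤.FirstOrderSpans hR α →
        (∀ β ∈ 𝔤.MC' hR, ∃ ψ ∈ T.aut k, ∃ c : P → (T.ring k)ˣ,
          ToricDatum.IsRescaling ψ c ∧ 𝔤.GaugeEquiv T β (ToricDatum.push ψ α)) ∧
        𝔤.RComplete hR α ∧
        ((∀ p, 𝔤.FirstOrderNeZero hR α p) → 𝔤.RVersal hR α)) ∧
    (∀ {Ob : Type*} {H : Ob → Ob → Type*} [∀ X Y, AddCommGroup (H X Y)]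
      [∀ X Y, Module k (H X Y)] (A : AInfCat k 𝔾 H),
      ∀ α ∈ A.Deformations T, A.FirstOrderSpans hR α →
        (∀ β ∈ A.Deformations' hR, ∃ ψ ∈ T.aut k, ∃ c : P → (T.ring k)ˣ,
          ToricDatum.IsRescaling ψ c ∧ ∃ F, A.IsFunctor β (ToricDatum.push ψ α) F) ∧
        A.RComplete hR α ∧
        ((∀ p, A.FirstOrderNeZero hR α p) → A.RVersal hR α)) :=
  ⟨fun 𝔤 _ hα hs => 𝔤.versality hR hα hs, fun A _ hα hs => A.versality hR hα hs⟩
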